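/- **Conventions.** $|\cdot|$ is Lebesgue measure on $\mathbb R^n$, $B_1^n$ and $B_\infty^n$ are the unit balls of the $\ell_1$- and $\ell_\infty$-norms, $A^\circ=\{y:\langle x,y\rangle\le 1\ \forall x\in A\}$, $d_{\mathcal H}$ is the Euclidean Hausdorff distance, and a symmetric convex body is a compact convex set $K=-K$ with nonempty interior. A *standard Hanner polytope* $H\subset\mathbb R^n$ is one obtained from the intervals $[-e_1,e_1],\dots,[-e_n,e_n]$, each used exactly once, by successive $\ell_1$-sums $H_1\oplus_1H_2=\operatorname{conv}(H_1\cup H_2)$ and $\ell_\infty$-sums $H_1\oplus_\infty H_2=H_1+H_2$; fix such a representation of $H$. Its polar $H^\circ$ has the representation in which $\ell_1$- and $\ell_\infty$-sums are interchanged. Faces are the intersections with supporting hyperplanes; $F^*=\{y\in H^\circ:\langle x,y\rangle=1\ \forall x\in F\}$ is the dual face of a face $F$ of $H$; $c_F$ is the centroid of $F$. **The subspaces $A_F$.** For every face $F$ of $H$ (and likewise of $H^\circ$, with its representation) an affine subspace $A_F$ is defined by recursion on the representation. If $H$ is an interval, $A_F=F$. If $H=H_1\oplus_1H_2$, then, for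 faces $F_j$ of $H_j$ with $k_j=\dim F_j$, $$A_{F_1\oplus_1\varnothing}=A_{F_1}+\operatorname{span}H_2,\quad A_{\varnothing\oplus_1F_2}=\operatorname{span}H_1+A_{F_2},\quad A_{F_1\oplus_1F_2}=\tfrac{k_1+1}{k_1+k_2+2}A_{F_1}+\tfrac{k_2+1}{k_1+k_2+2}A_{F_2}.$$ If $H=H_1\oplus_\infty H_2$, then $A_{F_1\oplus H_2}=A_{F_1}$, $A_{H_1\oplus F_2}=A_{F_2}$, and $$A_{F_1\oplus F_2}=A_{F_1}+A_{F_2}+\operatorname{span}\Big\{\tfrac{c_{F_1}}{\dim H_1-\dim F_1}-\tfrac{c_{F_2}}{\dim H_2-\dim F_2}\Big\}.$$ **The points $x_F$ and the function $V$.** Given a symmetric convex body $K$ and a face $F$ of $H$, let $t_F>0$ be such that $t_FA_F$ is tangent to $K$ (it meets $\partial K$ but not the interior of $K$), and let $x_F$ be the point of $t_FA_F\cap\partial K$ nearest to $c_F$. Put $X=(x_F)_F$, and $X^*=(x_{F^*})_F$, where $x_{F^*}$ is obtained in the same way from $K^\circ$, $A_{F^*}$ and $c_{F^*}$. For a family $Z=(z_F)$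 of points indexed by the faces of $H$ let $$V(Z)=\sum_{F^0\subset F^1\subset\dots\subset F^{n-1}}\big|\operatorname{conv}\{0,z_{F^0},\dots,z_{F^{n-1}}\}\big|,$$ the sum being over all flags of $H$ (each $F^k$ a face of $H$ of dimension $k$). For a vertex $v$ of $H$ let $\mathbb R^{(v)}=\operatorname{span}\{e_j:\langle v,e_j\rangle\ne0\}$ and $B_\infty^{(v)}=B_\infty^n\cap\mathbb R^{(v)}$, and let $K|\mathbb R^{(v)}$ be the orthogonal projection of $K$ to $\mathbb R^{(v)}$. **Proposition.** For every $n$ there are constants $c(n)>0$ and $\eta(n)>0$, depending only on $n$, such that the following holds. Let $H$ be a standard Hanner polytope in $\mathbb R^n$ and $K$ a symmetric convex body with $B_1^n\subset K\subset B_\infty^n$ and $d_{\mathcal H}(K,H)\le\eta(n)$. If $d_{\mathcal H}\big(K|\mathbb R^{(v)},B_\infty^{(v)}\big)=\delta>0$ for some vertex $v$ of $H$, then $$|K||K^\circ|\ \ge\ V(X)V(X^*)+c(n)\,\delta .$$ -/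

import Mathlib

open MeasureTheory
open scoped Pointwise

noncomputable section

namespace HannerMahler

/-- The Euclidean space `ℝⁿ`. -/
abbrev E (n : ℕ) : Type := EuclideanSpace ℝ (Fin n)

/-- The standard basis vector `e_i`. -/
def stdVec {n : ℕ} (i : Fin n) : E n := EuclideanSpace.single i 1

/-- The cross-polytope `B_1^n`. -/
def crossPolytope (n : ℕ) : Set (E n) := {x | ∑ i, |x i| ≤ 1}

/-- The cube `B_∞^n`. -/
def cube (n : ℕ) : Set (E n) := {x | ∀ i, |x i| ≤ 1}

/-- Symmetric convex bodies: compact convex sets with nonempty interior and `K = -K`. -/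
structure IsSymmConvexBody {n : ℕ} (K : Set (E n)) : Prop where
  convex : Convex ℝ K
  isCompact : IsCompact K
  interior_nonempty : (interior K).Nonempty
  symm : -K = K

/-- The polar `A° = {b : ⟨a, b⟩ ≤ 1 for all a ∈ A}`. -/
def polarBody {n : ℕ} (A : Set (E n)) : Set (E n) := {b | ∀ a ∈ A, inner ℝ a b ≤ 1}

/-- The dimension of a nonempty set `A`, i.e. the dimension of `span (A - A)`. -/
def dim {n : ℕ} (A : Set (E n)) : ℕ := Module.finrank ℝ (vectorSpan ℝ A)

/-- The centroid of a bounded convex set: the mean of `x` with respect to the volume measure of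
the dimension of the set. -/
def centroid {n : ℕ} (F : Set (E n)) : E n := ⨍ x in F, x ∂μHE[dim F]

/-! ### Faces, flags, and the volume function -/

/-- `F` is a (proper, nonempty) face of the full-dimensional polytope `P`: the intersection of `P`
with a supporting hyperplane `{x : ⟨θ, x⟩ = a}`. -/
def IsFace {n : ℕ} (P F : Set (E n)) : Prop :=
  ∃ (θ : E n) (a : ℝ), θ ≠ 0 ∧ (∀ x ∈ P, inner ℝ θ x ≤ a) ∧ (∃ x ∈ P, inner ℝ θ x = a) ∧
    F = {x ∈ P | inner ℝ θ x = a}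

/-- `v` is a vertex of `P`, i.e. `{v}` is a (zero-dimensional) face. -/
def IsVertex {n : ℕ} (P : Set (E n)) (v : E n) : Prop := IsFace P {v}

/-- The dual face `F^* = {y ∈ P° : ⟨x, y⟩ = 1 for all x ∈ F}` of a face `F` of `P`. -/
def dualFace {n : ℕ} (P F : Set (E n)) : Set (E n) :=
  {y ∈ polarBody P | ∀ x ∈ F, inner ℝ x y = 1}

/-- The flags `F⁰ ⊆ F¹ ⊆ ⋯ ⊆ Fⁿ⁻¹` over `P`, where `F^k` is a face of dimension `k`. -/
def flags {n : ℕ} (P : Set (E n)) : Set (Fin n → Set (E n)) :=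
  {F | (∀ k, IsFace P (F k) ∧ dim (F k) = (k : ℕ)) ∧ Monotone F}

/-- `V(Z) = ∑ |conv {0, z_{F⁰}, …, z_{Fⁿ⁻¹}}|`, the sum being over all flags over `P`, for a family
`Z = (z_F)` of points indexed by the faces `F` of `P` (values of `Z` at other sets are not used). -/
def volFun {n : ℕ} (P : Set (E n)) (Z : Set (E n) → E n) : ENNReal :=
  ∑' F : flags P, volume (convexHull ℝ (insert 0 (Set.range fun k => Z (F.1 k))))

/-! ### Points of tangency -/

/-- `x` is a point of `∂K` nearest to `c` on the dilate `tA`, where `t > 0` is such that `tA` is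
tangent to `K` (it meets the boundary of `K` but not the interior). -/
def IsTangencyPoint {n : ℕ} (A : Set (E n)) (c : E n) (K : Set (E n)) (x : E n) : Prop :=
  ∃ t : ℝ, 0 < t ∧ Disjoint (t • A) (interior K) ∧ x ∈ (t • A) ∩ frontier K ∧
    ∀ z ∈ (t • A) ∩ frontier K, dist x c ≤ dist z c

/-- The point of tangency constructed from `A`, `c` and `K`. -/
def tangencyPoint {n : ℕ} (A : Set (E n)) (c : E n) (K : Set (E n)) : E n :=
  Classical.epsilon (IsTangencyPoint A c K)

/-! ### Standard Hanner polytopes -/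

/-- Representations of (lower dimensional) Hanner polytopes in `ℝⁿ` in terms of the symmetric
intervals `[-e_i, e_i]` and `ℓ_1`- and `ℓ_∞`-sums. -/
inductive HannerRep (n : ℕ) : Type
  | interval (i : Fin n) : HannerRep n
  | sumOne (H₁ H₂ : HannerRep n) : HannerRep n
  | sumInf (H₁ H₂ : HannerRep n) : HannerRep n

namespace HannerRep

variable {n : ℕ}

/-- The set of the indices of all intervals occurring in the representation. -/
def coords : HannerRep n → Finset (Fin n)
  | interval i => {i}
  | sumOne H₁ H₂ => H₁.coords ∪ H₂.coords
  | sumInf H₁ H₂ => H₁.coords ∪ H₂.coords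

/-- No interval is used twice, so that all the sums are direct. -/
def IsDirect : HannerRep n → Prop
  | interval _ => True
  | sumOne H₁ H₂ => H₁.IsDirect ∧ H₂.IsDirect ∧ Disjoint H₁.coords H₂.coords
  | sumInf H₁ H₂ => H₁.IsDirect ∧ H₂.IsDirect ∧ Disjoint H₁.coords H₂.coords

/-- The representation is one of a standard Hanner polytope in `ℝⁿ`: each of the intervals
`[-e_1, e_1], …, [-e_n, e_n]` is used exactly once. -/
def IsStandard (H : HannerRep n) : Prop := H.IsDirect ∧ H.coords = Finset.univ

/-- The Hanner polytope with the given representation. -/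
def body : HannerRep n → Set (E n)
  | interval i => segment ℝ (-stdVec i) (stdVec i)
  | sumOne H₁ H₂ => convexHull ℝ (H₁.body ∪ H₂.body)
  | sumInf H₁ H₂ => H₁.body + H₂.body

/-- The linear span of the Hanner polytope. -/
def lin (H : HannerRep n) : Submodule ℝ (E n) := Submodule.span ℝ H.body

/-- The representation of the polar polytope `H°` (taken in the span of `H`), obtained by
interchanging `ℓ_1`- and `ℓ_∞`-sums. -/
def dual : HannerRep n → HannerRep n
  | interval i => interval i
  | sumOne H₁ H₂ => sumInf H₁.dual H₂.dual
  | sumInf H₁ H₂ => sumOne H₁.dual H₂.dual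

open Classical in
/-- The affine subspace `A_F` associated with a face `F` of `H`.
For an `ℓ_1`-sum, `F = F₁ ⊕₁ F₂` with `F_j = F ∩ span H_j` a face of `H_j` or empty.
For an `ℓ_∞`-sum, `F = F₁ ⊕ F₂` where `F_j`, the projection of `F` to `span H_j`, is a face of `H_j`
or `H_j` itself. (The value at a set `F` that is not a face is not used.) -/
def affSub : HannerRep n → Set (E n) → Set (E n)
  | interval _, F => F
  | sumOne H₁ H₂, F =>
      let F₁ : Set (E n) := F ∩ H₁.lin
      let F₂ : Set (E n) := F ∩ H₂.lin
      if F₂ = ∅ then H₁.affSub F₁ + (H₂.lin : Set (E n))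
      else if F₁ = ∅ then (H₁.lin : Set (E n)) + H₂.affSub F₂
      else
        (((dim F₁ : ℝ) + 1) / ((dim F₁ : ℝ) + (dim F₂ : ℝ) + 2)) • H₁.affSub F₁ +
          (((dim F₂ : ℝ) + 1) / ((dim F₁ : ℝ) + (dim F₂ : ℝ) + 2)) • H₂.affSub F₂
  | sumInf H₁ H₂, F =>
      let F₁ : Set (E n) := H₁.lin.starProjection '' F
      let F₂ : Set (E n) := H₂.lin.starProjection '' F
      if F₂ = H₂.body then H₁.affSub F₁
      else if F₁ = H₁.body then H₂.affSub F₂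
      else
        H₁.affSub F₁ + H₂.affSub F₂ +
          (Submodule.span ℝ
            {((dim H₁.body : ℝ) - (dim F₁ : ℝ))⁻¹ • centroid F₁ -
              ((dim H₂.body : ℝ) - (dim F₂ : ℝ))⁻¹ • centroid F₂} : Set (E n))

/-- The family `X = (x_F)` of tangency points obtained from `K` and the affine subspaces `A_F`. -/
def points (H : HannerRep n) (K : Set (E n)) (F : Set (E n)) : E n :=
  tangencyPoint (H.affSub F) (centroid F) K

/-- The family `X^* = (x_{F^*})`, indexed by the faces `F` of `H`, obtained from the polar of `K` and
the affine subspaces `A_{F^*}` for the dual faces `F^*`, which are faces of `H°`. -/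
def dualPoints (H : HannerRep n) (K : Set (E n)) (F : Set (E n)) : E n :=
  H.dual.points (polarBody K) (dualFace H.body F)

end HannerRep

/-- `ℝ^(v) = span {e_j : j ∈ supp v}`. -/
def suppSubspace {n : ℕ} (v : E n) : Submodule ℝ (E n) :=
  Submodule.span ℝ (stdVec '' {j | v j ≠ 0})

/-- The lower dimensional cube `B_∞^(v) = B_∞^n ∩ ℝ^(v)`. -/
def suppCube {n : ℕ} (v : E n) : Set (E n) := cube n ∩ suppSubspace v

/-- The orthogonal projection `K | ℝ^(v)`. -/
def suppProj {n : ℕ} (v : E n) (K : Set (E n)) : Set (E n) := (suppSubspace v).starProjection '' K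

end HannerMahler

end

/-! Faces of a standard Hanner polytope are coded by sign vectors `s : Fin n → SignType`, and a face
and its dual face carry the same code. If `s` vanishes on a summand, that summand contributes the
empty face in an ℓ₁-sum and the whole summand in an ℓ_∞-sum. One recursion thus treats H and H°
together, and F ⊆ G becomes the equality ⟨p, q⟩ = 1 for relative interior points p of F and q of the
dual face of G (`RelInt.pair_eq_one_iff`).

Volume. Each A_F meets H in a single point p_F, relatively interior to F
(`exists_touchesAt_affSub`), so x_F is close to p_F when K is close to H
(`TouchesAt.exists_tangency_close`). The cones spanned by the p_F along flags form the fan of a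
barycentric subdivision; a quantitative form of this, obtained by compactness, survives the passage
from p_F to x_F (`exists_spread`). Hence the simplices in V(X) have disjoint interiors and lie in K.
If moreover some y in K lies beyond the facet {⟨ν, ·⟩ = 1} of one of them, with ⟨ν, y⟩ ≥ 1 + ρ, then
a star subdivision gains volume of order ρ (`Spread.sum_volume_add_le`). The same holds for K°.

Rigidity. Suppose the conclusion fails, and let ρ be a small multiple of δ. Then every flag normal ν
of K satisfies ⟨ν, y⟩ < 1 + ρ on K, and likewise every flag normal μ of K° on K°; hence ⟨ν, μ⟩ ≤ 1 +
3ρ for all such pairs. Let w be a vertex and w_i ≠ 0. For every facet with normal u and u_i = w_i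
there is a flag from w to that facet passing through the face {x_i = w_i}
(`IsStandard.exists_flag`). The tangency point of that face is exactly w_i e_i, because B_1 ⊂ K ⊂
B_∞ (`IsStandard.points_single`). So the normal ν of this flag has ν_i = w_i, ⟨ν, x_w⟩ = 1 and ν ≈
u.

Every other coordinate j occurs together with i either in facet normals or in vertices, with
arbitrary signs (`adjacent_or_adjacent`). Coordinates of the first kind are made to vanish by a
convex combination N of normals (`exists_mem_forall_eq_zero`). Those of the second kind are O(ρ) in
N, as one sees by testing N against a μ close to a vertex of suitable signs. Now ⟨N, x_w⟩ = 1 gives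
|(x_w)_i − w_i| = O(ρ) (`abs_sub_le_of_normals`). Hence the projection of K comes so near to every
vertex of the cube B_∞^(v) that its Hausdorff distance to the cube is at most δ/2, a contradiction.
The constants are uniform because there are only finitely many standard representations for each n.
-/

noncomputable section

namespace HannerMahler

/-- Restriction of a vector to a set of coordinates. -/
def restr {n : ℕ} (S : Finset (Fin n)) : E n →ₗ[ℝ] E n where
  toFun x := WithLp.toLp 2 fun i => if i ∈ S then x i else 0
  map_add' x y := by
    ext i
    by_cases h : i ∈ S <;> simp [h]
  map_smul' a x := by
    ext i
    by_cases h : i ∈ S <;> simp [h]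

@[simp]
theorem restr_apply {n : ℕ} (S : Finset (Fin n)) (x : E n) (i : Fin n) :
    restr S x i = if i ∈ S then x i else 0 := rfl

/-! ### Sign vectors, the norm of a Hanner polytope and its recursive structure. -/

namespace HannerRep

variable {n : ℕ}

/-- The norm with unit ball `H`, as a seminorm on `ℝⁿ` that depends only on the coordinates
occurring in `H`. -/
def nrm : HannerRep n → E n → ℝ
  | interval i, x => |x i|
  | sumOne H₁ H₂, x => H₁.nrm x + H₂.nrm x
  | sumInf H₁ H₂, x => max (H₁.nrm x) (H₂.nrm x)

/-- The standard bilinear form on the coordinates occurring in `H`. -/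
def pair (H : HannerRep n) (x y : E n) : ℝ := ∑ i ∈ H.coords, x i * y i

/-- The sign vector `s` vanishes on the coordinates of `H`. -/
def Vanish (H : HannerRep n) (s : Fin n → SignType) : Prop := ∀ i ∈ H.coords, s i = 0

/-- `x` is a nonnegative multiple of a point of the face of `H` with sign vector `s`. -/
def Cone : HannerRep n → (Fin n → SignType) → E n → Prop
  | interval i, s, x => x i * (s i : ℝ) = |x i|
  | sumOne H₁ H₂, s, x =>
      ((H₁.Vanish s → H₁.nrm x = 0) ∧ (¬ H₁.Vanish s → H₁.Cone s x)) ∧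
        ((H₂.Vanish s → H₂.nrm x = 0) ∧ (¬ H₂.Vanish s → H₂.Cone s x))
  | sumInf H₁ H₂, s, x =>
      (¬ H₁.Vanish s → H₁.Cone s x ∧ H₂.nrm x ≤ H₁.nrm x) ∧
        (¬ H₂.Vanish s → H₂.Cone s x ∧ H₁.nrm x ≤ H₂.nrm x)

/-- A recursive description of points in the relative interior of the face of `H` with sign
vector `s`. -/
def RelInt : HannerRep n → (Fin n → SignType) → E n → Prop
  | interval i, s, p => p = EuclideanSpace.single i (s i : ℝ)
  | sumOne H₁ H₂, s, p => ∃ (p₁ p₂ : E n) (a b : ℝ), H₁.RelInt s p₁ ∧ H₂.RelInt s p₂ ∧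
      0 < a ∧ 0 < b ∧ (H₁.Vanish s → b = 1) ∧ (H₂.Vanish s → a = 1) ∧
      (¬ H₁.Vanish s → ¬ H₂.Vanish s → a + b = 1) ∧ p = a • p₁ + b • p₂
  | sumInf H₁ H₂, s, p => ∃ p₁ p₂ : E n, H₁.RelInt s p₁ ∧ H₂.RelInt s p₂ ∧ p = p₁ + p₂

/-- The face of `H` with sign vector `s`. -/
def faceSet (H : HannerRep n) (s : Fin n → SignType) : Set (E n) :=
  {x ∈ H.body | H.Cone s x ∧ H.nrm x = 1}

/-! ### The dual representation -/

@[simp]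
theorem coords_dual (H : HannerRep n) : H.dual.coords = H.coords := by
  induction H with
  | interval i => rfl
  | sumOne H₁ H₂ h₁ h₂ => simp [dual, coords, h₁, h₂]
  | sumInf H₁ H₂ h₁ h₂ => simp [dual, coords, h₁, h₂]

@[simp]
theorem dual_dual (H : HannerRep n) : H.dual.dual = H := by
  induction H with
  | interval i => rfl
  | sumOne H₁ H₂ h₁ h₂ => simp [dual, h₁, h₂]
  | sumInf H₁ H₂ h₁ h₂ => simp [dual, h₁, h₂]

theorem IsDirect.dual {H : HannerRep n} (h : H.IsDirect) : H.dual.IsDirect := by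
  induction H with
  | interval i => trivial
  | sumOne H₁ H₂ h₁ h₂ => exact ⟨h₁ h.1, h₂ h.2.1, by simpa using h.2.2⟩
  | sumInf H₁ H₂ h₁ h₂ => exact ⟨h₁ h.1, h₂ h.2.1, by simpa using h.2.2⟩

theorem IsStandard.dual {H : HannerRep n} (h : H.IsStandard) : H.dual.IsStandard :=
  ⟨h.1.dual, by simpa using h.2⟩

@[simp]
theorem vanish_dual (H : HannerRep n) (s : Fin n → SignType) : H.dual.Vanish s ↔ H.Vanish s := by
  simp [Vanish]

theorem coords_nonempty (H : HannerRep n) : H.coords.Nonempty := by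
  induction H with
  | interval i => simp [coords]
  | sumOne H₁ H₂ h₁ h₂ => simp [coords, h₁]
  | sumInf H₁ H₂ h₁ h₂ => simp [coords, h₁]

theorem vanish_sumOne {H₁ H₂ : HannerRep n} {s : Fin n → SignType} :
    (sumOne H₁ H₂).Vanish s ↔ H₁.Vanish s ∧ H₂.Vanish s := by
  simp only [Vanish, coords, Finset.mem_union, or_imp, forall_and]

theorem vanish_sumInf {H₁ H₂ : HannerRep n} {s : Fin n → SignType} :
    (sumInf H₁ H₂).Vanish s ↔ H₁.Vanish s ∧ H₂.Vanish s := by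
  simp only [Vanish, coords, Finset.mem_union, or_imp, forall_and]

/-! ### The norm -/

theorem nrm_nonneg (H : HannerRep n) (x : E n) : 0 ≤ H.nrm x := by
  induction H with
  | interval i => exact abs_nonneg _
  | sumOne H₁ H₂ h₁ h₂ => exact add_nonneg h₁ h₂
  | sumInf H₁ H₂ h₁ h₂ => exact le_max_of_le_left h₁

theorem nrm_add_le (H : HannerRep n) (x y : E n) : H.nrm (x + y) ≤ H.nrm x + H.nrm y := by
  induction H with
  | interval i => exact abs_add_le _ _
  | sumOne H₁ H₂ h₁ h₂ => simp only [nrm]; linarith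
  | sumInf H₁ H₂ h₁ h₂ =>
    simp only [nrm]
    exact max_le (h₁.trans (add_le_add (le_max_left _ _) (le_max_left _ _)))
      (h₂.trans (add_le_add (le_max_right _ _) (le_max_right _ _)))

theorem nrm_smul (H : HannerRep n) (a : ℝ) (x : E n) : H.nrm (a • x) = |a| * H.nrm x := by
  induction H with
  | interval i => simp [nrm, abs_mul]
  | sumOne H₁ H₂ h₁ h₂ => simp only [nrm, h₁, h₂]; ring
  | sumInf H₁ H₂ h₁ h₂ => simp only [nrm, h₁, h₂, mul_max_of_nonneg _ _ (abs_nonneg a)]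

@[simp]
theorem nrm_zero (H : HannerRep n) : H.nrm 0 = 0 := by
  simpa using H.nrm_smul 0 0

theorem nrm_congr (H : HannerRep n) {x y : E n} (h : ∀ i ∈ H.coords, x i = y i) :
    H.nrm x = H.nrm y := by
  induction H with
  | interval i => simp [nrm, h i (by simp [coords])]
  | sumOne H₁ H₂ h₁ h₂ =>
    simp only [nrm]
    rw [h₁ fun i hi => h i (by simp [coords, hi]), h₂ fun i hi => h i (by simp [coords, hi])]
  | sumInf H₁ H₂ h₁ h₂ =>
    simp only [nrm]
    rw [h₁ fun i hi => h i (by simp [coords, hi]), h₂ fun i hi => h i (by simp [coords, hi])]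

theorem abs_le_nrm (H : HannerRep n) {x : E n} {i : Fin n} (hi : i ∈ H.coords) :
    |x i| ≤ H.nrm x := by
  induction H with
  | interval j => simp only [coords, Finset.mem_singleton] at hi; simp [nrm, hi]
  | sumOne H₁ H₂ h₁ h₂ =>
    simp only [coords, Finset.mem_union] at hi
    rcases hi with hi | hi
    · exact (h₁ hi).trans (le_add_of_nonneg_right (nrm_nonneg _ _))
    · exact (h₂ hi).trans (le_add_of_nonneg_left (nrm_nonneg _ _))
  | sumInf H₁ H₂ h₁ h₂ =>
    simp only [coords, Finset.mem_union] at hi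
    rcases hi with hi | hi
    · exact (h₁ hi).trans (le_max_left _ _)
    · exact (h₂ hi).trans (le_max_right _ _)

theorem nrm_eq_zero_iff (H : HannerRep n) {x : E n} :
    H.nrm x = 0 ↔ ∀ i ∈ H.coords, x i = 0 := by
  refine ⟨fun h i hi => abs_nonpos_iff.1 (h ▸ H.abs_le_nrm hi), fun h => ?_⟩
  rw [H.nrm_congr (y := 0) (by simpa using h), nrm_zero]

theorem continuous_nrm (H : HannerRep n) : Continuous H.nrm := by
  induction H with
  | interval i => simp only [nrm]; fun_prop
  | sumOne H₁ H₂ h₁ h₂ => exact h₁.add h₂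
  | sumInf H₁ H₂ h₁ h₂ => exact h₁.max h₂

theorem nrm_le_sum (H : HannerRep n) (hd : H.IsDirect) (x : E n) :
    H.nrm x ≤ ∑ i ∈ H.coords, |x i| := by
  induction H with
  | interval i => simp [nrm, coords]
  | sumOne H₁ H₂ h₁ h₂ =>
    rw [coords, Finset.sum_union hd.2.2]
    exact add_le_add (h₁ hd.1) (h₂ hd.2.1)
  | sumInf H₁ H₂ h₁ h₂ =>
    rw [coords, Finset.sum_union hd.2.2]
    exact (max_le_add_of_nonneg (nrm_nonneg _ _) (nrm_nonneg _ _)).trans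
      (add_le_add (h₁ hd.1) (h₂ hd.2.1))

/-! ### The pairing -/

theorem pair_add_left (H : HannerRep n) (x y z : E n) :
    H.pair (x + y) z = H.pair x z + H.pair y z := by
  simp [pair, add_mul, Finset.sum_add_distrib]

theorem pair_smul_left (H : HannerRep n) (a : ℝ) (x y : E n) :
    H.pair (a • x) y = a * H.pair x y := by
  simp [pair, Finset.mul_sum, mul_assoc]

theorem pair_comm (H : HannerRep n) (x y : E n) : H.pair x y = H.dual.pair y x := by
  simp [pair, mul_comm]

theorem pair_congr (H : HannerRep n) {x x' y y' : E n} (h : ∀ i ∈ H.coords, x i = x' i)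
    (h' : ∀ i ∈ H.coords, y i = y' i) : H.pair x y = H.pair x' y' :=
  Finset.sum_congr rfl fun i hi => by rw [h i hi, h' i hi]

theorem pair_eq_zero_left (H : HannerRep n) {x : E n} (y : E n) (h : ∀ i ∈ H.coords, x i = 0) :
    H.pair x y = 0 := Finset.sum_eq_zero fun i hi => by rw [h i hi, zero_mul]

theorem pair_eq_zero_right (H : HannerRep n) (x : E n) {y : E n} (h : ∀ i ∈ H.coords, y i = 0) :
    H.pair x y = 0 := Finset.sum_eq_zero fun i hi => by rw [h i hi, mul_zero]

theorem pair_sumOne {H₁ H₂ : HannerRep n} (h : Disjoint H₁.coords H₂.coords) (x y : E n) :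
    (sumOne H₁ H₂).pair x y = H₁.pair x y + H₂.pair x y := Finset.sum_union h

theorem pair_sumInf {H₁ H₂ : HannerRep n} (h : Disjoint H₁.coords H₂.coords) (x y : E n) :
    (sumInf H₁ H₂).pair x y = H₁.pair x y + H₂.pair x y := Finset.sum_union h

theorem IsStandard.pair_eq_inner {H : HannerRep n} (h : H.IsStandard) (x y : E n) :
    H.pair x y = inner ℝ x y := by
  simp [pair, h.2, PiLp.inner_apply, mul_comm]

/-- Hölder's inequality: in each sum one of the two norms adds up while the other is a maximum. -/
theorem abs_pair_le {H : HannerRep n} (hd : H.IsDirect) (x y : E n) :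
    |H.pair x y| ≤ H.nrm x * H.dual.nrm y := by
  induction H with
  | interval i => simp [pair, nrm, dual, coords, abs_mul]
  | sumOne H₁ H₂ h₁ h₂ =>
    rw [pair_sumOne hd.2.2]
    refine (abs_add_le _ _).trans ((add_le_add (h₁ hd.1) (h₂ hd.2.1)).trans ?_)
    simp only [nrm, dual, add_mul]
    gcongr
    · exact nrm_nonneg _ _
    · exact le_max_left _ _
    · exact nrm_nonneg _ _
    · exact le_max_right _ _
  | sumInf H₁ H₂ h₁ h₂ =>
    rw [pair_sumInf hd.2.2]
    refine (abs_add_le _ _).trans ((add_le_add (h₁ hd.1) (h₂ hd.2.1)).trans ?_)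
    simp only [nrm, dual, mul_add]
    gcongr
    · exact nrm_nonneg _ _
    · exact le_max_left _ _
    · exact nrm_nonneg _ _
    · exact le_max_right _ _

theorem pair_le {H : HannerRep n} (hd : H.IsDirect) (x y : E n) :
    H.pair x y ≤ H.nrm x * H.dual.nrm y := (le_abs_self _).trans (abs_pair_le hd x y)

/-! ### Bodies and spans -/

theorem mem_span_single {S : Finset (Fin n)} {x : E n} (h : ∀ i ∉ S, x i = 0) :
    x = ∑ i ∈ S, x i • stdVec i := by
  ext j
  simp only [WithLp.ofLp_sum, Finset.sum_apply, stdVec, PiLp.smul_apply,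
    PiLp.single_apply, smul_eq_mul, mul_ite, mul_one, mul_zero]
  rw [Finset.sum_ite_eq S j]
  split_ifs with hj
  · rfl
  · exact h j hj

theorem mem_body_interval {i : Fin n} {x : E n} :
    x ∈ (interval i).body ↔ (∀ j ∉ (interval i).coords, x j = 0) ∧ (interval i).nrm x ≤ 1 := by
  simp only [body, coords, nrm, Finset.mem_singleton]
  constructor
  · rintro ⟨a, b, ha, hb, hab, rfl⟩
    constructor
    · intro j hj
      simp [stdVec, hj]
    · simp only [stdVec, smul_neg, PiLp.add_apply, PiLp.neg_apply, PiLp.smul_apply,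
        PiLp.single_apply, if_true, smul_eq_mul, mul_one]
      rw [abs_le]; constructor <;> linarith
  · rintro ⟨h, h1⟩
    rw [abs_le] at h1
    refine ⟨(1 - x i) / 2, (1 + x i) / 2, by linarith, by linarith, by ring, ?_⟩
    ext j
    by_cases hj : j = i
    · subst hj
      simp [stdVec]; ring
    · simp [stdVec, hj, h j hj]

theorem restr_add_restr {S T : Finset (Fin n)} (hST : Disjoint S T) {x : E n}
    (hx : ∀ i ∉ S ∪ T, x i = 0) : restr S x + restr T x = x := by
  ext i
  by_cases h1 : i ∈ S
  · have h2 : i ∉ T := Finset.disjoint_left.1 hST h1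
    simp [h1, h2]
  · by_cases h2 : i ∈ T
    · simp [h1, h2]
    · simp [h1, h2, hx i (by simp [h1, h2])]

theorem restr_eq_self {S : Finset (Fin n)} {x : E n} (hx : ∀ i ∉ S, x i = 0) :
    restr S x = x := by
  ext i
  by_cases h1 : i ∈ S
  · simp [h1]
  · simp [h1, hx i h1]

theorem nrm_restr (H : HannerRep n) (x : E n) : H.nrm (restr H.coords x) = H.nrm x :=
  H.nrm_congr fun i hi => by simp [hi]

theorem nrm_add_left (H : HannerRep n) {x y : E n} (h : ∀ i ∈ H.coords, y i = 0) :
    H.nrm (x + y) = H.nrm x := H.nrm_congr fun i hi => by simp [h i hi]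

theorem nrm_add_right (H : HannerRep n) {x y : E n} (h : ∀ i ∈ H.coords, x i = 0) :
    H.nrm (x + y) = H.nrm y := H.nrm_congr fun i hi => by simp [h i hi]

/-- Identifies the recursively built polytope with the unit ball of `nrm` in its coordinate
subspace, so that all later arguments can be carried out with norms. -/
theorem mem_body {H : HannerRep n} (hd : H.IsDirect) {x : E n} :
    x ∈ H.body ↔ (∀ i ∉ H.coords, x i = 0) ∧ H.nrm x ≤ 1 := by
  induction H generalizing x with
  | interval i => exact mem_body_interval
  | sumOne H₁ H₂ h₁ h₂ =>
    have hdis := hd.2.2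
    constructor
    · intro hx
      have hconv : Convex ℝ {x : E n | (∀ i ∉ (sumOne H₁ H₂).coords, x i = 0) ∧
          (sumOne H₁ H₂).nrm x ≤ 1} := by
        rintro x ⟨hx, hx1⟩ y ⟨hy, hy1⟩ a b ha hb hab
        refine ⟨fun i hi => by simp [hx i hi, hy i hi], (nrm_add_le _ _ _).trans ?_⟩
        rw [nrm_smul, nrm_smul, abs_of_nonneg ha, abs_of_nonneg hb]
        nlinarith
      refine convexHull_min ?_ hconv hx
      rintro y (hy | hy)
      · obtain ⟨hy0, hy1⟩ := (h₁ hd.1).1 hy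
        refine ⟨fun i hi => hy0 i fun h => hi (by simp [coords, h]), ?_⟩
        have : H₂.nrm y = 0 :=
          H₂.nrm_eq_zero_iff.2 fun i hi => hy0 i (Finset.disjoint_right.1 hdis hi)
        simp [nrm, this, hy1]
      · obtain ⟨hy0, hy1⟩ := (h₂ hd.2.1).1 hy
        refine ⟨fun i hi => hy0 i fun h => hi (by simp [coords, h]), ?_⟩
        have : H₁.nrm y = 0 :=
          H₁.nrm_eq_zero_iff.2 fun i hi => hy0 i (Finset.disjoint_left.1 hdis hi)
        simp [nrm, this, hy1]
    · rintro ⟨hx0, hx1⟩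
      have key : ∀ (H : HannerRep n), (∀ {x : E n}, x ∈ H.body ↔
          (∀ i ∉ H.coords, x i = 0) ∧ H.nrm x ≤ 1) →
          ∃ y ∈ H.body, restr H.coords x = H.nrm x • y := by
        intro H hH
        by_cases h0 : H.nrm x = 0
        · refine ⟨0, hH.2 ⟨fun _ _ => rfl, by simp⟩, ?_⟩
          ext i
          by_cases hi : i ∈ H.coords
          · simp [hi, H.nrm_eq_zero_iff.1 h0 i hi]
          · simp [hi]
        · refine ⟨(H.nrm x)⁻¹ • restr H.coords x, hH.2 ⟨fun i hi => by simp [hi], ?_⟩, ?_⟩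
          · rw [nrm_smul, nrm_restr, abs_inv, abs_of_nonneg (nrm_nonneg _ _),
              inv_mul_cancel₀ h0]
          · rw [smul_inv_smul₀ h0]
      obtain ⟨y₁, hy₁, e₁⟩ := key H₁ (h₁ hd.1)
      obtain ⟨y₂, hy₂, e₂⟩ := key H₂ (h₂ hd.2.1)
      have hz : (0 : E n) ∈ H₁.body := (h₁ hd.1).2 ⟨fun _ _ => rfl, by simp⟩
      -- The mass missing in `H₁.nrm x + H₂.nrm x ≤ 1` is put at the origin, which lies in the first
      -- summand.
      have hx : x = (1 - H₁.nrm x - H₂.nrm x) • (0 : E n) + H₁.nrm x • y₁ + H₂.nrm x • y₂ := by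
        rw [← e₁, ← e₂, smul_zero, zero_add, restr_add_restr hdis hx0]
      have hc := convex_convexHull ℝ (H₁.body ∪ H₂.body)
      have m₁ := subset_convexHull ℝ (H₁.body ∪ H₂.body) (Or.inl hy₁)
      have m₂ := subset_convexHull ℝ (H₁.body ∪ H₂.body) (Or.inr hy₂)
      have m₀ := subset_convexHull ℝ (H₁.body ∪ H₂.body) (Or.inl hz)
      simp only [nrm] at hx1
      have := hc.sum_mem (t := Finset.univ)
        (w := ![1 - H₁.nrm x - H₂.nrm x, H₁.nrm x, H₂.nrm x]) (z := ![0, y₁, y₂])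
        (by
          intro i _
          fin_cases i
          · simp; linarith
          · exact nrm_nonneg _ _
          · exact nrm_nonneg _ _)
        (by simp [Fin.sum_univ_three]; ring)
        (by
          intro i _
          fin_cases i
          · exact m₀
          · exact m₁
          · exact m₂)
      rw [Fin.sum_univ_three] at this
      rw [body, hx]
      exact this
  | sumInf H₁ H₂ h₁ h₂ =>
    have hdis := hd.2.2
    constructor
    · rintro ⟨y, hy, z, hz, rfl⟩
      obtain ⟨hy0, hy1⟩ := (h₁ hd.1).1 hy
      obtain ⟨hz0, hz1⟩ := (h₂ hd.2.1).1 hz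
      constructor
      · intro i hi
        simp only [coords, Finset.mem_union, not_or] at hi
        simp [hy0 i hi.1, hz0 i hi.2]
      · simp only [nrm]
        rw [nrm_add_left _ fun i hi => hz0 i (Finset.disjoint_left.1 hdis hi),
          nrm_add_right _ fun i hi => hy0 i (Finset.disjoint_right.1 hdis hi)]
        exact max_le hy1 hz1
    · rintro ⟨hx0, hx1⟩
      refine ⟨restr H₁.coords x, (h₁ hd.1).2 ⟨fun i hi => by simp [hi], ?_⟩,
        restr H₂.coords x, (h₂ hd.2.1).2 ⟨fun i hi => by simp [hi], ?_⟩,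
        restr_add_restr hdis hx0⟩
      · rw [nrm_restr]; exact (le_max_left _ _).trans hx1
      · rw [nrm_restr]; exact (le_max_right _ _).trans hx1

theorem zero_mem_body {H : HannerRep n} (hd : H.IsDirect) : (0 : E n) ∈ H.body :=
  (mem_body hd).2 ⟨fun _ _ => rfl, by simp⟩

theorem mem_lin {H : HannerRep n} (hd : H.IsDirect) {x : E n} :
    x ∈ H.lin ↔ ∀ i ∉ H.coords, x i = 0 := by
  constructor
  · intro hx
    induction hx using Submodule.span_induction with
    | mem y hy => exact ((mem_body hd).1 hy).1
    | zero => intros; rfl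
    | add y z _ _ hy hz => intro i hi; simp [hy i hi, hz i hi]
    | smul a y _ hy => intro i hi; simp [hy i hi]
  · intro hx
    rw [mem_span_single hx]
    refine Submodule.sum_mem _ fun i hi => Submodule.smul_mem _ _ (Submodule.subset_span ?_)
    refine (mem_body hd).2 ⟨fun j hj => ?_, ?_⟩
    · have : j ≠ i := fun h => hj (h ▸ hi)
      simp [stdVec, this]
    · refine (nrm_le_sum H hd _).trans ?_
      simp only [stdVec, PiLp.single_apply]
      rw [Finset.sum_eq_single_of_mem i hi]
      · simp
      · intro j _ hj; simp [hj]

theorem starProjection_lin {H : HannerRep n} (hd : H.IsDirect) (x : E n) :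
    H.lin.starProjection x = restr H.coords x := by
  refine Submodule.eq_starProjection_of_mem_orthogonal ((mem_lin hd).2 fun i hi => by simp [hi]) ?_
  rw [Submodule.mem_orthogonal]
  intro u hu
  rw [mem_lin hd] at hu
  simp only [PiLp.inner_apply]
  refine Finset.sum_eq_zero fun i _ => ?_
  by_cases hi : i ∈ H.coords
  · simp [hi]
  · simp [hu i hi]

end HannerRep

end HannerMahler

end

/-! ### Norming functionals: the equality case of Hölder's inequality, face by face. -/

noncomputable section

namespace HannerMahler

namespace HannerRep

variable {n : ℕ}

/-! ### Faces and relative interior points -/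

open Classical in
/-- A canonical relative interior point of the face with sign vector `s`. -/
def pt : HannerRep n → (Fin n → SignType) → E n
  | interval i, s => EuclideanSpace.single i (s i : ℝ)
  | sumOne H₁ H₂, s =>
      (if H₂.Vanish s then (1 : ℝ) else 1 / 2) • H₁.pt s +
        (if H₁.Vanish s then (1 : ℝ) else 1 / 2) • H₂.pt s
  | sumInf H₁ H₂, s => H₁.pt s + H₂.pt s

theorem relInt_pt (H : HannerRep n) (s : Fin n → SignType) : H.RelInt s (H.pt s) := by
  induction H with
  | interval i => rfl
  | sumOne H₁ H₂ h₁ h₂ =>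
    refine ⟨_, _, _, _, h₁, h₂, ?_, ?_, ?_, ?_, ?_, rfl⟩
    · split_ifs <;> norm_num
    · split_ifs <;> norm_num
    · intro h; simp [h]
    · intro h; simp [h]
    · intro h h'; simp only [h, h', if_false]; norm_num
  | sumInf H₁ H₂ h₁ h₂ => exact ⟨_, _, h₁, h₂, rfl⟩

/-- A summand on which the code vanishes is represented by the origin: in an ℓ₁-sum it contributes
nothing, in an ℓ_∞-sum it contributes its centre. This is why the recursion for `RelInt` needs no
separate cases. -/
theorem RelInt.eq_zero_of_vanish {H : HannerRep n} {s : Fin n → SignType} {p : E n}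
    (h : H.RelInt s p) (hv : H.Vanish s) : p = 0 := by
  induction H generalizing p with
  | interval i =>
    have := hv i (by simp [coords])
    rw [RelInt, this] at h
    rw [h]; ext j; simp
  | sumOne H₁ H₂ h₁ h₂ =>
    obtain ⟨p₁, p₂, a, b, hp₁, hp₂, -, -, -, -, -, rfl⟩ := h
    rw [vanish_sumOne] at hv
    rw [h₁ hp₁ hv.1, h₂ hp₂ hv.2]; simp
  | sumInf H₁ H₂ h₁ h₂ =>
    obtain ⟨p₁, p₂, hp₁, hp₂, rfl⟩ := h
    rw [vanish_sumInf] at hv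
    rw [h₁ hp₁ hv.1, h₂ hp₂ hv.2]; simp

theorem RelInt.apply_eq_zero {H : HannerRep n} {s : Fin n → SignType} {p : E n}
    (h : H.RelInt s p) {j : Fin n} (hj : j ∉ H.coords) : p j = 0 := by
  induction H generalizing p with
  | interval i =>
    rw [RelInt] at h
    simp only [coords, Finset.mem_singleton] at hj
    simp [h, hj]
  | sumOne H₁ H₂ h₁ h₂ =>
    obtain ⟨p₁, p₂, a, b, hp₁, hp₂, -, -, -, -, -, rfl⟩ := h
    simp only [coords, Finset.mem_union, not_or] at hj
    simp [h₁ hp₁ hj.1, h₂ hp₂ hj.2]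
  | sumInf H₁ H₂ h₁ h₂ =>
    obtain ⟨p₁, p₂, hp₁, hp₂, rfl⟩ := h
    simp only [coords, Finset.mem_union, not_or] at hj
    simp [h₁ hp₁ hj.1, h₂ hp₂ hj.2]

section Combine

variable {H₁ H₂ : HannerRep n} {s : Fin n → SignType} {p₁ p₂ : E n}

theorem RelInt.pair_left_combine (hdis : Disjoint H₁.coords H₂.coords) (h : H₂.RelInt s p₂)
    (a b : ℝ) (y : E n) : H₁.pair (a • p₁ + b • p₂) y = a * H₁.pair p₁ y := by
  rw [pair_add_left, pair_smul_left, pair_eq_zero_left H₁ (x := b • p₂), add_zero]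
  intro i hi
  simp [h.apply_eq_zero (Finset.disjoint_left.1 hdis hi)]

theorem RelInt.pair_right_combine (hdis : Disjoint H₁.coords H₂.coords) (h : H₁.RelInt s p₁)
    (a b : ℝ) (y : E n) : H₂.pair (a • p₁ + b • p₂) y = b * H₂.pair p₂ y := by
  rw [pair_add_left, pair_smul_left, pair_smul_left, pair_eq_zero_left H₂ (x := p₁), mul_zero,
    zero_add]
  intro i hi
  exact h.apply_eq_zero (Finset.disjoint_right.1 hdis hi)

theorem RelInt.nrm_left_combine (hdis : Disjoint H₁.coords H₂.coords) (h : H₂.RelInt s p₂)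
    {a : ℝ} (ha : 0 ≤ a) (b : ℝ) : H₁.nrm (a • p₁ + b • p₂) = a * H₁.nrm p₁ := by
  rw [nrm_add_left, nrm_smul, abs_of_nonneg ha]
  intro i hi
  simp [h.apply_eq_zero (Finset.disjoint_left.1 hdis hi)]

theorem RelInt.nrm_right_combine (hdis : Disjoint H₁.coords H₂.coords) (h : H₁.RelInt s p₁)
    (a : ℝ) {b : ℝ} (hb : 0 ≤ b) : H₂.nrm (a • p₁ + b • p₂) = b * H₂.nrm p₂ := by
  rw [nrm_add_right, nrm_smul, abs_of_nonneg hb]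
  intro i hi
  simp [h.apply_eq_zero (Finset.disjoint_right.1 hdis hi)]

end Combine

theorem RelInt.nrm_eq_one {H : HannerRep n} (hd : H.IsDirect) {s : Fin n → SignType} {p : E n}
    (h : H.RelInt s p) (hv : ¬ H.Vanish s) : H.nrm p = 1 := by
  induction H generalizing p with
  | interval i =>
    have hi : s i ≠ 0 := fun h0 => hv fun j hj => by
      simp only [coords, Finset.mem_singleton] at hj; rw [hj, h0]
    rw [RelInt] at h
    rw [h, nrm]
    rcases hs : s i with _ | _ | _ <;> simp_all
  | sumOne H₁ H₂ h₁ h₂ =>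
    obtain ⟨p₁, p₂, a, b, hp₁, hp₂, ha, hb, e₁, e₂, e₃, rfl⟩ := h
    rw [vanish_sumOne] at hv
    rw [nrm, hp₂.nrm_left_combine hd.2.2 ha.le, hp₁.nrm_right_combine hd.2.2 _ hb.le]
    by_cases v₁ : H₁.Vanish s
    · have v₂ : ¬ H₂.Vanish s := fun v₂ => hv ⟨v₁, v₂⟩
      rw [hp₁.eq_zero_of_vanish v₁, h₂ hd.2.1 hp₂ v₂, e₁ v₁]; simp
    · by_cases v₂ : H₂.Vanish s
      · rw [hp₂.eq_zero_of_vanish v₂, h₁ hd.1 hp₁ v₁, e₂ v₂]; simp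
      · rw [h₁ hd.1 hp₁ v₁, h₂ hd.2.1 hp₂ v₂, mul_one, mul_one, e₃ v₁ v₂]
  | sumInf H₁ H₂ h₁ h₂ =>
    obtain ⟨p₁, p₂, hp₁, hp₂, rfl⟩ := h
    rw [vanish_sumInf] at hv
    have A := hp₂.nrm_left_combine (p₁ := p₁) hd.2.2 zero_le_one 1
    have B := hp₁.nrm_right_combine (p₂ := p₂) hd.2.2 1 zero_le_one
    simp only [one_smul, one_mul] at A B
    rw [nrm, A, B]
    by_cases v₁ : H₁.Vanish s
    · have v₂ : ¬ H₂.Vanish s := fun v₂ => hv ⟨v₁, v₂⟩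
      rw [hp₁.eq_zero_of_vanish v₁, h₂ hd.2.1 hp₂ v₂]; simp
    · by_cases v₂ : H₂.Vanish s
      · rw [hp₂.eq_zero_of_vanish v₂, h₁ hd.1 hp₁ v₁]; simp
      · rw [h₁ hd.1 hp₁ v₁, h₂ hd.2.1 hp₂ v₂, max_self]

theorem RelInt.nrm_le_one {H : HannerRep n} (hd : H.IsDirect) {s : Fin n → SignType} {p : E n}
    (h : H.RelInt s p) : H.nrm p ≤ 1 := by
  by_cases hv : H.Vanish s
  · rw [h.eq_zero_of_vanish hv, nrm_zero]; exact zero_le_one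
  · exact (h.nrm_eq_one hd hv).le

theorem RelInt.pair_le_nrm {H : HannerRep n} (hd : H.IsDirect) {s : Fin n → SignType} {q : E n}
    (h : H.dual.RelInt s q) (x : E n) : H.pair x q ≤ H.nrm x :=
  (pair_le hd x q).trans (mul_le_of_le_one_right (nrm_nonneg _ _) (h.nrm_le_one hd.dual))

/-- Equality in Hölder's inequality against a relative interior point of the dual face: it must hold
in every summand carrying positive weight, and unrolling these conditions gives `Cone`. -/
theorem RelInt.pair_eq_nrm_iff {H : HannerRep n} (hd : H.IsDirect) {s : Fin n → SignType} {q : E n}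
    (h : H.dual.RelInt s q) (hv : ¬ H.Vanish s) (x : E n) :
    H.pair x q = H.nrm x ↔ H.Cone s x := by
  induction H generalizing q with
  | interval i =>
    rw [dual, RelInt] at h
    simp [h, pair, nrm, Cone, coords]
  | sumOne H₁ H₂ h₁ h₂ =>
    obtain ⟨q₁, q₂, hq₁, hq₂, rfl⟩ := h
    have hdis := hd.2.2
    have hdis' : Disjoint H₁.dual.coords H₂.dual.coords := by simpa using hdis
    have A := hq₂.pair_left_combine (p₁ := q₁) hdis' 1 1 x
    have B := hq₁.pair_right_combine (p₂ := q₂) hdis' 1 1 x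
    simp only [one_smul, one_mul, ← pair_comm] at A B
    rw [pair_sumOne hdis, A, B, nrm, Cone]
    rw [vanish_sumOne] at hv
    have L₁ := hq₁.pair_le_nrm hd.1 x
    have L₂ := hq₂.pair_le_nrm hd.2.1 x
    by_cases v₁ : H₁.Vanish s
    · have v₂ : ¬ H₂.Vanish s := fun v₂ => hv ⟨v₁, v₂⟩
      have hq0 : q₁ = 0 := hq₁.eq_zero_of_vanish (by simpa using v₁)
      have : H₁.pair x q₁ = 0 := pair_eq_zero_right _ _ (by simp [hq0])
      simp only [v₁, v₂, not_true, not_false_eq_true, true_imp_iff, false_imp_iff, and_true,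
        true_and, ← h₂ hd.2.1 hq₂ v₂]
      rw [this]
      have := H₁.nrm_nonneg x
      constructor
      · intro h; constructor <;> linarith
      · rintro ⟨h, h'⟩; linarith
    · by_cases v₂ : H₂.Vanish s
      · have hq0 : q₂ = 0 := hq₂.eq_zero_of_vanish (by simpa using v₂)
        have : H₂.pair x q₂ = 0 := pair_eq_zero_right _ _ (by simp [hq0])
        simp only [v₁, v₂, not_true, not_false_eq_true, true_imp_iff, false_imp_iff, and_true,
          true_and, ← h₁ hd.1 hq₁ v₁]
        rw [this]
        have := H₂.nrm_nonneg x
        constructor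
        · intro h; constructor <;> linarith
        · rintro ⟨h, h'⟩; linarith
      · simp only [v₁, v₂, not_false_eq_true, true_imp_iff, false_imp_iff,
          true_and, ← h₁ hd.1 hq₁ v₁, ← h₂ hd.2.1 hq₂ v₂]
        constructor
        · intro h; constructor <;> linarith
        · rintro ⟨h, h'⟩; linarith
  | sumInf H₁ H₂ h₁ h₂ =>
    obtain ⟨q₁, q₂, a, b, hq₁, hq₂, ha, hb, e₁, e₂, e₃, rfl⟩ := h
    have hdis := hd.2.2
    have hdis' : Disjoint H₁.dual.coords H₂.dual.coords := by simpa using hdis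
    have A := hq₂.pair_left_combine (p₁ := q₁) hdis' a b x
    have B := hq₁.pair_right_combine (p₂ := q₂) hdis' a b x
    simp only [← pair_comm] at A B
    rw [pair_sumInf hdis, A, B, nrm, Cone]
    rw [vanish_sumInf] at hv
    simp only [vanish_dual] at e₁ e₂ e₃
    have L₁ := hq₁.pair_le_nrm hd.1 x
    have L₂ := hq₂.pair_le_nrm hd.2.1 x
    have M₁ := le_max_left (H₁.nrm x) (H₂.nrm x)
    have M₂ := le_max_right (H₁.nrm x) (H₂.nrm x)
    by_cases v₁ : H₁.Vanish s
    · have v₂ : ¬ H₂.Vanish s := fun v₂ => hv ⟨v₁, v₂⟩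
      have hq0 : q₁ = 0 := hq₁.eq_zero_of_vanish (by simpa using v₁)
      have : H₁.pair x q₁ = 0 := pair_eq_zero_right _ _ (by simp [hq0])
      simp only [v₁, v₂, not_true, not_false_eq_true, true_imp_iff, false_imp_iff,
        true_and, ← h₂ hd.2.1 hq₂ v₂]
      rw [this, e₁ v₁]
      constructor
      · intro h; constructor <;> linarith
      · rintro ⟨h, h'⟩; rw [max_eq_right h', h]; ring
    · by_cases v₂ : H₂.Vanish s
      · have hq0 : q₂ = 0 := hq₂.eq_zero_of_vanish (by simpa using v₂)
        have : H₂.pair x q₂ = 0 := pair_eq_zero_right _ _ (by simp [hq0])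
        simp only [v₁, v₂, not_true, not_false_eq_true, true_imp_iff, false_imp_iff, and_true,
          ← h₁ hd.1 hq₁ v₁]
        rw [this, e₂ v₂]
        constructor
        · intro h; constructor <;> linarith
        · rintro ⟨h, h'⟩; rw [max_eq_left h', h]; ring
      · simp only [v₁, v₂, not_false_eq_true, true_imp_iff,
          ← h₁ hd.1 hq₁ v₁, ← h₂ hd.2.1 hq₂ v₂]
        have hab := e₃ v₁ v₂
        constructor
        · intro h
          -- A convex combination with positive weights of two numbers bounded by the maximum can
          -- equal the maximum only if both numbers do.
          have k₁ : H₁.pair x q₁ = max (H₁.nrm x) (H₂.nrm x) := by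
            by_contra hne
            have : H₁.pair x q₁ < max (H₁.nrm x) (H₂.nrm x) := lt_of_le_of_ne (L₁.trans M₁) hne
            have h3 := mul_lt_mul_of_pos_left this ha
            have h4 := mul_le_mul_of_nonneg_left (L₂.trans M₂) hb.le
            have h5 : a * max (H₁.nrm x) (H₂.nrm x) + b * max (H₁.nrm x) (H₂.nrm x) =
              max (H₁.nrm x) (H₂.nrm x) := by rw [← add_mul, hab, one_mul]
            linarith
          have k₂ : H₂.pair x q₂ = max (H₁.nrm x) (H₂.nrm x) := by
            by_contra hne
            have : H₂.pair x q₂ < max (H₁.nrm x) (H₂.nrm x) := lt_of_le_of_ne (L₂.trans M₂) hne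
            have h3 := mul_lt_mul_of_pos_left this hb
            have h4 := mul_le_mul_of_nonneg_left (L₁.trans M₁) ha.le
            have h5 : a * max (H₁.nrm x) (H₂.nrm x) + b * max (H₁.nrm x) (H₂.nrm x) =
              max (H₁.nrm x) (H₂.nrm x) := by rw [← add_mul, hab, one_mul]
            linarith
          exact ⟨⟨by linarith, by linarith⟩, ⟨by linarith, by linarith⟩⟩
        · rintro ⟨⟨h3, h4⟩, ⟨h5, h6⟩⟩
          have h7 : H₁.nrm x = H₂.nrm x := le_antisymm h6 h4
          rw [h3, h5, ← h7, max_self, ← add_mul, hab, one_mul]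

/-- A functional that attains its norm at one relative interior point of a face attains it on the
whole face. This justifies the name `RelInt` and lets single points stand for faces. -/
theorem RelInt.pair_eq_of_cone {H : HannerRep n} (hd : H.IsDirect) {s : Fin n → SignType} {p : E n}
    (h : H.RelInt s p) (hv : ¬ H.Vanish s) {y : E n} (hy : H.pair p y = H.dual.nrm y) {x : E n}
    (hx : H.Cone s x) : H.pair x y = H.dual.nrm y * H.nrm x := by
  induction H generalizing p with
  | interval i =>
    have hi : s i ≠ 0 := fun h0 => hv fun j hj => by
      simp only [coords, Finset.mem_singleton] at hj; rw [hj, h0]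
    rw [RelInt] at h
    subst h
    simp only [pair, coords, Finset.sum_singleton, PiLp.single_apply, if_true, dual, nrm,
      Cone] at hy hx ⊢
    rw [← hx, ← hy]
    have : ((s i : SignType) : ℝ) * (s i : ℝ) = 1 := by
      rcases hs : s i with _ | _ | _ <;> simp_all
    linear_combination (- x i * y i) * this
  | sumOne H₁ H₂ h₁ h₂ =>
    obtain ⟨p₁, p₂, a, b, hp₁, hp₂, ha, hb, e₁, e₂, e₃, rfl⟩ := h
    have hdis := hd.2.2
    rw [pair_sumOne hdis, hp₂.pair_left_combine hdis, hp₁.pair_right_combine hdis] at hy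
    rw [pair_sumOne hdis]
    simp only [dual, nrm, Cone] at hy hx ⊢
    rw [vanish_sumOne] at hv
    have L₁ : H₁.pair p₁ y ≤ H₁.dual.nrm y := (pair_le hd.1 p₁ y).trans
      (mul_le_of_le_one_left (nrm_nonneg _ _) (hp₁.nrm_le_one hd.1))
    have L₂ : H₂.pair p₂ y ≤ H₂.dual.nrm y := (pair_le hd.2.1 p₂ y).trans
      (mul_le_of_le_one_left (nrm_nonneg _ _) (hp₂.nrm_le_one hd.2.1))
    have M₁ := le_max_left (H₁.dual.nrm y) (H₂.dual.nrm y)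
    have M₂ := le_max_right (H₁.dual.nrm y) (H₂.dual.nrm y)
    set m := max (H₁.dual.nrm y) (H₂.dual.nrm y)
    by_cases v₁ : H₁.Vanish s
    · have v₂ : ¬ H₂.Vanish s := fun v₂ => hv ⟨v₁, v₂⟩
      have hx1 := hx.1.1 v₁
      have hp0 : H₁.pair p₁ y = 0 :=
        pair_eq_zero_left _ _ (by simp [hp₁.eq_zero_of_vanish v₁])
      rw [hp0, e₁ v₁] at hy
      have hm : H₂.dual.nrm y = m := by linarith
      rw [h₂ hd.2.1 hp₂ v₂ (by linarith) (hx.2.2 v₂), hm,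
        pair_eq_zero_left _ _ (H₁.nrm_eq_zero_iff.1 hx1), hx1]
      simp
    · by_cases v₂ : H₂.Vanish s
      · have hx1 := hx.2.1 v₂
        have hp0 : H₂.pair p₂ y = 0 :=
          pair_eq_zero_left _ _ (by simp [hp₂.eq_zero_of_vanish v₂])
        rw [hp0, e₂ v₂] at hy
        have hm : H₁.dual.nrm y = m := by linarith
        rw [h₁ hd.1 hp₁ v₁ (by linarith) (hx.1.2 v₁), hm,
          pair_eq_zero_left _ _ (H₂.nrm_eq_zero_iff.1 hx1), hx1]
        simp
      · have hab := e₃ v₁ v₂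
        have h5 : a * m + b * m = m := by rw [← add_mul, hab, one_mul]
        have k₁ : H₁.pair p₁ y = m := by
          by_contra hne
          have : H₁.pair p₁ y < m := lt_of_le_of_ne (L₁.trans M₁) hne
          have h3 := mul_lt_mul_of_pos_left this ha
          have h4 := mul_le_mul_of_nonneg_left (L₂.trans M₂) hb.le
          linarith
        have k₂ : H₂.pair p₂ y = m := by
          by_contra hne
          have : H₂.pair p₂ y < m := lt_of_le_of_ne (L₂.trans M₂) hne
          have h3 := mul_lt_mul_of_pos_left this hb
          have h4 := mul_le_mul_of_nonneg_left (L₁.trans M₁) ha.le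
          linarith
        have m₁ : H₁.dual.nrm y = m := by linarith
        have m₂ : H₂.dual.nrm y = m := by linarith
        rw [h₁ hd.1 hp₁ v₁ (by linarith) (hx.1.2 v₁), h₂ hd.2.1 hp₂ v₂ (by linarith) (hx.2.2 v₂),
          m₁, m₂, mul_add]
  | sumInf H₁ H₂ h₁ h₂ =>
    obtain ⟨p₁, p₂, hp₁, hp₂, rfl⟩ := h
    have hdis := hd.2.2
    have A := hp₂.pair_left_combine (p₁ := p₁) hdis 1 1 y
    have B := hp₁.pair_right_combine (p₂ := p₂) hdis 1 1 y
    simp only [one_smul, one_mul] at A B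
    rw [pair_sumInf hdis, A, B] at hy
    rw [pair_sumInf hdis]
    simp only [dual, nrm, Cone] at hy hx ⊢
    rw [vanish_sumInf] at hv
    have L₁ : H₁.pair p₁ y ≤ H₁.dual.nrm y := (pair_le hd.1 p₁ y).trans
      (mul_le_of_le_one_left (nrm_nonneg _ _) (hp₁.nrm_le_one hd.1))
    have L₂ : H₂.pair p₂ y ≤ H₂.dual.nrm y := (pair_le hd.2.1 p₂ y).trans
      (mul_le_of_le_one_left (nrm_nonneg _ _) (hp₂.nrm_le_one hd.2.1))
    have n₁ := H₁.dual.nrm_nonneg y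
    have n₂ := H₂.dual.nrm_nonneg y
    by_cases v₁ : H₁.Vanish s
    · have v₂ : ¬ H₂.Vanish s := fun v₂ => hv ⟨v₁, v₂⟩
      obtain ⟨c₂, hle⟩ := hx.2 v₂
      have hp0 : H₁.pair p₁ y = 0 :=
        pair_eq_zero_left _ _ (by simp [hp₁.eq_zero_of_vanish v₁])
      have z : H₁.dual.nrm y = 0 := by linarith
      rw [h₂ hd.2.1 hp₂ v₂ (by linarith) c₂, max_eq_right hle, z,
        pair_eq_zero_right _ _ (by simpa using H₁.dual.nrm_eq_zero_iff.1 z)]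
      ring
    · by_cases v₂ : H₂.Vanish s
      · obtain ⟨c₁, hle⟩ := hx.1 v₁
        have hp0 : H₂.pair p₂ y = 0 :=
          pair_eq_zero_left _ _ (by simp [hp₂.eq_zero_of_vanish v₂])
        have z : H₂.dual.nrm y = 0 := by linarith
        rw [h₁ hd.1 hp₁ v₁ (by linarith) c₁, max_eq_left hle, z,
          pair_eq_zero_right _ _ (by simpa using H₂.dual.nrm_eq_zero_iff.1 z)]
        ring
      · obtain ⟨c₁, hle₁⟩ := hx.1 v₁
        obtain ⟨c₂, hle₂⟩ := hx.2 v₂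
        rw [h₁ hd.1 hp₁ v₁ (by linarith) c₁, h₂ hd.2.1 hp₂ v₂ (by linarith) c₂,
          le_antisymm hle₂ hle₁, max_self]
        ring

theorem vanish_congr (H : HannerRep n) {s t : Fin n → SignType} (h : ∀ i ∈ H.coords, s i = t i) :
    H.Vanish s ↔ H.Vanish t :=
  forall₂_congr fun i hi => by rw [h i hi]

theorem cone_congr (H : HannerRep n) {s t : Fin n → SignType} (h : ∀ i ∈ H.coords, s i = t i)
    (x : E n) : H.Cone s x ↔ H.Cone t x := by
  induction H with
  | interval i => simp [Cone, h i (by simp [coords])]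
  | sumOne H₁ H₂ h₁ h₂ =>
    have e₁ : ∀ i ∈ H₁.coords, s i = t i := fun i hi => h i (by simp [coords, hi])
    have e₂ : ∀ i ∈ H₂.coords, s i = t i := fun i hi => h i (by simp [coords, hi])
    rw [Cone, Cone, h₁ e₁, h₂ e₂, vanish_congr _ e₁, vanish_congr _ e₂]
  | sumInf H₁ H₂ h₁ h₂ =>
    have e₁ : ∀ i ∈ H₁.coords, s i = t i := fun i hi => h i (by simp [coords, hi])
    have e₂ : ∀ i ∈ H₂.coords, s i = t i := fun i hi => h i (by simp [coords, hi])
    rw [Cone, Cone, h₁ e₁, h₂ e₂, vanish_congr _ e₁, vanish_congr _ e₂]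

/-- Combination of two sign vectors on disjoint sets of coordinates. -/
def glue (S : Finset (Fin n)) (s t : Fin n → SignType) : Fin n → SignType :=
  fun i => if i ∈ S then s i else t i

theorem glue_left {S : Finset (Fin n)} (s t : Fin n → SignType) : ∀ i ∈ S, glue S s t i = s i :=
  fun i hi => by simp [glue, hi]

theorem glue_right {S T : Finset (Fin n)} (h : Disjoint S T) (s t : Fin n → SignType) :
    ∀ i ∈ T, glue S s t i = t i :=
  fun i hi => by simp [glue, Finset.disjoint_right.1 h hi]

/-- The points at which a linear functional attains its norm form the cone over a face. -/
theorem exists_cone {H : HannerRep n} (hd : H.IsDirect) {y : E n} (hy : 0 < H.dual.nrm y) :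
    ∃ s, ¬ H.Vanish s ∧ ∀ x, H.pair x y = H.dual.nrm y * H.nrm x ↔ H.Cone s x := by
  induction H with
  | interval i =>
    simp only [dual, nrm, abs_pos] at hy
    refine ⟨fun _ => SignType.sign (y i), fun h => ?_, fun x => ?_⟩
    · have := h i (by simp [coords])
      exact hy (sign_eq_zero_iff.1 this)
    · simp only [pair, coords, Finset.sum_singleton, dual, nrm, Cone]
      have h1 : ((SignType.sign (y i) : SignType) : ℝ) * |y i| = y i := sign_mul_abs _
      have h2 : 0 < |y i| := abs_pos.2 hy
      constructor
      · intro h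
        refine mul_left_cancel₀ h2.ne' ?_
        rw [← h]; linear_combination x i * h1
      · intro h
        rw [← h]; linear_combination - x i * h1
  | sumOne H₁ H₂ h₁ h₂ =>
    have hdis := hd.2.2
    simp only [dual, nrm] at hy ⊢
    simp only [pair_sumOne hdis]
    have n₁ := H₁.dual.nrm_nonneg y
    have n₂ := H₂.dual.nrm_nonneg y
    -- The dual norm is a maximum here: a norming vector has no mass in a summand where the maximum
    -- is not attained, so the code is set to 0 there.
    rcases lt_trichotomy (H₁.dual.nrm y) (H₂.dual.nrm y) with hlt | heq | hlt
    · rw [max_eq_right hlt.le] at hy ⊢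
      obtain ⟨s, hs, hc⟩ := h₂ hd.2.1 hy
      have e₁ := glue_left (S := H₁.coords) 0 s
      have e₂ := glue_right hdis 0 s
      have v₁ : H₁.Vanish (glue H₁.coords 0 s) := (vanish_congr _ e₁).2 fun _ _ => rfl
      have v₂ : ¬ H₂.Vanish (glue H₁.coords 0 s) := fun h => hs ((vanish_congr _ e₂).1 h)
      refine ⟨glue H₁.coords 0 s, fun h => v₂ (vanish_sumOne.1 h).2, fun x => ?_⟩
      simp only [Cone, v₁, v₂, not_true, not_false_eq_true, true_imp_iff, false_imp_iff, and_true,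
        true_and]
      rw [cone_congr _ e₂, ← hc]
      have L₁ := pair_le hd.1 x y
      have L₂ := pair_le hd.2.1 x y
      have m₁ := H₁.nrm_nonneg x
      constructor
      · intro h
        have : H₁.nrm x = 0 := by
          by_contra hne
          have := mul_lt_mul_of_pos_left hlt (lt_of_le_of_ne m₁ (Ne.symm hne))
          nlinarith
        refine ⟨this, ?_⟩
        rw [this] at h L₁
        linarith
      · rintro ⟨h, h'⟩
        rw [pair_eq_zero_left _ _ (H₁.nrm_eq_zero_iff.1 h), h, h']; ring
    · rw [heq, max_self] at hy ⊢
      obtain ⟨s, hs, hc⟩ := h₁ hd.1 (heq ▸ hy)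
      obtain ⟨t, ht, hc'⟩ := h₂ hd.2.1 hy
      have e₁ := glue_left (S := H₁.coords) s t
      have e₂ := glue_right hdis s t
      have v₁ : ¬ H₁.Vanish (glue H₁.coords s t) := fun h => hs ((vanish_congr _ e₁).1 h)
      have v₂ : ¬ H₂.Vanish (glue H₁.coords s t) := fun h => ht ((vanish_congr _ e₂).1 h)
      refine ⟨glue H₁.coords s t, fun h => v₂ (vanish_sumOne.1 h).2, fun x => ?_⟩
      simp only [Cone, v₁, v₂, not_false_eq_true, true_imp_iff, false_imp_iff, true_and]
      rw [cone_congr _ e₂, cone_congr _ e₁, ← hc, ← hc']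
      have L₁ := pair_le hd.1 x y
      have L₂ := pair_le hd.2.1 x y
      rw [heq] at L₁ ⊢
      constructor
      · intro h; constructor <;> linarith
      · rintro ⟨h, h'⟩; linarith
    · rw [max_eq_left hlt.le] at hy ⊢
      obtain ⟨s, hs, hc⟩ := h₁ hd.1 hy
      have e₁ := glue_left (S := H₁.coords) s 0
      have e₂ := glue_right hdis s 0
      have v₂ : H₂.Vanish (glue H₁.coords s 0) := (vanish_congr _ e₂).2 fun _ _ => rfl
      have v₁ : ¬ H₁.Vanish (glue H₁.coords s 0) := fun h => hs ((vanish_congr _ e₁).1 h)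
      refine ⟨glue H₁.coords s 0, fun h => v₁ (vanish_sumOne.1 h).1, fun x => ?_⟩
      simp only [Cone, v₁, v₂, not_true, not_false_eq_true, true_imp_iff, false_imp_iff, and_true,
        true_and]
      rw [cone_congr _ e₁, ← hc]
      have L₁ := pair_le hd.1 x y
      have L₂ := pair_le hd.2.1 x y
      have m₂ := H₂.nrm_nonneg x
      constructor
      · intro h
        have : H₂.nrm x = 0 := by
          by_contra hne
          have := mul_lt_mul_of_pos_left hlt (lt_of_le_of_ne m₂ (Ne.symm hne))
          nlinarith
        refine ⟨?_, this⟩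
        rw [this] at h L₂
        linarith
      · rintro ⟨h', h⟩
        rw [pair_eq_zero_left H₂ _ (H₂.nrm_eq_zero_iff.1 h), h, h']; ring
  | sumInf H₁ H₂ h₁ h₂ =>
    have hdis := hd.2.2
    simp only [dual, nrm] at hy ⊢
    simp only [pair_sumInf hdis]
    have n₁ := H₁.dual.nrm_nonneg y
    have n₂ := H₂.dual.nrm_nonneg y
    -- The dual norm is a sum here: a summand on which `y` vanishes only has to have the smaller
    -- norm, and this is again code 0.
    rcases n₁.eq_or_lt with z₁ | pos₁
    · rw [← z₁, zero_add] at hy ⊢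
      obtain ⟨s, hs, hc⟩ := h₂ hd.2.1 hy
      have e₁ := glue_left (S := H₁.coords) 0 s
      have e₂ := glue_right hdis 0 s
      have v₁ : H₁.Vanish (glue H₁.coords 0 s) := (vanish_congr _ e₁).2 fun _ _ => rfl
      have v₂ : ¬ H₂.Vanish (glue H₁.coords 0 s) := fun h => hs ((vanish_congr _ e₂).1 h)
      refine ⟨glue H₁.coords 0 s, fun h => v₂ (vanish_sumInf.1 h).2, fun x => ?_⟩
      simp only [Cone, v₁, v₂, not_true, not_false_eq_true, true_imp_iff, false_imp_iff, true_and]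
      rw [cone_congr _ e₂, ← hc,
        pair_eq_zero_right H₁ _ (by simpa using H₁.dual.nrm_eq_zero_iff.1 z₁.symm), zero_add]
      have L₂ := pair_le hd.2.1 x y
      constructor
      · intro h
        have : max (H₁.nrm x) (H₂.nrm x) ≤ H₂.nrm x := by
          refine le_of_mul_le_mul_left ?_ hy
          linarith
        exact ⟨by rw [h, max_eq_right ((le_max_left _ _).trans this)],
          (le_max_left _ _).trans this⟩
      · rintro ⟨h, h'⟩
        rw [h, max_eq_right h']
    · rcases n₂.eq_or_lt with z₂ | pos₂
      · rw [← z₂, add_zero] at hy ⊢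
        obtain ⟨s, hs, hc⟩ := h₁ hd.1 hy
        have e₁ := glue_left (S := H₁.coords) s 0
        have e₂ := glue_right hdis s 0
        have v₂ : H₂.Vanish (glue H₁.coords s 0) := (vanish_congr _ e₂).2 fun _ _ => rfl
        have v₁ : ¬ H₁.Vanish (glue H₁.coords s 0) := fun h => hs ((vanish_congr _ e₁).1 h)
        refine ⟨glue H₁.coords s 0, fun h => v₁ (vanish_sumInf.1 h).1, fun x => ?_⟩
        simp only [Cone, v₁, v₂, not_true, not_false_eq_true, true_imp_iff, false_imp_iff,
          and_true]
        rw [cone_congr _ e₁, ← hc,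
          pair_eq_zero_right H₂ _ (by simpa using H₂.dual.nrm_eq_zero_iff.1 z₂.symm), add_zero]
        have L₁ := pair_le hd.1 x y
        constructor
        · intro h
          have : max (H₁.nrm x) (H₂.nrm x) ≤ H₁.nrm x := by
            refine le_of_mul_le_mul_left ?_ hy
            linarith
          exact ⟨by rw [h, max_eq_left ((le_max_right _ _).trans this)],
            (le_max_right _ _).trans this⟩
        · rintro ⟨h, h'⟩
          rw [h, max_eq_left h']
      · obtain ⟨s, hs, hc⟩ := h₁ hd.1 pos₁
        obtain ⟨t, ht, hc'⟩ := h₂ hd.2.1 pos₂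
        have e₁ := glue_left (S := H₁.coords) s t
        have e₂ := glue_right hdis s t
        have v₁ : ¬ H₁.Vanish (glue H₁.coords s t) := fun h => hs ((vanish_congr _ e₁).1 h)
        have v₂ : ¬ H₂.Vanish (glue H₁.coords s t) := fun h => ht ((vanish_congr _ e₂).1 h)
        refine ⟨glue H₁.coords s t, fun h => v₂ (vanish_sumInf.1 h).2, fun x => ?_⟩
        simp only [Cone, v₁, v₂, not_false_eq_true, true_imp_iff]
        rw [cone_congr _ e₂, cone_congr _ e₁, ← hc, ← hc']
        have L₁ := pair_le hd.1 x y
        have L₂ := pair_le hd.2.1 x y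
        have M₁ := le_max_left (H₁.nrm x) (H₂.nrm x)
        have M₂ := le_max_right (H₁.nrm x) (H₂.nrm x)
        have K₁ := mul_le_mul_of_nonneg_left M₁ pos₁.le
        have K₂ := mul_le_mul_of_nonneg_left M₂ pos₂.le
        constructor
        · intro h
          have j₁ : max (H₁.nrm x) (H₂.nrm x) ≤ H₁.nrm x := by
            refine le_of_mul_le_mul_left ?_ pos₁
            linarith
          have j₂ : max (H₁.nrm x) (H₂.nrm x) ≤ H₂.nrm x := by
            refine le_of_mul_le_mul_left ?_ pos₂
            linarith
          exact ⟨⟨by linarith, M₂.trans j₁⟩, ⟨by linarith, M₁.trans j₂⟩⟩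
        · rintro ⟨⟨h3, h4⟩, ⟨h5, h6⟩⟩
          rw [h3, h5, le_antisymm h6 h4, max_self]; ring

end HannerRep

end HannerMahler

end

/-! ### Faces as sign vectors: dimension, centroid, inclusion and polarity. -/

noncomputable section

namespace HannerMahler

/-! ### Dimension and centroids -/

theorem dim_lt_dim {n : ℕ} {A B : Set (E n)} (hAB : A ⊆ B) (θ : E n) (a : ℝ)
    (hA : ∀ x ∈ A, inner ℝ θ x = a) (hne : A.Nonempty) {y : E n} (hy : y ∈ B)
    (hya : inner ℝ θ y ≠ a) : dim A < dim B := by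
  refine Submodule.finrank_lt_finrank_of_lt (lt_of_le_of_ne (vectorSpan_mono ℝ hAB) fun h => ?_)
  obtain ⟨x, hx⟩ := hne
  have h1 : y - x ∈ vectorSpan ℝ A := h ▸ vsub_mem_vectorSpan ℝ hy (hAB hx)
  have h2 : vectorSpan ℝ A ≤ LinearMap.ker (innerₛₗ ℝ θ) := by
    rw [vectorSpan_def, Submodule.span_le]
    rintro _ ⟨u, hu, v, hv, rfl⟩
    simp [inner_sub_right, hA u hu, hA v hv]
  have h3 := h2 h1
  simp only [LinearMap.mem_ker, innerₛₗ_apply_apply, inner_sub_right, hA x hx] at h3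
  exact hya (by linarith)

/-- An average over a closed convex set of finite positive measure stays in the set. Finiteness and
positivity are checked in the direction space of F, where the Hausdorff measure is a Haar measure
and F has nonempty interior. -/
theorem centroid_mem {n : ℕ} {F : Set (E n)} (hc : Convex ℝ F) (hk : IsCompact F)
    (hne : F.Nonempty) : centroid F ∈ F := by
  obtain ⟨p, hp⟩ := hne
  let f : vectorSpan ℝ F → E n := fun v => (v : E n) + p
  have hf : Isometry f := fun v w => by simp [f, edist_dist, dist_eq_norm]
  have hclosed : Topology.IsClosedEmbedding f := hf.isClosedEmbedding
  have hG : IsCompact (f ⁻¹' F) := hclosed.isCompact_preimage hk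
  have hrange : F ⊆ Set.range f := fun x hx =>
    ⟨⟨x - p, vsub_mem_vectorSpan ℝ hx hp⟩, by simp [f]⟩
  have hGc : Convex ℝ (f ⁻¹' F) := by
    intro u hu v hv a b ha hb hab
    have := hc hu hv ha hb hab
    change ((a • u + b • v : vectorSpan ℝ F) : E n) + p ∈ F
    convert this using 1
    simp only [f, Submodule.coe_add, Submodule.coe_smul]
    have : p = a • p + b • p := by rw [← add_smul, hab, one_smul]
    nth_rewrite 1 [this]
    module
  have h0 : (0 : vectorSpan ℝ F) ∈ f ⁻¹' F := by simpa [f] using hp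
  have hint : (interior (f ⁻¹' F)).Nonempty := by
    rw [hGc.interior_nonempty_iff_affineSpan_eq_top,
      AffineSubspace.affineSpan_eq_top_iff_vectorSpan_eq_top_of_nonempty _ _ _ ⟨0, h0⟩, eq_top_iff]
    have himg : (vectorSpan ℝ F).subtype '' (f ⁻¹' F) = (fun x => x - p) '' F := by
      ext x
      constructor
      · rintro ⟨v, hv, rfl⟩
        exact ⟨f v, hv, by simp [f]⟩
      · rintro ⟨y, hy, rfl⟩
        obtain ⟨v, rfl⟩ := hrange hy
        exact ⟨v, hy, by simp [f]⟩
    have hspan : Submodule.map (vectorSpan ℝ F).subtype (Submodule.span ℝ (f ⁻¹' F)) =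
        vectorSpan ℝ F := by
      rw [Submodule.map_span, himg, vectorSpan_eq_span_vsub_set_right ℝ hp]
      rfl
    have htop : Submodule.span ℝ (f ⁻¹' F) = ⊤ := by
      refine Submodule.map_injective_of_injective (vectorSpan ℝ F).injective_subtype ?_
      rw [hspan, Submodule.map_top, Submodule.range_subtype]
    rw [← htop, vectorSpan_eq_span_vsub_set_right ℝ h0]
    simp
  have himage : f '' (f ⁻¹' F) = F := Set.image_preimage_eq_of_subset hrange
  have hμ : μHE[dim F] F = μHE[dim F] (f ⁻¹' F) := by
    have := hf.euclideanHausdorffMeasure_image (d := dim F) (f ⁻¹' F)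
    rwa [himage] at this
  have hpos : μHE[dim F] F ≠ 0 := by
    rw [hμ]
    have : (μHE[dim F] : Measure (vectorSpan ℝ F)).IsAddHaarMeasure :=
      isAddHaarMeasure_euclideanHausdorffMeasure
    exact (lt_of_lt_of_le (isOpen_interior.measure_pos _ hint)
      (measure_mono interior_subset)).ne'
  have hfin : μHE[dim F] F ≠ ⊤ := by
    rw [hμ]
    have : (μHE[dim F] : Measure (vectorSpan ℝ F)).IsAddHaarMeasure :=
      isAddHaarMeasure_euclideanHausdorffMeasure
    exact hG.measure_lt_top.ne
  obtain ⟨C, hC⟩ := hk.isBounded.exists_norm_le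
  refine hc.set_average_mem hk.isClosed hpos hfin ?_ ?_
  · exact (ae_restrict_mem hk.isClosed.measurableSet)
  · refine Measure.integrableOn_of_bounded (M := C) hfin
      measurable_id.aestronglyMeasurable ?_
    filter_upwards [ae_restrict_mem hk.isClosed.measurableSet] with x hx using hC x hx

namespace HannerRep

variable {n : ℕ}

theorem pair_eq_inner {H : HannerRep n} (x : E n) {y : E n} (hy : ∀ i ∉ H.coords, y i = 0) :
    H.pair x y = inner ℝ x y := by
  rw [pair, PiLp.inner_apply]
  refine (Finset.sum_subset (Finset.subset_univ _) fun i _ hi => ?_).trans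
    (Finset.sum_congr rfl fun i _ => ?_)
  · simp [hy i hi]
  · simp [mul_comm]

theorem RelInt.pair_eq_inner {H : HannerRep n} {s : Fin n → SignType} {q : E n}
    (h : H.dual.RelInt s q) (x : E n) : H.pair x q = inner ℝ x q :=
  HannerRep.pair_eq_inner x fun i hi => h.apply_eq_zero (by simpa using hi)

theorem RelInt.mem_faceSet_iff {H : HannerRep n} (hd : H.IsDirect) {s : Fin n → SignType} {q : E n}
    (h : H.dual.RelInt s q) (hv : ¬ H.Vanish s) {x : E n} :
    x ∈ H.faceSet s ↔ x ∈ H.body ∧ H.pair x q = 1 := by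
  constructor
  · rintro ⟨hb, hc, h1⟩
    exact ⟨hb, by rw [(h.pair_eq_nrm_iff hd hv x).2 hc, h1]⟩
  · rintro ⟨hb, h1⟩
    have h2 := h.pair_le_nrm hd x
    have h3 := ((mem_body hd).1 hb).2
    exact ⟨hb, (h.pair_eq_nrm_iff hd hv x).1 (by linarith), by linarith⟩

theorem RelInt.pair_eq_one {H : HannerRep n} (hd : H.IsDirect) {s : Fin n → SignType} {p q : E n}
    (hp : H.RelInt s p) (hq : H.dual.RelInt s q) (hv : ¬ H.Vanish s) : H.pair p q = 1 := by
  induction H generalizing p q with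
  | interval i =>
    have hi : s i ≠ 0 := fun h0 => hv fun j hj => by
      simp only [coords, Finset.mem_singleton] at hj; rw [hj, h0]
    rw [HannerRep.dual, RelInt] at hq
    rw [RelInt] at hp
    rw [hp, hq]
    rcases hs : s i with _ | _ | _ <;> simp_all [pair, coords]
  | sumOne H₁ H₂ h₁ h₂ =>
    obtain ⟨p₁, p₂, a, b, hp₁, hp₂, ha, hb, e₁, e₂, e₃, rfl⟩ := hp
    obtain ⟨q₁, q₂, hq₁, hq₂, rfl⟩ := hq
    have hdis := hd.2.2
    have hdis' : Disjoint H₁.dual.coords H₂.dual.coords := by simpa using hdis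
    have A := hq₂.pair_left_combine (p₁ := q₁) hdis' 1 1 p₁
    have B := hq₁.pair_right_combine (p₂ := q₂) hdis' 1 1 p₂
    simp only [one_smul, one_mul, ← pair_comm] at A B
    rw [pair_sumOne hdis, hp₂.pair_left_combine hdis, hp₁.pair_right_combine hdis, A, B]
    rw [vanish_sumOne] at hv
    by_cases v₁ : H₁.Vanish s
    · have v₂ : ¬ H₂.Vanish s := fun v₂ => hv ⟨v₁, v₂⟩
      rw [h₂ hd.2.1 hp₂ hq₂ v₂, pair_eq_zero_left H₁ _ (by simp [hp₁.eq_zero_of_vanish v₁]), e₁ v₁]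
      simp
    · by_cases v₂ : H₂.Vanish s
      · rw [h₁ hd.1 hp₁ hq₁ v₁, pair_eq_zero_left H₂ _ (by simp [hp₂.eq_zero_of_vanish v₂]), e₂ v₂]
        simp
      · rw [h₁ hd.1 hp₁ hq₁ v₁, h₂ hd.2.1 hp₂ hq₂ v₂, mul_one, mul_one, e₃ v₁ v₂]
  | sumInf H₁ H₂ h₁ h₂ =>
    obtain ⟨p₁, p₂, hp₁, hp₂, rfl⟩ := hp
    obtain ⟨q₁, q₂, a, b, hq₁, hq₂, ha, hb, e₁, e₂, e₃, rfl⟩ := hq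
    have hdis := hd.2.2
    have hdis' : Disjoint H₁.dual.coords H₂.dual.coords := by simpa using hdis
    have A := hp₂.pair_left_combine (p₁ := p₁) hdis 1 1 (a • q₁ + b • q₂)
    have B := hp₁.pair_right_combine (p₂ := p₂) hdis 1 1 (a • q₁ + b • q₂)
    simp only [one_smul, one_mul] at A B
    rw [pair_sumInf hdis, A, B, pair_comm H₁, pair_comm H₂, hq₂.pair_left_combine hdis',
      hq₁.pair_right_combine hdis', ← pair_comm, ← pair_comm]
    rw [vanish_sumInf] at hv
    simp only [vanish_dual] at e₁ e₂ e₃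
    by_cases v₁ : H₁.Vanish s
    · have v₂ : ¬ H₂.Vanish s := fun v₂ => hv ⟨v₁, v₂⟩
      rw [h₂ hd.2.1 hp₂ hq₂ v₂, pair_eq_zero_left H₁ _ (by simp [hp₁.eq_zero_of_vanish v₁]), e₁ v₁]
      simp
    · by_cases v₂ : H₂.Vanish s
      · rw [h₁ hd.1 hp₁ hq₁ v₁, pair_eq_zero_left H₂ _ (by simp [hp₂.eq_zero_of_vanish v₂]), e₂ v₂]
        simp
      · rw [h₁ hd.1 hp₁ hq₁ v₁, h₂ hd.2.1 hp₂ hq₂ v₂, mul_one, mul_one, e₃ v₁ v₂]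

theorem RelInt.mem_body {H : HannerRep n} (hd : H.IsDirect) {s : Fin n → SignType} {p : E n}
    (h : H.RelInt s p) : p ∈ H.body :=
  (HannerRep.mem_body hd).2 ⟨fun _ hi => h.apply_eq_zero hi, h.nrm_le_one hd⟩

theorem RelInt.mem_faceSet {H : HannerRep n} (hd : H.IsDirect) {s : Fin n → SignType} {p : E n}
    (h : H.RelInt s p) (hv : ¬ H.Vanish s) : p ∈ H.faceSet s :=
  ((H.dual.relInt_pt s).mem_faceSet_iff hd hv).2
    ⟨h.mem_body hd, h.pair_eq_one hd (H.dual.relInt_pt s) hv⟩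

theorem faceSet_nonempty {H : HannerRep n} (hd : H.IsDirect) {s : Fin n → SignType}
    (hv : ¬ H.Vanish s) : (H.faceSet s).Nonempty := ⟨_, (H.relInt_pt s).mem_faceSet hd hv⟩

theorem RelInt.pair_le_one {H : HannerRep n} (hd : H.IsDirect) {s t : Fin n → SignType} {p q : E n}
    (hp : H.RelInt s p) (hq : H.dual.RelInt t q) : H.pair p q ≤ 1 :=
  (hq.pair_le_nrm hd p).trans (hp.nrm_le_one hd)

/-- The incidence relation of faces is read off from one number. This is the input for the
barycentric fan below. -/
theorem RelInt.pair_eq_one_iff {H : HannerRep n} (hd : H.IsDirect) {s t : Fin n → SignType}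
    {p q : E n} (hp : H.RelInt s p) (hq : H.dual.RelInt t q) (hs : ¬ H.Vanish s)
    (ht : ¬ H.Vanish t) : H.pair p q = 1 ↔ H.faceSet s ⊆ H.faceSet t := by
  constructor
  · rintro h x ⟨hb, hc, h1⟩
    have hq1 : H.dual.nrm q = 1 := hq.nrm_eq_one hd.dual (by simpa using ht)
    refine (hq.mem_faceSet_iff hd ht).2 ⟨hb, ?_⟩
    rw [hp.pair_eq_of_cone hd hs (by rw [h, hq1]) hc, hq1, h1, one_mul]
  · intro h
    exact ((hq.mem_faceSet_iff hd ht).1 (h (hp.mem_faceSet hd hs))).2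

theorem body_convex (H : HannerRep n) : Convex ℝ H.body := by
  induction H with
  | interval i => exact convex_segment _ _
  | sumOne H₁ H₂ h₁ h₂ => exact convex_convexHull _ _
  | sumInf H₁ H₂ h₁ h₂ => exact h₁.add h₂

theorem body_isCompact {H : HannerRep n} (hd : H.IsDirect) : IsCompact H.body := by
  have hclosed : IsClosed H.body := by
    have : H.body = (H.lin : Set (E n)) ∩ {x : E n | H.nrm x ≤ 1} :=
      Set.ext fun x => (mem_body hd).trans (and_congr_left fun _ => (mem_lin hd).symm)
    rw [this]
    exact H.lin.closed_of_finiteDimensional.inter (isClosed_le H.continuous_nrm continuous_const)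
  refine Metric.isCompact_of_isClosed_isBounded hclosed ?_
  refine isBounded_iff_forall_norm_le.2 ⟨√(∑ _i : Fin n, 1), fun x hx => ?_⟩
  rw [EuclideanSpace.norm_eq]
  refine Real.sqrt_le_sqrt (Finset.sum_le_sum fun i _ => ?_)
  obtain ⟨h0, h1⟩ := (mem_body hd).1 hx
  by_cases hi : i ∈ H.coords
  · have := (H.abs_le_nrm hi).trans h1
    rw [Real.norm_eq_abs]
    exact pow_le_one₀ (abs_nonneg _) this
  · simp [h0 i hi]

theorem faceSet_eq {H : HannerRep n} (hd : H.IsDirect) {s : Fin n → SignType}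
    (hv : ¬ H.Vanish s) : H.faceSet s = H.body ∩ {x | inner ℝ x (H.dual.pt s) = (1 : ℝ)} := by
  ext x
  rw [(H.dual.relInt_pt s).mem_faceSet_iff hd hv, (H.dual.relInt_pt s).pair_eq_inner]
  rfl

theorem faceSet_convex {H : HannerRep n} (hd : H.IsDirect) {s : Fin n → SignType}
    (hv : ¬ H.Vanish s) : Convex ℝ (H.faceSet s) := by
  rw [faceSet_eq hd hv]
  refine H.body_convex.inter ?_
  intro x hx y hy a b ha hb hab
  simp only [Set.mem_ofPred_eq, inner_add_left, inner_smul_left] at *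
  simp [hx, hy, hab]

theorem faceSet_isCompact {H : HannerRep n} (hd : H.IsDirect) {s : Fin n → SignType}
    (hv : ¬ H.Vanish s) : IsCompact (H.faceSet s) := by
  rw [faceSet_eq hd hv]
  exact (body_isCompact hd).inter_right (isClosed_eq (by fun_prop) continuous_const)

theorem centroid_mem_faceSet {H : HannerRep n} (hd : H.IsDirect) {s : Fin n → SignType}
    (hv : ¬ H.Vanish s) : centroid (H.faceSet s) ∈ H.faceSet s :=
  centroid_mem (faceSet_convex hd hv) (faceSet_isCompact hd hv) (faceSet_nonempty hd hv)

theorem dim_faceSet_lt {H : HannerRep n} (hd : H.IsDirect) {s : Fin n → SignType}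
    (hv : ¬ H.Vanish s) : dim (H.faceSet s) < dim H.body := by
  have hq := H.dual.relInt_pt s
  refine dim_lt_dim (fun x hx => hx.1) (H.dual.pt s) 1 (fun x hx => ?_) (faceSet_nonempty hd hv)
    (zero_mem_body hd) (by simp)
  rw [real_inner_comm, ← hq.pair_eq_inner]
  exact ((hq.mem_faceSet_iff hd hv).1 hx).2

theorem faceSet_ssubset_dim_lt {H : HannerRep n} (hd : H.IsDirect) {s t : Fin n → SignType}
    (hs : ¬ H.Vanish s) (h : H.faceSet s ⊂ H.faceSet t) :
    dim (H.faceSet s) < dim (H.faceSet t) := by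
  have hq := H.dual.relInt_pt s
  obtain ⟨y, hy, hys⟩ := Set.exists_of_ssubset h
  refine dim_lt_dim h.1 (H.dual.pt s) 1 (fun x hx => ?_) (faceSet_nonempty hd hs) hy ?_
  · rw [real_inner_comm, ← hq.pair_eq_inner]
    exact ((hq.mem_faceSet_iff hd hs).1 hx).2
  · rw [real_inner_comm, ← hq.pair_eq_inner]
    exact fun h1 => hys ((hq.mem_faceSet_iff hd hs).2 ⟨hy.1, h1⟩)

/-! ### Faces of standard Hanner polytopes -/

theorem IsStandard.mem_body {H : HannerRep n} (h : H.IsStandard) {x : E n} :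
    x ∈ H.body ↔ H.nrm x ≤ 1 := by
  rw [HannerRep.mem_body h.1, h.2]; simp

/-- One inclusion is Hölder's inequality. For the other, y is tested at a point of H where it
attains its norm, which `exists_cone` provides. -/
theorem IsStandard.polarBody_body {H : HannerRep n} (h : H.IsStandard) :
    polarBody H.body = H.dual.body := by
  ext y
  rw [h.dual.mem_body]
  constructor
  · intro hy
    rcases (H.dual.nrm_nonneg y).eq_or_lt with h0 | hpos
    · linarith
    · obtain ⟨s, hs, hc⟩ := exists_cone h.1 hpos
      have hp := H.relInt_pt s
      have := hy _ (hp.mem_body h.1)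
      rw [← h.pair_eq_inner, (hc _).2 (hp.mem_faceSet h.1 hs).2.1, hp.nrm_eq_one h.1 hs,
        mul_one] at this
      exact this
  · intro hy x hx
    rw [h.mem_body] at hx
    rw [← h.pair_eq_inner]
    exact (pair_le h.1 x y).trans (mul_le_one₀ hx (nrm_nonneg _ _) hy)

theorem IsStandard.isFace_faceSet {H : HannerRep n} (h : H.IsStandard) {s : Fin n → SignType}
    (hs : ¬ H.Vanish s) : IsFace H.body (H.faceSet s) := by
  have hq := H.dual.relInt_pt s
  refine ⟨H.dual.pt s, 1, ?_, ?_, ?_, ?_⟩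
  · intro h0
    have := hq.nrm_eq_one h.1.dual (by simpa using hs)
    rw [h0, nrm_zero] at this
    exact zero_ne_one this
  · intro x hx
    rw [real_inner_comm, ← hq.pair_eq_inner]
    exact (hq.pair_le_nrm h.1 x).trans (h.mem_body.1 hx)
  · obtain ⟨x, hx⟩ := faceSet_nonempty h.1 hs
    refine ⟨x, hx.1, ?_⟩
    rw [real_inner_comm, ← hq.pair_eq_inner]
    exact ((hq.mem_faceSet_iff h.1 hs).1 hx).2
  · rw [faceSet_eq h.1 hs]
    ext x
    simp [real_inner_comm]

/-- The level of a supporting hyperplane must be the dual norm of its normal, so the face consists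
of the unit vectors normed by that normal, and `exists_cone` supplies the code. -/
theorem IsStandard.isFace_iff {H : HannerRep n} (h : H.IsStandard) {F : Set (E n)} :
    IsFace H.body F ↔ ∃ s, ¬ H.Vanish s ∧ F = H.faceSet s := by
  constructor
  · rintro ⟨θ, a, hθ, hle, ⟨x₀, hx₀, hx₀a⟩, rfl⟩
    have hpos : 0 < H.dual.nrm θ := by
      refine lt_of_le_of_ne (nrm_nonneg _ _) fun h0 => hθ ?_
      ext i
      exact H.dual.nrm_eq_zero_iff.1 h0.symm i (by simp [h.2])
    obtain ⟨s, hs, hc⟩ := exists_cone h.1 hpos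
    have hp := H.relInt_pt s
    have h1 := hle _ (hp.mem_body h.1)
    rw [real_inner_comm, ← h.pair_eq_inner, (hc _).2 (hp.mem_faceSet h.1 hs).2.1,
      hp.nrm_eq_one h.1 hs, mul_one] at h1
    have h2 : a ≤ H.dual.nrm θ := by
      rw [← hx₀a, real_inner_comm, ← h.pair_eq_inner]
      exact (pair_le h.1 _ _).trans
        (mul_le_of_le_one_left (nrm_nonneg _ _) (h.mem_body.1 hx₀))
    have ha : a = H.dual.nrm θ := le_antisymm h2 h1
    refine ⟨s, hs, ?_⟩
    ext x
    constructor
    · rintro ⟨hx, hxa⟩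
      rw [real_inner_comm, ← h.pair_eq_inner, ha] at hxa
      have h3 := pair_le h.1 x θ
      have h4 := h.mem_body.1 hx
      have h5 : H.nrm x = 1 := by
        refine le_antisymm h4 ?_
        rw [hxa] at h3
        exact le_of_mul_le_mul_right (by linarith) hpos
      exact ⟨hx, (hc x).1 (by rw [hxa, h5, mul_one]), h5⟩
    · rintro ⟨hx, hcx, h1⟩
      refine ⟨hx, ?_⟩
      rw [real_inner_comm, ← h.pair_eq_inner, (hc x).2 hcx, h1, mul_one, ha]
  · rintro ⟨s, hs, rfl⟩
    exact h.isFace_faceSet hs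

/-- Polarity keeps the code: by `RelInt.pair_eq_of_cone` the condition on all of F reduces to one
relative interior point, which in turn serves as the functional cutting out the dual face. -/
theorem IsStandard.dualFace_faceSet {H : HannerRep n} (h : H.IsStandard) {s : Fin n → SignType}
    (hs : ¬ H.Vanish s) : dualFace H.body (H.faceSet s) = H.dual.faceSet s := by
  have hp : H.dual.dual.RelInt s (H.pt s) := by simpa using H.relInt_pt s
  have hs' : ¬ H.dual.Vanish s := by simpa using hs
  ext y
  rw [hp.mem_faceSet_iff h.1.dual hs', ← pair_comm, dualFace, h.polarBody_body]
  constructor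
  · rintro ⟨hy, h1⟩
    refine ⟨hy, ?_⟩
    rw [h.pair_eq_inner]
    exact h1 _ ((H.relInt_pt s).mem_faceSet h.1 hs)
  · rintro ⟨hy, h1⟩
    refine ⟨hy, fun x hx => ?_⟩
    have hn : H.dual.nrm y = 1 := by
      refine le_antisymm (h.dual.mem_body.1 hy) ?_
      rw [← h1]
      exact (pair_le h.1 _ _).trans
        (mul_le_of_le_one_left (nrm_nonneg _ _) ((H.relInt_pt s).nrm_le_one h.1))
    rw [← h.pair_eq_inner, (H.relInt_pt s).pair_eq_of_cone h.1 hs (by rw [h1, hn]) hx.2.1, hn, hx.2.2,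
      one_mul]

end HannerRep

end HannerMahler

end

/-! ### The subspaces A_F touch H in a single point. -/

noncomputable section

namespace HannerMahler

/-- The coset `p + W`. -/
def coset {n : ℕ} (p : E n) (W : Submodule ℝ (E n)) : Set (E n) := {x | x - p ∈ W}

theorem coset_zero {n : ℕ} (W : Submodule ℝ (E n)) : coset 0 W = W := by
  ext x; simp [coset]

theorem coset_add_coset {n : ℕ} (p q : E n) (V W : Submodule ℝ (E n)) :
    coset p V + coset q W = coset (p + q) (V ⊔ W) := by
  ext x
  rw [Set.mem_add]
  simp only [coset, Set.mem_ofPred_eq, Submodule.mem_sup]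
  constructor
  · rintro ⟨a, ha, b, hb, rfl⟩
    exact ⟨_, ha, _, hb, by abel⟩
  · rintro ⟨a, ha, b, hb, hab⟩
    exact ⟨p + a, by simpa, q + b, by simpa, by
      rw [show p + a + (q + b) = p + q + (a + b) by abel, hab]; abel⟩

theorem smul_coset {n : ℕ} {a : ℝ} (ha : a ≠ 0) (p : E n) (W : Submodule ℝ (E n)) :
    a • coset p W = coset (a • p) W := by
  ext x
  rw [Set.mem_smul_set_iff_inv_smul_mem₀ ha]
  simp only [coset, Set.mem_ofPred_eq]
  rw [← W.smul_mem_iff ha, smul_sub, smul_inv_smul₀ ha]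

theorem isClosed_coset {n : ℕ} (p : E n) (W : Submodule ℝ (E n)) : IsClosed (coset p W) :=
  W.closed_of_finiteDimensional.preimage (by fun_prop : Continuous fun x : E n => x - p)

namespace HannerRep

variable {n : ℕ}

/-- Properties of the affine subspace associated with the face of `H` with sign vector `s`:
it touches `H` exactly in the point `p`, and lies in the hyperplane `⟨x, q⟩ = 1`. -/
structure TouchesAt (H : HannerRep n) (s : Fin n → SignType) (A : Set (E n)) (p q : E n) :
    Prop where
  subset_lin : A ⊆ H.lin
  exists_coset : ∃ W, A = coset p W
  relInt : H.RelInt s p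
  relInt_dual : H.dual.RelInt s q
  pair_eq_one : ∀ x ∈ A, H.pair x q = 1
  eq_of_nrm_le : ∀ x ∈ A, H.nrm x ≤ 1 → x = p

theorem TouchesAt.one_le_nrm {H : HannerRep n} (hd : H.IsDirect) {s : Fin n → SignType}
    {A : Set (E n)} {p q : E n} (h : H.TouchesAt s A p q) {x : E n} (hx : x ∈ A) :
    1 ≤ H.nrm x :=
  (h.pair_eq_one x hx).symm.le.trans (h.relInt_dual.pair_le_nrm hd x)

theorem mem_faceSet_left {H₁ H₂ : HannerRep n} (hd : (sumOne H₁ H₂).IsDirect)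
    {s : Fin n → SignType} {x : E n} (hx : x ∈ (sumOne H₁ H₂).faceSet s) (hl : x ∈ H₁.lin) :
    ¬ H₁.Vanish s ∧ x ∈ H₁.faceSet s := by
  obtain ⟨hb, hc, h1⟩ := hx
  rw [mem_lin hd.1] at hl
  have h2 : H₂.nrm x = 0 :=
    H₂.nrm_eq_zero_iff.2 fun i hi => hl i (Finset.disjoint_right.1 hd.2.2 hi)
  simp only [nrm, h2, add_zero] at h1
  have hv : ¬ H₁.Vanish s := fun hv => by
    have := hc.1.1 hv
    rw [h1] at this
    exact one_ne_zero this
  exact ⟨hv, (mem_body hd.1).2 ⟨hl, h1.le⟩, hc.1.2 hv, h1⟩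

theorem mem_faceSet_right {H₁ H₂ : HannerRep n} (hd : (sumOne H₁ H₂).IsDirect)
    {s : Fin n → SignType} {x : E n} (hx : x ∈ (sumOne H₁ H₂).faceSet s) (hl : x ∈ H₂.lin) :
    ¬ H₂.Vanish s ∧ x ∈ H₂.faceSet s := by
  obtain ⟨hb, hc, h1⟩ := hx
  rw [mem_lin hd.2.1] at hl
  have h2 : H₁.nrm x = 0 :=
    H₁.nrm_eq_zero_iff.2 fun i hi => hl i (Finset.disjoint_left.1 hd.2.2 hi)
  simp only [nrm, h2, zero_add] at h1
  have hv : ¬ H₂.Vanish s := fun hv => by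
    have := hc.2.1 hv
    rw [h1] at this
    exact one_ne_zero this
  exact ⟨hv, (mem_body hd.2.1).2 ⟨hl, h1.le⟩, hc.2.2 hv, h1⟩

theorem cone_of_nrm_eq_zero {H : HannerRep n} (hd : H.IsDirect) {s : Fin n → SignType}
    (hv : ¬ H.Vanish s) {x : E n} (hx : H.nrm x = 0) : H.Cone s x := by
  rw [← (H.dual.relInt_pt s).pair_eq_nrm_iff hd hv, hx,
    pair_eq_zero_left _ _ (H.nrm_eq_zero_iff.1 hx)]

theorem cone_congr_right {H : HannerRep n} (hd : H.IsDirect) {s : Fin n → SignType}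
    (hv : ¬ H.Vanish s) {x y : E n} (hxy : ∀ i ∈ H.coords, x i = y i) :
    H.Cone s x ↔ H.Cone s y := by
  rw [← (H.dual.relInt_pt s).pair_eq_nrm_iff hd hv, ← (H.dual.relInt_pt s).pair_eq_nrm_iff hd hv,
    H.nrm_congr hxy, H.pair_congr hxy fun _ _ => rfl]

theorem faceSet_sumOne_inter_left {H₁ H₂ : HannerRep n} (hd : (sumOne H₁ H₂).IsDirect)
    {s : Fin n → SignType} (hv : ¬ H₁.Vanish s) :
    (sumOne H₁ H₂).faceSet s ∩ H₁.lin = H₁.faceSet s := by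
  ext x
  constructor
  · rintro ⟨hx, hl⟩
    exact (mem_faceSet_left hd hx hl).2
  · rintro ⟨hb, hc, h1⟩
    have hl := ((mem_body hd.1).1 hb).1
    have h2 : H₂.nrm x = 0 :=
      H₂.nrm_eq_zero_iff.2 fun i hi => hl i (Finset.disjoint_right.1 hd.2.2 hi)
    refine ⟨⟨subset_convexHull ℝ _ (Or.inl hb), ⟨⟨fun h => absurd h hv, fun _ => hc⟩,
      fun _ => h2, fun hv2 => cone_of_nrm_eq_zero hd.2.1 hv2 h2⟩, ?_⟩, (mem_lin hd.1).2 hl⟩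
    rw [nrm, h1, h2, add_zero]

theorem faceSet_sumOne_inter_right {H₁ H₂ : HannerRep n} (hd : (sumOne H₁ H₂).IsDirect)
    {s : Fin n → SignType} (hv : ¬ H₂.Vanish s) :
    (sumOne H₁ H₂).faceSet s ∩ H₂.lin = H₂.faceSet s := by
  ext x
  constructor
  · rintro ⟨hx, hl⟩
    exact (mem_faceSet_right hd hx hl).2
  · rintro ⟨hb, hc, h1⟩
    have hl := ((mem_body hd.2.1).1 hb).1
    have h2 : H₁.nrm x = 0 :=
      H₁.nrm_eq_zero_iff.2 fun i hi => hl i (Finset.disjoint_left.1 hd.2.2 hi)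
    refine ⟨⟨subset_convexHull ℝ _ (Or.inr hb), ⟨⟨fun _ => h2,
      fun hv2 => cone_of_nrm_eq_zero hd.1 hv2 h2⟩, fun h => absurd h hv, fun _ => hc⟩, ?_⟩,
      (mem_lin hd.2.1).2 hl⟩
    rw [nrm, h1, h2, zero_add]

theorem faceSet_sumOne_inter_left_eq_empty {H₁ H₂ : HannerRep n} (hd : (sumOne H₁ H₂).IsDirect)
    {s : Fin n → SignType} (hv : H₁.Vanish s) :
    (sumOne H₁ H₂).faceSet s ∩ H₁.lin = ∅ :=
  Set.eq_empty_of_forall_notMem fun _ hx => (mem_faceSet_left hd hx.1 hx.2).1 hv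

theorem faceSet_sumOne_inter_right_eq_empty {H₁ H₂ : HannerRep n} (hd : (sumOne H₁ H₂).IsDirect)
    {s : Fin n → SignType} (hv : H₂.Vanish s) :
    (sumOne H₁ H₂).faceSet s ∩ H₂.lin = ∅ :=
  Set.eq_empty_of_forall_notMem fun _ hx => (mem_faceSet_right hd hx.1 hx.2).1 hv

theorem restr_mem_body {H : HannerRep n} (hd : H.IsDirect) {x : E n} (hx : H.nrm x ≤ 1) :
    restr H.coords x ∈ H.body :=
  (mem_body hd).2 ⟨fun i hi => by simp [hi], by rwa [nrm_restr]⟩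

theorem restr_mem_faceSet {H : HannerRep n} (hd : H.IsDirect) {s : Fin n → SignType}
    (hv : ¬ H.Vanish s) {x : E n} (hc : H.Cone s x) (hx : H.nrm x = 1) :
    restr H.coords x ∈ H.faceSet s :=
  ⟨restr_mem_body hd hx.le,
    (cone_congr_right hd hv fun i hi => by simp [hi]).2 hc, by rwa [nrm_restr]⟩

/-- A face of an ℓ_∞-sum is a product, where a factor with vanishing code is the whole summand. The
implications `hy'` and `hz'` cover all three shapes at once. -/
theorem add_mem_faceSet_sumInf {H₁ H₂ : HannerRep n} (hd : (sumInf H₁ H₂).IsDirect)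
    {s : Fin n → SignType} (hv : ¬ (sumInf H₁ H₂).Vanish s) {y z : E n} (hy : y ∈ H₁.body)
    (hz : z ∈ H₂.body) (hy' : ¬ H₁.Vanish s → y ∈ H₁.faceSet s)
    (hz' : ¬ H₂.Vanish s → z ∈ H₂.faceSet s) : y + z ∈ (sumInf H₁ H₂).faceSet s := by
  obtain ⟨y0, y1⟩ := (mem_body hd.1).1 hy
  obtain ⟨z0, z1⟩ := (mem_body hd.2.1).1 hz
  have a : ∀ i ∈ H₁.coords, (y + z) i = y i := fun i hi => by
    simp [z0 i (Finset.disjoint_left.1 hd.2.2 hi)]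
  have b : ∀ i ∈ H₂.coords, (y + z) i = z i := fun i hi => by
    simp [y0 i (Finset.disjoint_right.1 hd.2.2 hi)]
  have n₁ := H₁.nrm_congr a
  have n₂ := H₂.nrm_congr b
  refine ⟨Set.add_mem_add hy hz, ⟨fun h => ⟨(cone_congr_right hd.1 h a).2 (hy' h).2.1, ?_⟩,
    fun h => ⟨(cone_congr_right hd.2.1 h b).2 (hz' h).2.1, ?_⟩⟩, ?_⟩
  · rw [n₁, n₂, (hy' h).2.2]; exact z1
  · rw [n₁, n₂, (hz' h).2.2]; exact y1
  · rw [nrm, n₁, n₂]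
    by_cases h : H₁.Vanish s
    · have h2 : ¬ H₂.Vanish s := fun h2 => hv (vanish_sumInf.2 ⟨h, h2⟩)
      rw [(hz' h2).2.2, max_eq_right y1]
    · rw [(hy' h).2.2, max_eq_left z1]

theorem image_faceSet_sumInf_left {H₁ H₂ : HannerRep n} (hd : (sumInf H₁ H₂).IsDirect)
    {s : Fin n → SignType} (hv : ¬ (sumInf H₁ H₂).Vanish s) :
    H₁.lin.starProjection '' (sumInf H₁ H₂).faceSet s =
      {y ∈ H₁.body | ¬ H₁.Vanish s → y ∈ H₁.faceSet s} := by
  ext y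
  constructor
  · rintro ⟨x, ⟨hb, hc, h1⟩, rfl⟩
    rw [starProjection_lin hd.1]
    simp only [nrm] at h1
    refine ⟨restr_mem_body hd.1 (h1 ▸ le_max_left _ _), fun h => ?_⟩
    obtain ⟨c, hle⟩ := hc.1 h
    rw [max_eq_left hle] at h1
    exact restr_mem_faceSet hd.1 h c h1
  · rintro ⟨hy, hy'⟩
    obtain ⟨y0, y1⟩ := (mem_body hd.1).1 hy
    have hp := H₂.relInt_pt s
    refine ⟨y + H₂.pt s, add_mem_faceSet_sumInf hd hv hy (hp.mem_body hd.2.1) hy'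
      (hp.mem_faceSet hd.2.1), ?_⟩
    rw [starProjection_lin hd.1, map_add, restr_eq_self y0]
    ext i
    by_cases hi : i ∈ H₁.coords
    · simp [hi, hp.apply_eq_zero (Finset.disjoint_left.1 hd.2.2 hi)]
    · simp [hi]

theorem image_faceSet_sumInf_right {H₁ H₂ : HannerRep n} (hd : (sumInf H₁ H₂).IsDirect)
    {s : Fin n → SignType} (hv : ¬ (sumInf H₁ H₂).Vanish s) :
    H₂.lin.starProjection '' (sumInf H₁ H₂).faceSet s =
      {y ∈ H₂.body | ¬ H₂.Vanish s → y ∈ H₂.faceSet s} := by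
  ext y
  constructor
  · rintro ⟨x, ⟨hb, hc, h1⟩, rfl⟩
    rw [starProjection_lin hd.2.1]
    simp only [nrm] at h1
    refine ⟨restr_mem_body hd.2.1 (h1 ▸ le_max_right _ _), fun h => ?_⟩
    obtain ⟨c, hle⟩ := hc.2 h
    rw [max_eq_right hle] at h1
    exact restr_mem_faceSet hd.2.1 h c h1
  · rintro ⟨hy, hy'⟩
    obtain ⟨y0, y1⟩ := (mem_body hd.2.1).1 hy
    have hp := H₁.relInt_pt s
    refine ⟨H₁.pt s + y, add_mem_faceSet_sumInf hd hv (hp.mem_body hd.1) hy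
      (hp.mem_faceSet hd.1) hy', ?_⟩
    rw [starProjection_lin hd.2.1, map_add, restr_eq_self y0]
    ext i
    by_cases hi : i ∈ H₂.coords
    · simp [hi, hp.apply_eq_zero (Finset.disjoint_right.1 hd.2.2 hi)]
    · simp [hi]

theorem faceSet_ne_body {H : HannerRep n} (hd : H.IsDirect) (s : Fin n → SignType) :
    H.faceSet s ≠ H.body := fun h => by
  have h0 : (0 : E n) ∈ H.faceSet s := h ▸ zero_mem_body hd
  have := h0.2.2
  rw [nrm_zero] at this
  exact zero_ne_one this

theorem faceSet_pair_eq_one {H : HannerRep n} (hd : H.IsDirect) {s : Fin n → SignType}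
    (hv : ¬ H.Vanish s) {q : E n} (hq : H.dual.RelInt s q) {x : E n} (hx : x ∈ H.faceSet s) :
    H.pair x q = 1 := ((hq.mem_faceSet_iff hd hv).1 hx).2

/-- The affine subspaces `A_F` of the faces of a Hanner polytope touch it in one point. -/
theorem exists_touchesAt_affSub {H : HannerRep n} (hd : H.IsDirect) {s : Fin n → SignType}
    (hv : ¬ H.Vanish s) : ∃ p q, H.TouchesAt s (H.affSub (H.faceSet s)) p q := by
  induction H with
  | interval i =>
    have hi : s i ≠ 0 := fun h0 => hv fun j hj => by
      simp only [coords, Finset.mem_singleton] at hj; rw [hj, h0]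
    have hp := (interval i).relInt_pt s
    have hq := (interval i).dual.relInt_pt s
    have hF : (interval i).faceSet s = {(interval i).pt s} := by
      ext x
      rw [hp.mem_faceSet_iff (H := interval i) hd hv, mem_body hd, Set.mem_singleton_iff]
      simp only [coords, Finset.mem_singleton, pair, Finset.sum_singleton, pt, nrm,
        PiLp.single_apply, if_true]
      have h2 : ((s i : SignType) : ℝ) * (s i : ℝ) = 1 := by
        rcases hs : s i with _ | _ | _ <;> simp_all
      constructor
      · rintro ⟨⟨h0, -⟩, h1⟩
        ext j
        by_cases hj : j = i
        · subst hj
          simp only [PiLp.single_apply, if_true]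
          linear_combination (s j : ℝ) * h1 - x j * h2
        · simp [hj, h0 j hj]
      · rintro rfl
        refine ⟨⟨fun j hj => by simp [hj], ?_⟩, by simp [h2]⟩
        rcases hs : s i with _ | _ | _ <;> simp_all
    refine ⟨_, _, ?_, ⟨⊥, ?_⟩, hp, hq, fun x hx => ?_, fun x hx _ => ?_⟩
    · rw [affSub]
      exact fun x hx => Submodule.subset_span hx.1
    · rw [affSub, hF]
      ext x; simp [coset, sub_eq_zero]
    · exact faceSet_pair_eq_one hd hv hq hx
    · rw [affSub, hF] at hx
      exact hx
  | sumOne H₁ H₂ h₁ h₂ =>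
    have hdis := hd.2.2
    have hdis' : Disjoint H₁.dual.coords H₂.dual.coords := by simpa using hdis
    have hne : ∀ {s}, ¬ H₁.Vanish s → H₁.faceSet s ≠ ∅ := fun h =>
      (faceSet_nonempty hd.1 h).ne_empty
    have hne' : ∀ {s}, ¬ H₂.Vanish s → H₂.faceSet s ≠ ∅ := fun h =>
      (faceSet_nonempty hd.2.1 h).ne_empty
    have key : ∀ {q₁ q₂ : E n}, H₁.dual.RelInt s q₁ → H₂.dual.RelInt s q₂ → ∀ x,
        (sumOne H₁ H₂).pair x (q₁ + q₂) = H₁.pair x q₁ + H₂.pair x q₂ := by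
      intro q₁ q₂ hq₁ hq₂ x
      have A := hq₂.pair_left_combine (p₁ := q₁) hdis' 1 1 x
      have B := hq₁.pair_right_combine (p₂ := q₂) hdis' 1 1 x
      simp only [one_smul, one_mul, ← pair_comm] at A B
      rw [pair_sumOne hdis, A, B]
    have lin_le : H₁.lin ≤ (sumOne H₁ H₂).lin := fun x hx => (mem_lin hd).2 fun i hi =>
      (mem_lin hd.1).1 hx i fun h => hi (by simp [coords, h])
    have lin_le' : H₂.lin ≤ (sumOne H₁ H₂).lin := fun x hx => (mem_lin hd).2 fun i hi =>
      (mem_lin hd.2.1).1 hx i fun h => hi (by simp [coords, h])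
    have r₁ : ∀ {y z : E n}, y ∈ H₁.lin → z ∈ H₂.lin → ∀ i ∈ H₁.coords, (y + z) i = y i :=
      fun hy hz i hi => by simp [(mem_lin hd.2.1).1 hz i (Finset.disjoint_left.1 hdis hi)]
    have r₂ : ∀ {y z : E n}, y ∈ H₁.lin → z ∈ H₂.lin → ∀ i ∈ H₂.coords, (y + z) i = z i :=
      fun hy hz i hi => by simp [(mem_lin hd.1).1 hy i (Finset.disjoint_right.1 hdis hi)]
    by_cases v₂ : H₂.Vanish s
    · have v₁ : ¬ H₁.Vanish s := fun v₁ => hv (vanish_sumOne.2 ⟨v₁, v₂⟩)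
      obtain ⟨p, q, hA⟩ := h₁ hd.1 v₁
      have hEq : (sumOne H₁ H₂).affSub ((sumOne H₁ H₂).faceSet s) =
          H₁.affSub (H₁.faceSet s) + (H₂.lin : Set (E n)) := by
        simp only [affSub, faceSet_sumOne_inter_right_eq_empty hd v₂,
          faceSet_sumOne_inter_left hd v₁, if_true]
      have hq2 := H₂.dual.relInt_pt s
      have hz : H₂.dual.pt s = 0 := hq2.eq_zero_of_vanish (by simpa using v₂)
      rw [hEq]
      refine ⟨p, q + H₂.dual.pt s, ?_, ?_, ?_, ⟨_, _, hA.relInt_dual, hq2, rfl⟩, ?_, ?_⟩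
      · rintro _ ⟨y, hy, z, hz, rfl⟩
        exact Submodule.add_mem _ (lin_le (hA.subset_lin hy)) (lin_le' hz)
      · obtain ⟨W, hW⟩ := hA.exists_coset
        refine ⟨W ⊔ H₂.lin, ?_⟩
        rw [hW, ← coset_zero H₂.lin, coset_add_coset, add_zero]
      · refine ⟨p, 0, 1, 1, hA.relInt, ?_, one_pos, one_pos, fun _ => rfl, fun _ => rfl,
          fun _ h => absurd v₂ h, by simp⟩
        have := (H₂.relInt_pt s).eq_zero_of_vanish v₂
        exact this ▸ H₂.relInt_pt s
      · rintro _ ⟨y, hy, z, hzl, rfl⟩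
        simp only
        rw [key hA.relInt_dual hq2, pair_eq_zero_right H₂ _ (by simp [hz]),
          H₁.pair_congr (r₁ (hA.subset_lin hy) hzl) fun _ _ => rfl, hA.pair_eq_one y hy, add_zero]
      · rintro _ ⟨y, hy, z, hzl, rfl⟩ hle
        simp only [nrm] at hle
        rw [H₁.nrm_congr (r₁ (hA.subset_lin hy) hzl), H₂.nrm_congr (r₂ (hA.subset_lin hy) hzl)]
          at hle
        have e1 := hA.one_le_nrm hd.1 hy
        have e2 := H₂.nrm_nonneg z
        have e3 : H₂.nrm z = 0 := by linarith
        have e4 : z = 0 := by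
          ext i
          by_cases hi : i ∈ H₂.coords
          · exact H₂.nrm_eq_zero_iff.1 e3 i hi
          · exact (mem_lin hd.2.1).1 hzl i hi
        simp only [e4, add_zero]
        exact hA.eq_of_nrm_le y hy (by linarith)
    · by_cases v₁ : H₁.Vanish s
      · obtain ⟨p, q, hA⟩ := h₂ hd.2.1 v₂
        have hEq : (sumOne H₁ H₂).affSub ((sumOne H₁ H₂).faceSet s) =
            (H₁.lin : Set (E n)) + H₂.affSub (H₂.faceSet s) := by
          simp only [affSub, faceSet_sumOne_inter_right hd v₂,
            faceSet_sumOne_inter_left_eq_empty hd v₁, if_true, hne' v₂, if_false]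
        have hq1 := H₁.dual.relInt_pt s
        have hz : H₁.dual.pt s = 0 := hq1.eq_zero_of_vanish (by simpa using v₁)
        rw [hEq]
        refine ⟨p, H₁.dual.pt s + q, ?_, ?_, ?_, ⟨_, _, hq1, hA.relInt_dual, rfl⟩, ?_, ?_⟩
        · rintro _ ⟨y, hy, z, hz, rfl⟩
          exact Submodule.add_mem _ (lin_le hy) (lin_le' (hA.subset_lin hz))
        · obtain ⟨W, hW⟩ := hA.exists_coset
          refine ⟨H₁.lin ⊔ W, ?_⟩
          rw [hW, ← coset_zero H₁.lin, coset_add_coset, zero_add]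
        · refine ⟨0, p, 1, 1, ?_, hA.relInt, one_pos, one_pos, fun _ => rfl, fun _ => rfl,
            fun h _ => absurd v₁ h, by simp⟩
          have := (H₁.relInt_pt s).eq_zero_of_vanish v₁
          exact this ▸ H₁.relInt_pt s
        · rintro _ ⟨y, hyl, z, hz', rfl⟩
          simp only
          rw [key hq1 hA.relInt_dual, pair_eq_zero_right H₁ _ (by simp [hz]),
            H₂.pair_congr (r₂ hyl (hA.subset_lin hz')) fun _ _ => rfl, hA.pair_eq_one z hz',
            zero_add]
        · rintro _ ⟨y, hyl, z, hz', rfl⟩ hle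
          simp only [nrm] at hle
          rw [H₁.nrm_congr (r₁ hyl (hA.subset_lin hz')),
            H₂.nrm_congr (r₂ hyl (hA.subset_lin hz'))] at hle
          have e1 := hA.one_le_nrm hd.2.1 hz'
          have e2 := H₁.nrm_nonneg y
          have e3 : H₁.nrm y = 0 := by linarith
          have e4 : y = 0 := by
            ext i
            by_cases hi : i ∈ H₁.coords
            · exact H₁.nrm_eq_zero_iff.1 e3 i hi
            · exact (mem_lin hd.1).1 hyl i hi
          simp only [e4, zero_add]
          exact hA.eq_of_nrm_le z hz' (by linarith)
      · obtain ⟨p₁, q₁, hA₁⟩ := h₁ hd.1 v₁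
        obtain ⟨p₂, q₂, hA₂⟩ := h₂ hd.2.1 v₂
        -- Of the dimension-dependent weights only positivity and sum 1 matter here.
        obtain ⟨a, b, ha, hb, hab, hEq⟩ : ∃ a b : ℝ, 0 < a ∧ 0 < b ∧ a + b = 1 ∧
            (sumOne H₁ H₂).affSub ((sumOne H₁ H₂).faceSet s) =
              a • H₁.affSub (H₁.faceSet s) + b • H₂.affSub (H₂.faceSet s) := by
          refine ⟨((dim (H₁.faceSet s) : ℝ) + 1) /
            ((dim (H₁.faceSet s) : ℝ) + (dim (H₂.faceSet s) : ℝ) + 2),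
            ((dim (H₂.faceSet s) : ℝ) + 1) /
            ((dim (H₁.faceSet s) : ℝ) + (dim (H₂.faceSet s) : ℝ) + 2), by positivity,
            by positivity, ?_, ?_⟩
          · field_simp; ring
          · simp only [affSub, faceSet_sumOne_inter_right hd v₂,
              faceSet_sumOne_inter_left hd v₁, hne v₁, hne' v₂, if_false]
        rw [hEq]
        refine ⟨a • p₁ + b • p₂, q₁ + q₂, ?_, ?_, ⟨p₁, p₂, a, b, hA₁.relInt, hA₂.relInt, ha, hb,
          fun h => absurd h v₁, fun h => absurd h v₂, fun _ _ => hab, rfl⟩,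
          ⟨_, _, hA₁.relInt_dual, hA₂.relInt_dual, rfl⟩, ?_, ?_⟩
        · rintro _ ⟨_, ⟨y, hy, rfl⟩, _, ⟨z, hz, rfl⟩, rfl⟩
          exact Submodule.add_mem _ (Submodule.smul_mem _ _ (lin_le (hA₁.subset_lin hy)))
            (Submodule.smul_mem _ _ (lin_le' (hA₂.subset_lin hz)))
        · obtain ⟨W₁, hW₁⟩ := hA₁.exists_coset
          obtain ⟨W₂, hW₂⟩ := hA₂.exists_coset
          refine ⟨W₁ ⊔ W₂, ?_⟩
          rw [hW₁, hW₂, smul_coset ha.ne', smul_coset hb.ne', coset_add_coset]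
        · rintro _ ⟨_, ⟨y, hy, rfl⟩, _, ⟨z, hz, rfl⟩, rfl⟩
          have my := H₁.lin.smul_mem a (hA₁.subset_lin hy)
          have mz := H₂.lin.smul_mem b (hA₂.subset_lin hz)
          simp only
          rw [key hA₁.relInt_dual hA₂.relInt_dual, H₁.pair_congr (r₁ my mz) fun _ _ => rfl,
            H₂.pair_congr (r₂ my mz) fun _ _ => rfl, pair_smul_left, pair_smul_left,
            hA₁.pair_eq_one y hy, hA₂.pair_eq_one z hz, mul_one, mul_one, hab]
        · rintro _ ⟨_, ⟨y, hy, rfl⟩, _, ⟨z, hz, rfl⟩, rfl⟩ hle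
          have my := H₁.lin.smul_mem a (hA₁.subset_lin hy)
          have mz := H₂.lin.smul_mem b (hA₂.subset_lin hz)
          simp only [nrm] at hle
          rw [H₁.nrm_congr (r₁ my mz), H₂.nrm_congr (r₂ my mz), nrm_smul, nrm_smul,
            abs_of_pos ha, abs_of_pos hb] at hle
          have e1 := hA₁.one_le_nrm hd.1 hy
          have e2 := hA₂.one_le_nrm hd.2.1 hz
          have f1 : H₁.nrm y ≤ 1 := by
            refine le_of_mul_le_mul_left ?_ ha
            have := mul_le_mul_of_nonneg_left e2 hb.le
            linarith
          have f2 : H₂.nrm z ≤ 1 := by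
            refine le_of_mul_le_mul_left ?_ hb
            have := mul_le_mul_of_nonneg_left e1 ha.le
            linarith
          simp only
          rw [hA₁.eq_of_nrm_le y hy f1, hA₂.eq_of_nrm_le z hz f2]
  | sumInf H₁ H₂ h₁ h₂ =>
    have hdis := hd.2.2
    have hdis' : Disjoint H₁.dual.coords H₂.dual.coords := by simpa using hdis
    have key : ∀ {q₁ q₂ : E n}, H₁.dual.RelInt s q₁ → H₂.dual.RelInt s q₂ → ∀ (a b : ℝ) (x : E n),
        (sumInf H₁ H₂).pair x (a • q₁ + b • q₂) = a * H₁.pair x q₁ + b * H₂.pair x q₂ := by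
      intro q₁ q₂ hq₁ hq₂ a b x
      have A := hq₂.pair_left_combine (p₁ := q₁) hdis' a b x
      have B := hq₁.pair_right_combine (p₂ := q₂) hdis' a b x
      simp only [← pair_comm] at A B
      rw [pair_sumInf hdis, A, B]
    have lin_le : H₁.lin ≤ (sumInf H₁ H₂).lin := fun x hx => (mem_lin hd).2 fun i hi =>
      (mem_lin hd.1).1 hx i fun h => hi (by simp [coords, h])
    have lin_le' : H₂.lin ≤ (sumInf H₁ H₂).lin := fun x hx => (mem_lin hd).2 fun i hi =>
      (mem_lin hd.2.1).1 hx i fun h => hi (by simp [coords, h])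
    have r₁ : ∀ {y z : E n}, y ∈ H₁.lin → z ∈ H₂.lin → ∀ i ∈ H₁.coords, (y + z) i = y i :=
      fun hy hz i hi => by simp [(mem_lin hd.2.1).1 hz i (Finset.disjoint_left.1 hdis hi)]
    have r₂ : ∀ {y z : E n}, y ∈ H₁.lin → z ∈ H₂.lin → ∀ i ∈ H₂.coords, (y + z) i = z i :=
      fun hy hz i hi => by simp [(mem_lin hd.1).1 hy i (Finset.disjoint_right.1 hdis hi)]
    have z₁ : ∀ {y : E n}, y ∈ H₁.lin → H₂.nrm y = 0 := fun hy =>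
      H₂.nrm_eq_zero_iff.2 fun i hi => (mem_lin hd.1).1 hy i (Finset.disjoint_right.1 hdis hi)
    have z₂ : ∀ {y : E n}, y ∈ H₂.lin → H₁.nrm y = 0 := fun hy =>
      H₁.nrm_eq_zero_iff.2 fun i hi => (mem_lin hd.2.1).1 hy i (Finset.disjoint_left.1 hdis hi)
    have P₁ : ¬ H₁.Vanish s → {y ∈ H₁.body | ¬ H₁.Vanish s → y ∈ H₁.faceSet s} = H₁.faceSet s :=
      fun v => Set.ext fun x => ⟨fun h => h.2 v, fun h => ⟨h.1, fun _ => h⟩⟩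
    have P₂ : ¬ H₂.Vanish s → {y ∈ H₂.body | ¬ H₂.Vanish s → y ∈ H₂.faceSet s} = H₂.faceSet s :=
      fun v => Set.ext fun x => ⟨fun h => h.2 v, fun h => ⟨h.1, fun _ => h⟩⟩
    have Q₁ : H₁.Vanish s → {y ∈ H₁.body | ¬ H₁.Vanish s → y ∈ H₁.faceSet s} = H₁.body :=
      fun v => Set.ext fun x => ⟨fun h => h.1, fun h => ⟨h, fun h' => absurd v h'⟩⟩
    have Q₂ : H₂.Vanish s → {y ∈ H₂.body | ¬ H₂.Vanish s → y ∈ H₂.faceSet s} = H₂.body :=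
      fun v => Set.ext fun x => ⟨fun h => h.1, fun h => ⟨h, fun h' => absurd v h'⟩⟩
    by_cases v₂ : H₂.Vanish s
    · have v₁ : ¬ H₁.Vanish s := fun v₁ => hv (vanish_sumInf.2 ⟨v₁, v₂⟩)
      obtain ⟨p, q, hA⟩ := h₁ hd.1 v₁
      have hEq : (sumInf H₁ H₂).affSub ((sumInf H₁ H₂).faceSet s) = H₁.affSub (H₁.faceSet s) := by
        simp only [affSub, image_faceSet_sumInf_left hd hv, image_faceSet_sumInf_right hd hv,
          P₁ v₁, Q₂ v₂, if_true]
      have hq2 := H₂.dual.relInt_pt s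
      have hz : H₂.dual.pt s = 0 := hq2.eq_zero_of_vanish (by simpa using v₂)
      have hp2 := H₂.relInt_pt s
      have hz' : H₂.pt s = 0 := hp2.eq_zero_of_vanish v₂
      rw [hEq]
      refine ⟨p, (1 : ℝ) • q + (1 : ℝ) • H₂.dual.pt s, hA.subset_lin.trans lin_le, hA.exists_coset,
        ⟨p, H₂.pt s, hA.relInt, hp2, by simp [hz']⟩, ⟨_, _, 1, 1, hA.relInt_dual, hq2, one_pos,
        one_pos, fun _ => rfl, fun _ => rfl, fun _ h => absurd (by simpa using v₂) h, rfl⟩, ?_, ?_⟩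
      · intro x hx
        rw [key hA.relInt_dual hq2, hA.pair_eq_one x hx, pair_eq_zero_right H₂ _ (by simp [hz])]
        simp
      · intro x hx hle
        exact hA.eq_of_nrm_le x hx ((le_max_left _ _).trans hle)
    · by_cases v₁ : H₁.Vanish s
      · obtain ⟨p, q, hA⟩ := h₂ hd.2.1 v₂
        have hEq : (sumInf H₁ H₂).affSub ((sumInf H₁ H₂).faceSet s) =
            H₂.affSub (H₂.faceSet s) := by
          simp only [affSub, image_faceSet_sumInf_left hd hv, image_faceSet_sumInf_right hd hv,
            Q₁ v₁, P₂ v₂, if_true, faceSet_ne_body hd.2.1 s, if_false]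
        have hq1 := H₁.dual.relInt_pt s
        have hz : H₁.dual.pt s = 0 := hq1.eq_zero_of_vanish (by simpa using v₁)
        have hp1 := H₁.relInt_pt s
        have hz' : H₁.pt s = 0 := hp1.eq_zero_of_vanish v₁
        rw [hEq]
        refine ⟨p, (1 : ℝ) • H₁.dual.pt s + (1 : ℝ) • q, hA.subset_lin.trans lin_le',
          hA.exists_coset, ⟨H₁.pt s, p, hp1, hA.relInt, by simp [hz']⟩,
          ⟨_, _, 1, 1, hq1, hA.relInt_dual, one_pos,
          one_pos, fun _ => rfl, fun _ => rfl, fun h => absurd (by simpa using v₁) h, rfl⟩, ?_, ?_⟩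
        · intro x hx
          rw [key hq1 hA.relInt_dual, hA.pair_eq_one x hx, pair_eq_zero_right H₁ _ (by simp [hz])]
          simp
        · intro x hx hle
          exact hA.eq_of_nrm_le x hx ((le_max_right _ _).trans hle)
      · obtain ⟨p₁, q₁, hA₁⟩ := h₁ hd.1 v₁
        obtain ⟨p₂, q₂, hA₂⟩ := h₂ hd.2.1 v₂
        have c₁ := centroid_mem_faceSet hd.1 v₁
        have c₂ := centroid_mem_faceSet hd.2.1 v₂
        -- Only the positivity of the two codimensions is used, and of the centroids only that they
        -- lie in their faces.
        obtain ⟨d₁, d₂, hd₁, hd₂, hEq⟩ : ∃ d₁ d₂ : ℝ, 0 < d₁ ∧ 0 < d₂ ∧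
            (sumInf H₁ H₂).affSub ((sumInf H₁ H₂).faceSet s) =
              H₁.affSub (H₁.faceSet s) + H₂.affSub (H₂.faceSet s) + (Submodule.span ℝ
                {d₁⁻¹ • centroid (H₁.faceSet s) - d₂⁻¹ • centroid (H₂.faceSet s)} :
                Set (E n)) := by
          refine ⟨(dim H₁.body : ℝ) - (dim (H₁.faceSet s) : ℝ),
            (dim H₂.body : ℝ) - (dim (H₂.faceSet s) : ℝ), ?_, ?_, ?_⟩
          · exact sub_pos.2 (Nat.cast_lt.2 (dim_faceSet_lt hd.1 v₁))
          · exact sub_pos.2 (Nat.cast_lt.2 (dim_faceSet_lt hd.2.1 v₂))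
          · simp only [affSub, image_faceSet_sumInf_left hd hv, image_faceSet_sumInf_right hd hv,
              P₁ v₁, P₂ v₂, faceSet_ne_body hd.2.1 s, faceSet_ne_body hd.1 s, if_false]
        have k₁ := faceSet_pair_eq_one hd.1 v₁ hA₁.relInt_dual c₁
        have k₂ := faceSet_pair_eq_one hd.2.1 v₂ hA₂.relInt_dual c₂
        have l₁ : centroid (H₁.faceSet s) ∈ H₁.lin := Submodule.subset_span c₁.1
        have l₂ : centroid (H₂.faceSet s) ∈ H₂.lin := Submodule.subset_span c₂.1
        generalize centroid (H₁.faceSet s) = g₁ at *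
        generalize centroid (H₂.faceSet s) = g₂ at *
        rw [hEq]
        have repr : ∀ x ∈ H₁.affSub (H₁.faceSet s) + H₂.affSub (H₂.faceSet s) + (Submodule.span ℝ
            {d₁⁻¹ • g₁ - d₂⁻¹ • g₂} : Set (E n)), ∃ y ∈ H₁.affSub (H₁.faceSet s),
            ∃ z ∈ H₂.affSub (H₂.faceSet s), ∃ r : ℝ,
              x = (y + (r / d₁) • g₁) + (z + (-(r / d₂)) • g₂) ∧ y + (r / d₁) • g₁ ∈ H₁.lin ∧
              z + (-(r / d₂)) • g₂ ∈ H₂.lin ∧ H₁.pair x q₁ = 1 + r / d₁ ∧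
              H₂.pair x q₂ = 1 - r / d₂ := by
          rintro _ ⟨_, ⟨y, hy, z, hz, rfl⟩, w, hw, rfl⟩
          obtain ⟨r, rfl⟩ := Submodule.mem_span_singleton.1 hw
          have my : y + (r / d₁) • g₁ ∈ H₁.lin :=
            Submodule.add_mem _ (hA₁.subset_lin hy) (Submodule.smul_mem _ _ l₁)
          have mz : z + (-(r / d₂)) • g₂ ∈ H₂.lin :=
            Submodule.add_mem _ (hA₂.subset_lin hz) (Submodule.smul_mem _ _ l₂)
          have e : y + z + r • (d₁⁻¹ • g₁ - d₂⁻¹ • g₂) =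
              (y + (r / d₁) • g₁) + (z + (-(r / d₂)) • g₂) := by
            simp only [div_eq_mul_inv]; module
          refine ⟨y, hy, z, hz, r, e, my, mz, ?_, ?_⟩
          · simp only
            rw [e, H₁.pair_congr (r₁ my mz) fun _ _ => rfl, pair_add_left, pair_smul_left,
              hA₁.pair_eq_one y hy, k₁, mul_one]
          · simp only
            rw [e, H₂.pair_congr (r₂ my mz) fun _ _ => rfl, pair_add_left, pair_smul_left,
              hA₂.pair_eq_one z hz, k₂]
            ring
        have hs : d₁ + d₂ ≠ 0 := by positivity
        -- The weights in the dual point are proportional to `d₁` and `d₂`, so that the pairing is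
        -- zero on the additional direction `d₁⁻¹ • g₁ - d₂⁻¹ • g₂`.
        refine ⟨p₁ + p₂, (d₁ / (d₁ + d₂)) • q₁ + (d₂ / (d₁ + d₂)) • q₂, ?_, ?_,
          ⟨_, _, hA₁.relInt, hA₂.relInt, rfl⟩,
          ⟨_, _, _, _, hA₁.relInt_dual, hA₂.relInt_dual, by positivity, by positivity,
            fun h => absurd (by simpa using h) v₁, fun h => absurd (by simpa using h) v₂,
            fun _ _ => by field_simp, rfl⟩, ?_, ?_⟩
        · intro x hx
          obtain ⟨y, hy, z, hz, r, rfl, my, mz, -, -⟩ := repr x hx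
          exact Submodule.add_mem _ (lin_le my) (lin_le' mz)
        · obtain ⟨W₁, hW₁⟩ := hA₁.exists_coset
          obtain ⟨W₂, hW₂⟩ := hA₂.exists_coset
          refine ⟨W₁ ⊔ W₂ ⊔ Submodule.span ℝ {d₁⁻¹ • g₁ - d₂⁻¹ • g₂}, ?_⟩
          rw [hW₁, hW₂, coset_add_coset, ← coset_zero (Submodule.span ℝ _), coset_add_coset,
            add_zero]
        · intro x hx
          obtain ⟨y, hy, z, hz, r, -, my, mz, e₁, e₂⟩ := repr x hx
          rw [key hA₁.relInt_dual hA₂.relInt_dual, e₁, e₂]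
          field_simp; ring
        · intro x hx hle
          obtain ⟨y, hy, z, hz, r, rfl, my, mz, e₁, e₂⟩ := repr x hx
          have i₁ := hA₁.relInt_dual.pair_le_nrm hd.1 (y + (r / d₁) • g₁ + (z + (-(r / d₂)) • g₂))
          have i₂ := hA₂.relInt_dual.pair_le_nrm hd.2.1
            (y + (r / d₁) • g₁ + (z + (-(r / d₂)) • g₂))
          simp only [nrm] at hle
          have j₁ := (le_max_left _ _).trans hle
          have j₂ := (le_max_right _ _).trans hle
          -- Moving along the additional direction raises one of the values `1 + r / d₁`, `1 - r /
          -- d₂` above 1, so a point of norm at most 1 has `r = 0`.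
          have hr1 : r / d₁ ≤ 0 := by linarith
          have hr2 : 0 ≤ r / d₂ := by linarith
          have hr : r = 0 := by
            rw [div_nonpos_iff] at hr1
            rw [div_nonneg_iff] at hr2
            rcases hr1 with h | h <;> rcases hr2 with h' | h' <;> linarith [h.1, h.2, h'.1, h'.2]
          subst hr
          simp only [zero_div, neg_zero, zero_smul, add_zero] at j₁ j₂ ⊢
          rw [H₁.nrm_congr (r₁ (hA₁.subset_lin hy) (hA₂.subset_lin hz))] at j₁
          rw [H₂.nrm_congr (r₂ (hA₁.subset_lin hy) (hA₂.subset_lin hz))] at j₂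
          rw [hA₁.eq_of_nrm_le y hy j₁, hA₂.eq_of_nrm_le z hz j₂]

end HannerRep

end HannerMahler

end

/-! ### The barycentric fan and its stability under perturbation. -/

noncomputable section

namespace HannerMahler

/-! ### Families of points indexed by a finite poset -/

section Spread

variable {n : ℕ} {ι : Type*} [PartialOrder ι]

/-- The support of `a` is a chain. -/
def ChainSupp (a : ι → ℝ) : Prop := ∀ i j, a i ≠ 0 → a j ≠ 0 → i ≤ j ∨ j ≤ i

theorem ChainSupp.mono {a b : ι → ℝ} (h : ChainSupp b) (hab : ∀ i, a i ≠ 0 → b i ≠ 0) :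
    ChainSupp a := fun i j hi hj => h i j (hab i hi) (hab j hj)

variable [Fintype ι]

/-- Quantitative form of the statement that the cones spanned by the points `z i`, for `i` in
a chain, form a simplicial fan. -/
def Spread (κ : ℝ) (z : ι → E n) : Prop :=
  ∀ a b : ι → ℝ, (∀ i, 0 ≤ a i) → (∀ i, 0 ≤ b i) → ChainSupp a → ChainSupp b →
    κ * ∑ i, |a i - b i| ≤ ‖∑ i, (a i - b i) • z i‖

theorem ChainSupp.exists_max {a : ι → ℝ} (h : ChainSupp a) (hne : ∃ i, a i ≠ 0) :
    ∃ g, a g ≠ 0 ∧ ∀ i, a i ≠ 0 → i ≤ g := by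
  classical
  obtain ⟨i₀, hi₀⟩ := hne
  obtain ⟨g, hg⟩ := (Finset.univ.filter fun i => a i ≠ 0).exists_maximal ⟨i₀, by simpa using hi₀⟩
  refine ⟨g, by simpa using hg.1, fun i hi => ?_⟩
  rcases h i g hi (by simpa using hg.1) with h1 | h1
  · exact h1
  · exact hg.2 (by simpa using hi) h1

/-- Uniqueness in the barycentric subdivision. -/
theorem chain_disjoint_aux {P Q : ι → E n} (hle : ∀ i j, inner ℝ (P i) (Q j) ≤ 1)
    (heq : ∀ i j, inner ℝ (P i) (Q j) = (1 : ℝ) ↔ i ≤ j) {a b : ι → ℝ} (hb : ∀ i, 0 ≤ b i)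
    (ca : ChainSupp a) (h : ∑ i, a i • P i = ∑ i, b i • P i)
    (hne : ∃ i, a i ≠ 0) :
    ∃ g, a g ≠ 0 ∧ (∀ i, a i ≠ 0 → i ≤ g) ∧ ∑ i, a i ≤ ∑ i, b i ∧
      (∑ i, b i ≤ ∑ i, a i → ∀ i, b i ≠ 0 → i ≤ g) := by
  obtain ⟨g, hg, hmax⟩ := ca.exists_max hne
  -- Since `g` is the top of the chain carrying `a`, every point used on the left pairs to exactly 1
  -- with `Q g`.
  have e : ∑ i, a i = ∑ i, b i * inner ℝ (P i) (Q g) := by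
    have h1 := congrArg (fun x => inner ℝ x (Q g)) h
    simp only [sum_inner, inner_smul_left, conj_trivial] at h1
    rw [← h1]
    refine Finset.sum_congr rfl fun i _ => ?_
    by_cases hi : a i = 0
    · simp [hi]
    · rw [(heq i g).2 (hmax i hi), mul_one]
  have hterm : ∀ i ∈ Finset.univ, b i * inner ℝ (P i) (Q g) ≤ b i := fun i _ =>
    mul_le_of_le_one_right (hb i) (hle i g)
  refine ⟨g, hg, hmax, e ▸ Finset.sum_le_sum hterm, fun h2 i hi => ?_⟩
  have h3 : ∑ i, b i * inner ℝ (P i) (Q g) = ∑ i, b i :=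
    le_antisymm (Finset.sum_le_sum hterm) (e ▸ h2)
  have h4 := (Finset.sum_eq_sum_iff_of_le hterm).1 h3 i (Finset.mem_univ i)
  exact (heq i g).1 (mul_left_cancel₀ hi (h4.trans (mul_one _).symm))

/-- If both combinations were nonzero, the previous lemma used in both directions would give equal
sums and a common top element, contradicting `a i * b i = 0`. -/
theorem chain_disjoint {P Q : ι → E n} (hle : ∀ i j, inner ℝ (P i) (Q j) ≤ 1)
    (heq : ∀ i j, inner ℝ (P i) (Q j) = (1 : ℝ) ↔ i ≤ j) {a b : ι → ℝ} (ha : ∀ i, 0 ≤ a i)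
    (hb : ∀ i, 0 ≤ b i) (ca : ChainSupp a) (cb : ChainSupp b) (hab : ∀ i, a i * b i = 0)
    (h : ∑ i, a i • P i = ∑ i, b i • P i) : (∀ i, a i = 0) ∧ ∀ i, b i = 0 := by
  have zero_of_sum : ∀ c : ι → ℝ, (∀ i, 0 ≤ c i) → ∑ i, c i ≤ 0 → ∀ i, c i = 0 :=
    fun c hc hs i => (Finset.sum_eq_zero_iff_of_nonneg fun i _ => hc i).1
      (le_antisymm hs (Finset.sum_nonneg fun i _ => hc i)) i (Finset.mem_univ i)
  by_cases hA : ∃ i, a i ≠ 0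
  · obtain ⟨g, hg, hmax, hs, hbg⟩ := chain_disjoint_aux hle heq hb ca h hA
    by_cases hB : ∃ i, b i ≠ 0
    · obtain ⟨g', hg', hmax', hs', hag'⟩ := chain_disjoint_aux hle heq ha cb h.symm hB
      have : g = g' := le_antisymm (hag' hs g hg) (hbg hs' g' hg')
      subst this
      rcases mul_eq_zero.1 (hab g) with h0 | h0
      · exact absurd h0 hg
      · exact absurd h0 hg'
    · push Not at hB
      exact ⟨zero_of_sum a ha (by simpa [hB] using hs), hB⟩
  · push Not at hA
    by_cases hB : ∃ i, b i ≠ 0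
    · obtain ⟨g', hg', hmax', hs', hag'⟩ := chain_disjoint_aux hle heq ha cb h.symm hB
      exact ⟨hA, zero_of_sum b hb (by simpa [hA] using hs')⟩
    · push Not at hB
      exact ⟨hA, hB⟩

/-- Compactness: the normalised pairs of disjointly supported chain weights form a compact set, on
which the norm of the difference has no zero by `chain_disjoint`. Homogeneity gives the general
case. -/
theorem exists_chain_gap {P Q : ι → E n} (hle : ∀ i j, inner ℝ (P i) (Q j) ≤ 1)
    (heq : ∀ i j, inner ℝ (P i) (Q j) = (1 : ℝ) ↔ i ≤ j) :
    ∃ κ : ℝ, 0 < κ ∧ ∀ a b : ι → ℝ, (∀ i, 0 ≤ a i) → (∀ i, 0 ≤ b i) → ChainSupp a → ChainSupp b →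
      (∀ i, a i * b i = 0) → κ * ∑ i, (a i + b i) ≤ ‖∑ i, a i • P i - ∑ i, b i • P i‖ := by
  let S : Set ((ι → ℝ) × (ι → ℝ)) := {c | (∀ i, 0 ≤ c.1 i) ∧ (∀ i, 0 ≤ c.2 i) ∧
    (∀ i j, ¬ (i ≤ j ∨ j ≤ i) → c.1 i * c.1 j = 0) ∧
    (∀ i j, ¬ (i ≤ j ∨ j ≤ i) → c.2 i * c.2 j = 0) ∧ (∀ i, c.1 i * c.2 i = 0) ∧
    ∑ i, (c.1 i + c.2 i) = 1}
  -- Being supported on a chain is rewritten as a family of polynomial equations, hence as a closed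
  -- condition.
  have chain_iff : ∀ a : ι → ℝ, ChainSupp a ↔ ∀ i j, ¬ (i ≤ j ∨ j ≤ i) → a i * a j = 0 := by
    intro a
    refine forall₂_congr fun i j => ?_
    rw [mul_eq_zero]; tauto
  have hSclosed : IsClosed S := by
    have e : S = (⋂ i, {c | 0 ≤ c.1 i}) ∩ (⋂ i, {c | 0 ≤ c.2 i}) ∩
        (⋂ i, ⋂ j, ⋂ (_ : ¬ (i ≤ j ∨ j ≤ i)), {c | c.1 i * c.1 j = 0}) ∩
        (⋂ i, ⋂ j, ⋂ (_ : ¬ (i ≤ j ∨ j ≤ i)), {c | c.2 i * c.2 j = 0}) ∩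
        (⋂ i, {c | c.1 i * c.2 i = 0}) ∩ {c | ∑ i, (c.1 i + c.2 i) = 1} := by
      ext c
      simp only [S, Set.mem_ofPred_eq, Set.mem_inter_iff, Set.mem_iInter, and_assoc]
    rw [e]
    refine ((((IsClosed.inter ?_ ?_).inter ?_).inter ?_).inter ?_).inter ?_
    · exact isClosed_iInter fun i => isClosed_le (by fun_prop) (by fun_prop)
    · exact isClosed_iInter fun i => isClosed_le (by fun_prop) (by fun_prop)
    · exact isClosed_iInter fun i => isClosed_iInter fun j => isClosed_iInter fun _ =>
        isClosed_eq (by fun_prop) (by fun_prop)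
    · exact isClosed_iInter fun i => isClosed_iInter fun j => isClosed_iInter fun _ =>
        isClosed_eq (by fun_prop) (by fun_prop)
    · exact isClosed_iInter fun i => isClosed_eq (by fun_prop) (by fun_prop)
    · exact isClosed_eq (by fun_prop) (by fun_prop)
  have hScompact : IsCompact S := by
    refine IsCompact.of_isClosed_subset (isCompact_Icc (a := ((0, 0) : (ι → ℝ) × (ι → ℝ)))
      (b := (1, 1))) hSclosed fun c hc => ?_
    obtain ⟨h1, h2, -, -, -, hs⟩ := hc
    have hbound : ∀ i, c.1 i + c.2 i ≤ 1 := fun i => hs ▸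
      Finset.single_le_sum (f := fun i => c.1 i + c.2 i) (fun i _ => add_nonneg (h1 i) (h2 i))
        (Finset.mem_univ i)
    refine ⟨⟨h1, h2⟩, ⟨fun i => ?_, fun i => ?_⟩⟩
    · have := hbound i; have := h2 i; simp only [Pi.one_apply]; linarith
    · have := hbound i; have := h1 i; simp only [Pi.one_apply]; linarith
  let f : (ι → ℝ) × (ι → ℝ) → ℝ := fun c => ‖∑ i, c.1 i • P i - ∑ i, c.2 i • P i‖
  have hf : Continuous f := by fun_prop
  obtain ⟨κ, hκ, hmin⟩ : ∃ κ : ℝ, 0 < κ ∧ ∀ c ∈ S, κ ≤ f c := by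
    rcases S.eq_empty_or_nonempty with he | hne
    · exact ⟨1, one_pos, by simp [he]⟩
    · obtain ⟨c, hc, hmin⟩ := hScompact.exists_isMinOn hne hf.continuousOn
      refine ⟨f c, ?_, fun d hd => hmin hd⟩
      refine lt_of_le_of_ne (norm_nonneg _) fun h0 => ?_
      obtain ⟨h1, h2, h3, h4, h5, h6⟩ := hc
      obtain ⟨z1, z2⟩ := chain_disjoint hle heq h1 h2 ((chain_iff _).2 h3) ((chain_iff _).2 h4) h5
        (sub_eq_zero.1 (norm_eq_zero.1 h0.symm))
      simp [z1, z2] at h6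
  refine ⟨κ, hκ, fun a b ha hb ca cb hab => ?_⟩
  set t := ∑ i, (a i + b i)
  have ht : 0 ≤ t := Finset.sum_nonneg fun i _ => add_nonneg (ha i) (hb i)
  rcases ht.eq_or_lt with h0 | hpos
  · rw [← h0, mul_zero]; exact norm_nonneg _
  · have hmem : ((fun i => t⁻¹ * a i, fun i => t⁻¹ * b i) : (ι → ℝ) × (ι → ℝ)) ∈ S := by
      refine ⟨fun i => mul_nonneg (inv_nonneg.2 ht) (ha i),
        fun i => mul_nonneg (inv_nonneg.2 ht) (hb i), fun i j hij => ?_, fun i j hij => ?_,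
        fun i => ?_, ?_⟩
      · have := (chain_iff a).1 ca i j hij
        linear_combination (t⁻¹ * t⁻¹) * this
      · have := (chain_iff b).1 cb i j hij
        linear_combination (t⁻¹ * t⁻¹) * this
      · have := hab i
        linear_combination (t⁻¹ * t⁻¹) * this
      · simp only [← mul_add, ← Finset.mul_sum]
        exact inv_mul_cancel₀ hpos.ne'
    have := hmin _ hmem
    simp only [f, mul_smul, ← Finset.smul_sum, ← smul_sub, norm_smul, norm_inv] at this
    rw [Real.norm_of_nonneg ht, le_inv_mul_iff₀ hpos] at this
    linarith

/-- The positive and negative parts of `a - b` are disjointly supported on chains, so the gap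
applies to them. Half of the gap is spent on moving `P i` to `z i`. -/
theorem exists_spread {P Q : ι → E n} (hle : ∀ i j, inner ℝ (P i) (Q j) ≤ 1)
    (heq : ∀ i j, inner ℝ (P i) (Q j) = (1 : ℝ) ↔ i ≤ j) :
    ∃ κ : ℝ, 0 < κ ∧ ∃ ε : ℝ, 0 < ε ∧ ∀ z : ι → E n, (∀ i, ‖z i - P i‖ ≤ ε) → Spread κ z := by
  obtain ⟨κ, hκ, H⟩ := exists_chain_gap hle heq
  refine ⟨κ / 2, by positivity, κ / 2, by positivity, fun z hz a b ha hb ca cb => ?_⟩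
  let c : ι → ℝ := fun i => max (a i - b i) 0
  let d : ι → ℝ := fun i => max (b i - a i) 0
  have hcd : ∀ i, c i - d i = a i - b i := fun i => by
    simp only [c, d]
    rcases le_total (a i) (b i) with h | h
    · rw [max_eq_right (by linarith), max_eq_left (by linarith)]; ring
    · rw [max_eq_left (by linarith), max_eq_right (by linarith)]; ring
  have hcd' : ∀ i, c i + d i = |a i - b i| := fun i => by
    simp only [c, d]
    rcases le_total (a i) (b i) with h | h
    · rw [max_eq_right (by linarith), max_eq_left (by linarith), abs_of_nonpos (by linarith)]; ring
    · rw [max_eq_left (by linarith), max_eq_right (by linarith), abs_of_nonneg (by linarith)]; ring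
  have h1 := H c d (fun i => le_max_right _ _) (fun i => le_max_right _ _)
    (ca.mono fun i hi h0 => hi (by simp [c, h0, hb i]))
    (cb.mono fun i hi h0 => hi (by simp [d, h0, ha i])) (fun i => by
      simp only [c, d]
      rcases le_total (a i) (b i) with h | h
      · rw [max_eq_right (by linarith), zero_mul]
      · rw [max_eq_right (a := b i - a i) (by linarith), mul_zero])
  rw [← Finset.sum_sub_distrib] at h1
  simp only [← sub_smul, hcd, hcd'] at h1
  have h2 : ‖∑ i, (a i - b i) • P i‖ ≤ ‖∑ i, (a i - b i) • z i‖ + κ / 2 * ∑ i, |a i - b i| := by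
    have e : ∑ i, (a i - b i) • P i = ∑ i, (a i - b i) • z i - ∑ i, (a i - b i) • (z i - P i) := by
      rw [← Finset.sum_sub_distrib]
      exact Finset.sum_congr rfl fun i _ => by module
    rw [e]
    refine (norm_sub_le _ _).trans (add_le_add le_rfl ((norm_sum_le _ _).trans ?_))
    rw [Finset.mul_sum]
    refine Finset.sum_le_sum fun i _ => ?_
    rw [norm_smul, Real.norm_eq_abs, mul_comm]
    exact mul_le_mul_of_nonneg_right (hz i) (abs_nonneg _)
  linarith

end Spread

end HannerMahler

end

/-! ### Volume gained by star subdivision of one simplex. -/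

noncomputable section

namespace HannerMahler

/-! ### Simplices with a vertex at the origin -/

section Simplex

variable {n : ℕ}

/-- The simplex spanned by the origin and the points `w k`. -/
def simplex (w : Fin n → E n) : Set (E n) := convexHull ℝ (insert 0 (Set.range w))

theorem simplex_subset {w : Fin n → E n} {K : Set (E n)} (hK : Convex ℝ K) (h0 : 0 ∈ K)
    (hw : ∀ k, w k ∈ K) : simplex w ⊆ K :=
  convexHull_min (Set.insert_subset h0 (Set.range_subset_iff.2 hw)) hK

/-- The open cone spanned by a basis. -/
def openCone (b : Module.Basis (Fin n) ℝ (E n)) : Set (E n) := {x | ∀ k, 0 < b.repr x k}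

theorem continuous_repr (b : Module.Basis (Fin n) ℝ (E n)) (k : Fin n) :
    Continuous fun x => b.repr x k :=
  (b.coord k).continuous_of_finiteDimensional

theorem isOpen_openCone (b : Module.Basis (Fin n) ℝ (E n)) : IsOpen (openCone b) := by
  have : openCone b = ⋂ k, {x | 0 < b.repr x k} := by
    ext x; simp [openCone]
  rw [this]
  exact isOpen_iInter_of_finite fun k => isOpen_lt continuous_const (continuous_repr b k)

theorem repr_nonneg_of_mem_simplex (b : Module.Basis (Fin n) ℝ (E n)) {x : E n}
    (hx : x ∈ simplex b) (k : Fin n) : 0 ≤ b.repr x k := by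
  have hc : Convex ℝ {x : E n | 0 ≤ b.coord k x} := convex_halfSpace_ge (b.coord k).isLinear 0
  refine convexHull_min ?_ hc hx
  rintro y (rfl | ⟨j, rfl⟩)
  · simp
  · simp only [Set.mem_ofPred_eq, Module.Basis.coord_apply, Module.Basis.repr_self,
      Finsupp.single_apply]
    split_ifs <;> norm_num

theorem mem_simplex_of_repr (b : Module.Basis (Fin n) ℝ (E n)) {x : E n}
    (h0 : ∀ k, 0 ≤ b.repr x k) (h1 : ∑ k, b.repr x k ≤ 1) : x ∈ simplex b := by
  have hc : Convex ℝ (simplex b) := convex_convexHull ℝ _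
  have m0 : (0 : E n) ∈ simplex b := subset_convexHull ℝ _ (Set.mem_insert _ _)
  have mk : ∀ k, b k ∈ simplex b := fun k =>
    subset_convexHull ℝ _ (Set.mem_insert_of_mem _ ⟨k, rfl⟩)
  have := hc.sum_mem (t := Finset.univ) (w := fun o : Option (Fin n) =>
      o.elim (1 - ∑ k, b.repr x k) fun k => b.repr x k) (z := fun o => o.elim 0 b)
    (by rintro (_ | k) _
        · simpa using h1
        · exact h0 k)
    (by simp [Fintype.sum_option])
    (by rintro (_ | k) _
        · exact m0
        · exact mk k)
  rw [Fintype.sum_option] at this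
  simp only [Option.elim, smul_zero, zero_add, b.sum_repr] at this
  exact this

/-- Only the parts of the simplex in the n coordinate hyperplanes of the basis are lost, and these
are null sets. Open cones are preferred because those of different flags are truly disjoint. -/
theorem volume_simplex_le (b : Module.Basis (Fin n) ℝ (E n)) :
    volume (simplex b) ≤ volume (simplex b ∩ openCone b) := by
  have hsub : simplex b ⊆ (simplex b ∩ openCone b) ∪ ⋃ k, (LinearMap.ker (b.coord k) : Set (E n)) := by
    intro x hx
    by_cases h : x ∈ openCone b
    · exact Or.inl ⟨hx, h⟩
    · right
      simp only [openCone, Set.mem_ofPred_eq, not_forall, not_lt] at h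
      obtain ⟨k, hk⟩ := h
      refine Set.mem_iUnion.2 ⟨k, ?_⟩
      simp only [SetLike.mem_coe, LinearMap.mem_ker, Module.Basis.coord_apply]
      exact le_antisymm hk (repr_nonneg_of_mem_simplex b hx k)
  refine (measure_mono hsub).trans ((measure_union_le _ _).trans ?_)
  have : volume (⋃ k, (LinearMap.ker (b.coord k) : Set (E n))) = 0 := by
    refine measure_iUnion_null fun k => Measure.addHaar_submodule _ _ fun htop => ?_
    have : b k ∈ LinearMap.ker (b.coord k) := htop ▸ Submodule.mem_top
    simp at this
  rw [this, add_zero]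

/-- Star subdivision of a simplex at a point of the open cone. -/
theorem sum_repr_mul_volume_le (b : Module.Basis (Fin n) ℝ (E n)) {K : Set (E n)}
    (hK : Convex ℝ K) (hKm : MeasurableSet K) (h0 : 0 ∈ K) (hb : ∀ k, b k ∈ K) {q : E n}
    (hq : q ∈ K) (hqpos : ∀ k, 0 < b.repr q k) :
    ENNReal.ofReal (∑ k, b.repr q k) * volume (simplex b) ≤ volume (K ∩ openCone b) := by
  -- `D j` is the region where the ratio of the coordinate of `y` to that of `q` is strictly
  -- smallest at index `j`; these regions separate the pieces of the subdivision.
  let D : Fin n → Set (E n) := fun j =>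
    {y | ∀ k, k ≠ j → b.repr y j * b.repr q k < b.repr y k * b.repr q j}
  -- `A j` replaces the vertex `b j` by `q` and fixes the others. Its determinant is the j-th
  -- coordinate of `q`, so the volumes of the pieces add up to the sum of the coordinates times the
  -- original volume.
  let A : Fin n → (E n →ₗ[ℝ] E n) := fun j => LinearMap.transvection (b.coord j) (q - b j)
  have hAapply : ∀ j x, A j x = x + b.repr x j • (q - b j) := fun j x => by
    simp [A, LinearMap.transvection]
  have hdet : ∀ j, LinearMap.det (A j) = b.repr q j := fun j => by
    simp [A, LinearMap.transvection.det]
  have hD : ∀ j, IsOpen (D j) := fun j => by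
    have : D j = ⋂ k, ⋂ (_ : k ≠ j), {y | b.repr y j * b.repr q k < b.repr y k * b.repr q j} := by
      ext x; simp [D]
    rw [this]
    refine isOpen_iInter_of_finite fun k => isOpen_iInter_of_finite fun _ =>
      isOpen_lt ?_ ?_
    · exact (continuous_repr b j).mul continuous_const
    · exact (continuous_repr b k).mul continuous_const
  have hdisj : Pairwise (Function.onFun Disjoint fun j => K ∩ openCone b ∩ D j) := by
    intro i j hij
    refine Set.disjoint_left.2 fun x hx hx' => ?_
    have h1 := hx.2 j hij.symm
    have h2 := hx'.2 i hij
    linarith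
  have hpiece : ∀ j, ENNReal.ofReal (b.repr q j) * volume (simplex b) ≤
      volume (K ∩ openCone b ∩ D j) := by
    intro j
    have hsub : A j '' (simplex b ∩ openCone b) ⊆ K ∩ openCone b ∩ D j := by
      rintro _ ⟨x, ⟨hx, hxc⟩, rfl⟩
      have hrepr : ∀ k, b.repr (A j x) k =
          b.repr x k + b.repr x j * (b.repr q k - if j = k then 1 else 0) := fun k => by
        rw [hAapply]
        simp [Finsupp.single_apply]
      have hj : b.repr (A j x) j = b.repr x j * b.repr q j := by
        rw [hrepr, if_pos rfl]; ring
      have hk : ∀ k, k ≠ j → b.repr (A j x) k = b.repr x k + b.repr x j * b.repr q k :=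
        fun k hk => by rw [hrepr, if_neg hk.symm]; ring
      refine ⟨⟨?_, ?_⟩, ?_⟩
      · have h1 : A j x ∈ A j '' simplex b := ⟨x, hx, rfl⟩
        rw [simplex, LinearMap.image_convexHull] at h1
        refine convexHull_min ?_ hK h1
        rintro _ ⟨y, (rfl | ⟨k, rfl⟩), rfl⟩
        · simpa using h0
        · rw [hAapply]
          by_cases hkj : k = j
          · subst hkj
            simpa using hq
          · simpa [Finsupp.single_apply, hkj] using hb k
      · intro k
        by_cases hkj : k = j
        · subst hkj
          rw [hj]; exact mul_pos (hxc k) (hqpos k)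
        · rw [hk k hkj]
          exact add_pos (hxc k) (mul_pos (hxc j) (hqpos k))
      · intro k hkj
        rw [hj, hk k hkj]
        have := mul_pos (hxc k) (hqpos j)
        nlinarith
    calc ENNReal.ofReal (b.repr q j) * volume (simplex b)
        ≤ ENNReal.ofReal (b.repr q j) * volume (simplex b ∩ openCone b) := by
          exact mul_le_mul_right (volume_simplex_le b) _
      _ = volume (A j '' (simplex b ∩ openCone b)) := by
          rw [Measure.addHaar_image_linearMap, hdet, abs_of_pos (hqpos j)]
      _ ≤ _ := measure_mono hsub
  rw [ENNReal.ofReal_sum_of_nonneg fun k _ => (hqpos k).le, Finset.sum_mul]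
  calc _ ≤ ∑ j, volume (K ∩ openCone b ∩ D j) := Finset.sum_le_sum fun j _ => hpiece j
    _ = volume (⋃ j, K ∩ openCone b ∩ D j) := by
        rw [measure_iUnion hdisj fun j =>
          (hKm.inter (isOpen_openCone b).measurableSet).inter (hD j).measurableSet, tsum_fintype]
    _ ≤ _ := measure_mono (Set.iUnion_subset fun j => Set.inter_subset_left)

end Simplex

end HannerMahler

end

/-! ### Simplices over flags: nonoverlap, lower volume bound, facet normals and gain. -/

noncomputable section

namespace HannerMahler

section Flags

variable {n : ℕ} {ι : Type*} [PartialOrder ι] {κ : ℝ} {z : ι → E n}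

/-- The open cone of positive combinations. -/
def posSpan (w : Fin n → E n) : Set (E n) :=
  {x | ∃ a : Fin n → ℝ, (∀ k, 0 < a k) ∧ x = ∑ k, a k • w k}

theorem openCone_eq_posSpan (b : Module.Basis (Fin n) ℝ (E n)) : openCone b = posSpan b := by
  ext x
  constructor
  · intro h
    exact ⟨fun k => b.repr x k, h, (b.sum_repr x).symm⟩
  · rintro ⟨a, ha, rfl⟩ k
    rw [b.repr_sum_self]
    exact ha k

theorem chainSupp_extend {f : Fin n → ι} (hf : StrictMono f) (a : Fin n → ℝ) :
    ChainSupp (Function.extend f a 0) := by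
  have hmem : ∀ i, Function.extend f a 0 i ≠ 0 → ∃ k, f k = i := fun i hi => by
    by_contra h
    exact hi (by rw [Function.extend_apply' _ _ _ h]; rfl)
  intro i j hi hj
  obtain ⟨k, rfl⟩ := hmem i hi
  obtain ⟨l, rfl⟩ := hmem j hj
  exact (le_total k l).imp (fun h => hf.monotone h) fun h => hf.monotone h

theorem extend_nonneg {f : Fin n → ι} (hf : StrictMono f) {a : Fin n → ℝ} (ha : ∀ k, 0 ≤ a k)
    (i : ι) : 0 ≤ Function.extend f a 0 i := by
  by_cases h : ∃ k, f k = i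
  · obtain ⟨k, rfl⟩ := h
    rw [hf.injective.extend_apply]; exact ha k
  · rw [Function.extend_apply' _ _ _ h]; exact le_rfl

variable [Fintype ι]

theorem sum_extend {f : Fin n → ι} (hf : StrictMono f) (a : Fin n → ℝ) :
    ∑ i, Function.extend f a 0 i • z i = ∑ k, a k • z (f k) := by
  refine (Fintype.sum_of_injective f hf.injective _ _ (fun i hi => ?_) fun k => ?_).symm
  · rw [Function.extend_apply' _ _ _ (by simpa using hi)]; simp
  · rw [hf.injective.extend_apply]

/-- Quantitative linear independence along one chain: `Spread` is applied to the positive and the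
negative part of `a`, both supported on that chain. -/
theorem Spread.sum_abs_le (hS : Spread κ z) {f : Fin n → ι} (hf : StrictMono f) (a : Fin n → ℝ) :
    κ * ∑ k, |a k| ≤ ‖∑ k, a k • z (f k)‖ := by
  have h := hS (Function.extend f (fun k => max (a k) 0) 0)
    (Function.extend f (fun k => max (-a k) 0) 0) (extend_nonneg hf fun k => le_max_right _ _)
    (extend_nonneg hf fun k => le_max_right _ _) (chainSupp_extend hf _) (chainSupp_extend hf _)
  have e : ∀ x : ℝ, max x 0 - max (-x) 0 = x := fun x => by
    rcases le_total x 0 with hx | hx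
    · rw [max_eq_right hx, max_eq_left (by linarith)]; ring
    · rw [max_eq_left hx, max_eq_right (by linarith)]; ring
  simp only [sub_smul, Finset.sum_sub_distrib] at h
  rw [sum_extend hf, sum_extend hf, ← Finset.sum_sub_distrib] at h
  simp only [← sub_smul, e] at h
  rwa [← Fintype.sum_of_injective f hf.injective (fun k => |a k|) _ (fun i hi => ?_)
    fun k => ?_] at h
  · rw [Function.extend_apply' _ _ _ (by simpa using hi),
      Function.extend_apply' _ _ _ (by simpa using hi)]; simp
  · rw [hf.injective.extend_apply, hf.injective.extend_apply, e]

theorem Spread.exists_basis (hS : Spread κ z) (hκ : 0 < κ) {f : Fin n → ι} (hf : StrictMono f) :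
    ∃ b : Module.Basis (Fin n) ℝ (E n), ⇑b = z ∘ f := by
  have hli : LinearIndependent ℝ (z ∘ f) := by
    rw [Fintype.linearIndependent_iff]
    intro a ha k
    have h := hS.sum_abs_le hf a
    simp only [Function.comp_apply] at ha
    rw [ha, norm_zero] at h
    have h2 : ∑ k, |a k| ≤ 0 := nonpos_of_mul_nonpos_right h hκ
    have h3 := Finset.single_le_sum (f := fun k => |a k|) (fun k _ => abs_nonneg _)
      (Finset.mem_univ k)
    exact abs_nonpos_iff.1 (h3.trans h2)
  rcases Nat.eq_zero_or_pos n with rfl | hn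
  · exact ⟨Module.Basis.empty _, funext fun k => k.elim0⟩
  · have : Nonempty (Fin n) := ⟨⟨0, hn⟩⟩
    exact ⟨basisOfLinearIndependentOfCardEqFinrank hli (by simp),
      coe_basisOfLinearIndependentOfCardEqFinrank _ _⟩

/-- A common point would have two chain representations with distance 0, hence equal weights and
equal supports; a strictly monotone map is determined by its range. -/
theorem Spread.disjoint_posSpan (hS : Spread κ z) (hκ : 0 < κ) {f g : Fin n → ι}
    (hf : StrictMono f) (hg : StrictMono g) (hfg : f ≠ g) :
    Disjoint (posSpan (z ∘ f)) (posSpan (z ∘ g)) := by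
  rw [Set.disjoint_left]
  rintro x ⟨a, ha, hxa⟩ ⟨b, hb, hxb⟩
  have h := hS (Function.extend f a 0) (Function.extend g b 0) (extend_nonneg hf fun k => (ha k).le)
    (extend_nonneg hg fun k => (hb k).le) (chainSupp_extend hf _) (chainSupp_extend hg _)
  simp only [sub_smul, Finset.sum_sub_distrib] at h
  rw [sum_extend hf, sum_extend hg] at h
  simp only [Function.comp_apply] at hxa hxb
  rw [← hxa, ← hxb, sub_self, norm_zero] at h
  have h2 := nonpos_of_mul_nonpos_right h hκ
  have h3 : ∀ i, Function.extend f a 0 i = Function.extend g b 0 i := fun i => by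
    have h3 := Finset.single_le_sum (f := fun i => |Function.extend f a 0 i -
      Function.extend g b 0 i|) (fun k _ => abs_nonneg _) (Finset.mem_univ i)
    exact sub_eq_zero.1 (abs_nonpos_iff.1 (h3.trans h2))
  refine hfg (hf.range_inj hg |>.1 ?_)
  ext i
  have key : ∀ {f : Fin n → ι} {a : Fin n → ℝ}, StrictMono f → (∀ k, 0 < a k) →
      (i ∈ Set.range f ↔ Function.extend f a 0 i ≠ 0) := by
    intro f a hf ha
    constructor
    · rintro ⟨k, rfl⟩
      rw [hf.injective.extend_apply]; exact (ha k).ne'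
    · intro hi
      by_contra hn
      exact hi (by rw [Function.extend_apply' _ _ _ (by simpa using hn)]; rfl)
  rw [key hf ha, key hg hb, h3]

/-- Around the point with all coordinates 1/(2n), a displacement of norm below κ/(2n) changes the
coordinates by at most 1/(2n) in total. They stay nonnegative with sum at most 1/2 + 1/(2n) ≤ 1. -/
theorem Spread.le_volume_simplex (hS : Spread κ z) (hκ : 0 < κ) {f : Fin n → ι}
    (hf : StrictMono f) (hn : 0 < n) :
    volume (Metric.ball (0 : E n) (κ / (2 * n))) ≤ volume (simplex (z ∘ f)) := by
  obtain ⟨b, hb⟩ := hS.exists_basis hκ hf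
  have hn' : (0 : ℝ) < n := Nat.cast_pos.2 hn
  let c : E n := ∑ k, (1 / (2 * n) : ℝ) • b k
  have hc : ∀ k, b.repr c k = 1 / (2 * n) := fun k => by
    simp only [c]; rw [b.repr_sum_self]
  have hsub : Metric.ball c (κ / (2 * n)) ⊆ simplex b := by
    intro x hx
    rw [mem_ball_iff_norm] at hx
    have h1 := hS.sum_abs_le hf fun k => b.repr (x - c) k
    have hbk : ∀ k, z (f k) = b k := fun k => by rw [hb]; rfl
    simp only [hbk, b.sum_repr] at h1
    have h3 : ∑ k, |b.repr (x - c) k| ≤ 1 / (2 * n) := by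
      refine le_of_mul_le_mul_left (h1.trans (hx.le.trans_eq ?_)) hκ
      ring
    have h4 : ∀ k, b.repr x k = 1 / (2 * n) + b.repr (x - c) k := fun k => by
      simp [hc]
    refine mem_simplex_of_repr b (fun k => ?_) ?_
    · have h5 := Finset.single_le_sum (f := fun k => |b.repr (x - c) k|)
        (fun k _ => abs_nonneg _) (Finset.mem_univ k)
      have := neg_abs_le (b.repr (x - c) k)
      rw [h4]; linarith
    · have h5 : ∑ k, b.repr (x - c) k ≤ ∑ k, |b.repr (x - c) k| :=
        Finset.sum_le_sum fun k _ => le_abs_self _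
      simp only [h4, Finset.sum_add_distrib, Finset.sum_const, Finset.card_univ, Fintype.card_fin,
        nsmul_eq_mul]
      have h6 : (n : ℝ) * (1 / (2 * n)) = 1 / 2 := by field_simp
      have h7 : 1 / (2 * n : ℝ) ≤ 1 / 2 := by
        have : (1 : ℝ) ≤ n := Nat.one_le_cast.2 hn
        gcongr; linarith
      rw [h6]; linarith
  rw [← hb, ← Measure.addHaar_ball_center volume c]
  exact measure_mono hsub

theorem Spread.exists_normal (hS : Spread κ z) (hκ : 0 < κ) {f : Fin n → ι} (hf : StrictMono f) :
    ∃ ν : E n, ∀ k, inner ℝ ν (z (f k)) = (1 : ℝ) := by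
  obtain ⟨b, hb⟩ := hS.exists_basis hκ hf
  let φ : E n →ₗ[ℝ] ℝ := ∑ k, b.coord k
  refine ⟨(InnerProductSpace.toDual ℝ (E n)).symm φ.toContinuousLinearMap, fun k => ?_⟩
  rw [InnerProductSpace.toDual_symm_apply]
  have : z (f k) = b k := by rw [hb]; rfl
  rw [this]
  simp [φ, Finsupp.single_apply]

/-- Expanding one factor of ‖ν − w‖² in the basis of the flag bounds it by ε times the ℓ₁-norm of
the coordinates, which is at most ‖ν − w‖/κ. Used with w the exact facet normal of H. -/
theorem Spread.norm_sub_le (hS : Spread κ z) (hκ : 0 < κ) {f : Fin n → ι} (hf : StrictMono f)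
    {ν w : E n} (hν : ∀ k, inner ℝ ν (z (f k)) = (1 : ℝ)) {ε : ℝ} (hε : 0 ≤ ε)
    (hw : ∀ k, |1 - inner ℝ w (z (f k))| ≤ ε) : ‖ν - w‖ ≤ ε / κ := by
  obtain ⟨b, hb⟩ := hS.exists_basis hκ hf
  have hbk : ∀ k, z (f k) = b k := fun k => by rw [hb]; rfl
  have h2 := hS.sum_abs_le hf fun k => b.repr (ν - w) k
  simp only [hbk, b.sum_repr] at h2
  have h3 : ‖ν - w‖ * ‖ν - w‖ ≤ ε * ∑ k, |b.repr (ν - w) k| := by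
    have h1 : inner ℝ (ν - w) (ν - w) = inner ℝ (ν - w) (∑ k, b.repr (ν - w) k • b k) := by
      rw [b.sum_repr]
    rw [← real_inner_self_eq_norm_mul_norm, h1, inner_sum, Finset.mul_sum]
    refine Finset.sum_le_sum fun k _ => ?_
    rw [inner_smul_right, inner_sub_left, ← hbk, hν]
    refine (le_abs_self _).trans ?_
    rw [abs_mul, mul_comm]
    exact mul_le_mul_of_nonneg_right (hw k) (abs_nonneg _)
  rcases (norm_nonneg (ν - w)).eq_or_lt with h0 | hpos
  · rw [← h0]
    exact div_nonneg hε hκ.le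
  · rw [le_div_iff₀ hκ]
    refine le_of_mul_le_mul_right ?_ hpos
    calc ‖ν - w‖ * κ * ‖ν - w‖ = κ * (‖ν - w‖ * ‖ν - w‖) := by ring
      _ ≤ κ * (ε * ∑ k, |b.repr (ν - w) k|) := mul_le_mul_of_nonneg_left h3 hκ.le
      _ = ε * (κ * ∑ k, |b.repr (ν - w) k|) := by ring
      _ ≤ ε * ‖ν - w‖ := mul_le_mul_of_nonneg_left h2 hε

/-- The simplices of all flags have disjoint interiors, and a point of `K` beyond the facet of one
of the simplices yields additional volume. -/
theorem Spread.sum_volume_add_le (hS : Spread κ z) (hκ : 0 < κ) (hn : 0 < n) {K : Set (E n)}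
    (hK : Convex ℝ K) (hKm : MeasurableSet K) (h0 : 0 ∈ K) (hz : ∀ i, z i ∈ K) {R : ℝ}
    (hR : ∀ x ∈ K, ‖x‖ ≤ R) {f₀ : Fin n → ι} (hf₀ : StrictMono f₀) {ν : E n}
    (hν : ∀ k, inner ℝ ν (z (f₀ k)) = (1 : ℝ)) {y : E n} (hy : y ∈ K) {ρ : ℝ}
    (hyρ : 1 + ρ ≤ inner ℝ ν y) (S : Finset (Fin n → ι)) (hSm : ∀ f ∈ S, StrictMono f) :
    ∑ f ∈ S, volume (simplex (z ∘ f)) +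
        ENNReal.ofReal (ρ / (2 * (1 + n * (R / κ)))) * volume (simplex (z ∘ f₀)) ≤ volume K := by
  classical
  have hn' : (0 : ℝ) < n := Nat.cast_pos.2 hn
  have hRpos : 0 ≤ R := (norm_nonneg _).trans (hR 0 h0)
  have hbasis := fun f (hf : StrictMono f) => hS.exists_basis hκ hf
  have hle : ∀ f, StrictMono f → volume (simplex (z ∘ f)) ≤ volume (K ∩ posSpan (z ∘ f)) := by
    intro f hf
    obtain ⟨b, hb⟩ := hbasis f hf
    rw [← hb, ← openCone_eq_posSpan]
    refine (volume_simplex_le b).trans (measure_mono (Set.inter_subset_inter_left _ ?_))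
    exact simplex_subset hK h0 fun k => by rw [hb]; exact hz _
  have hle₀ : volume (simplex (z ∘ f₀)) + ENNReal.ofReal (ρ / (2 * (1 + n * (R / κ)))) *
      volume (simplex (z ∘ f₀)) ≤ volume (K ∩ posSpan (z ∘ f₀)) := by
    rcases le_or_gt ρ 0 with hρ | hρ
    · rw [ENNReal.ofReal_of_nonpos (div_nonpos_of_nonpos_of_nonneg hρ (by positivity)), zero_mul,
        add_zero]
      exact hle f₀ hf₀
    obtain ⟨b, hb⟩ := hbasis f₀ hf₀
    have hbk : ∀ k, b k = z (f₀ k) := fun k => by rw [hb]; rfl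
    -- The point y may lie outside the cone of the flag, with coordinates as low as −R/κ. This
    -- weight is small enough for the mixture `q` of the facet's barycentre and y to have positive
    -- coordinates, and it keeps the proportion τ of the excess ρ.
    set τ : ℝ := 1 / (2 * (1 + n * (R / κ))) with hτ
    have hτpos : 0 < τ := by positivity
    have hτ1 : τ ≤ 1 / 2 := by
      rw [hτ]
      refine one_div_le_one_div_of_le two_pos ?_
      have : 0 ≤ n * (R / κ) := by positivity
      linarith
    let q : E n := (1 - τ) • (∑ k, (1 / n : ℝ) • b k) + τ • y
    have hqrepr : ∀ k, b.repr q k = (1 - τ) / n + τ * b.repr y k := fun k => by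
      simp only [q, map_add, map_smul, Finsupp.add_apply, Finsupp.smul_apply, smul_eq_mul]
      rw [b.repr_sum_self]; ring
    have hyk : ∀ k, |b.repr y k| ≤ R / κ := fun k => by
      have h1 := hS.sum_abs_le hf₀ fun k => b.repr y k
      simp only [← hbk, b.sum_repr] at h1
      have h2 := Finset.single_le_sum (f := fun k => |b.repr y k|) (fun k _ => abs_nonneg _)
        (Finset.mem_univ k)
      rw [le_div_iff₀ hκ, mul_comm]
      exact ((mul_le_mul_of_nonneg_left h2 hκ.le).trans h1).trans (hR y hy)
    have hqpos : ∀ k, 0 < b.repr q k := fun k => by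
      rw [hqrepr]
      have h1 : -(τ * (R / κ)) ≤ τ * b.repr y k := by
        rw [← mul_neg]
        exact mul_le_mul_of_nonneg_left (neg_le_of_abs_le (hyk k)) hτpos.le
      have h2 : τ * (R / κ) < (1 - τ) / n := by
        rw [lt_div_iff₀ hn']
        have : τ * (2 * (1 + n * (R / κ))) = 1 := by rw [hτ]; field_simp
        nlinarith
      linarith
    have hsum : 1 + τ * ρ ≤ ∑ k, b.repr q k := by
      have hysum : ∑ k, b.repr y k = inner ℝ ν y := by
        conv_rhs => rw [← b.sum_repr y, inner_sum]
        refine Finset.sum_congr rfl fun k _ => ?_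
        rw [inner_smul_right, hbk, hν, mul_one]
      simp only [hqrepr, Finset.sum_add_distrib, ← Finset.mul_sum, hysum, Finset.sum_const,
        Finset.card_univ, Fintype.card_fin, nsmul_eq_mul]
      rw [mul_div_cancel₀ _ hn'.ne']
      nlinarith
    have hqK : q ∈ K := by
      refine hK ?_ hy (by linarith) hτpos.le (by ring)
      refine hK.sum_mem (fun _ _ => by positivity) ?_ fun k _ => by rw [hbk]; exact hz _
      simp [hn'.ne']
    have := sum_repr_mul_volume_le b hK hKm h0 (fun k => by rw [hbk]; exact hz _) hqK hqpos
    rw [openCone_eq_posSpan, hb] at this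
    refine le_trans ?_ this
    have e : ρ / (2 * (1 + n * (R / κ))) = τ * ρ := by rw [hτ]; ring
    rw [e, ← one_add_mul, ← ENNReal.ofReal_one, ← ENNReal.ofReal_add zero_le_one (by positivity)]
    exact mul_le_mul_left (ENNReal.ofReal_le_ofReal hsum) _
  have hmeas : ∀ f, StrictMono f → MeasurableSet (K ∩ posSpan (z ∘ f)) := by
    intro f hf
    obtain ⟨b, hb⟩ := hbasis f hf
    rw [← hb, ← openCone_eq_posSpan]
    exact hKm.inter (isOpen_openCone b).measurableSet
  have hins : ∀ f ∈ insert f₀ S, StrictMono f := fun f hf => by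
    rcases Finset.mem_insert.1 hf with rfl | h
    · exact hf₀
    · exact hSm f h
  calc _ ≤ ∑ f ∈ insert f₀ S, volume (simplex (z ∘ f)) +
        ENNReal.ofReal (ρ / (2 * (1 + n * (R / κ)))) * volume (simplex (z ∘ f₀)) :=
        add_le_add (Finset.sum_le_sum_of_subset (Finset.subset_insert _ _)) le_rfl
    _ ≤ ∑ f ∈ insert f₀ S, volume (K ∩ posSpan (z ∘ f)) := by
        rw [← Finset.add_sum_erase _ _ (Finset.mem_insert_self f₀ S),
          ← Finset.add_sum_erase _ (fun f => volume (K ∩ posSpan (z ∘ f)))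
            (Finset.mem_insert_self f₀ S), add_right_comm]
        exact add_le_add hle₀ (Finset.sum_le_sum fun f hf =>
          hle f (hins f (Finset.mem_of_mem_erase hf)))
    _ = volume (⋃ f ∈ insert f₀ S, K ∩ posSpan (z ∘ f)) := by
        rw [measure_biUnion_finset]
        · intro f hf g hg hfg
          exact (hS.disjoint_posSpan hκ (hins f hf) (hins g hg) hfg).mono Set.inter_subset_right
            Set.inter_subset_right
        · exact fun f hf => hmeas f (hins f hf)
    _ ≤ volume K := measure_mono (Set.iUnion₂_subset fun f _ => Set.inter_subset_left)

end Flags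

end HannerMahler

end

/-! ### Bodies near H and the position of their tangency points. -/

noncomputable section

namespace HannerMahler

variable {n : ℕ}

theorem abs_apply_le_norm (x : E n) (i : Fin n) : |x i| ≤ ‖x‖ := by
  simpa using PiLp.norm_apply_le x i

theorem sum_abs_le_norm (x : E n) : ∑ i, |x i| ≤ n * ‖x‖ := by
  calc ∑ i, |x i| ≤ ∑ _i : Fin n, ‖x‖ := Finset.sum_le_sum fun i _ => abs_apply_le_norm x i
    _ = n * ‖x‖ := by simp

theorem norm_le_sum_abs (x : E n) : ‖x‖ ≤ ∑ i, |x i| := by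
  have h : x = ∑ i, x i • stdVec i := by
    have := HannerRep.mem_span_single (S := Finset.univ) (x := x) (by simp)
    exact this
  conv_lhs => rw [h]
  refine (norm_sum_le _ _).trans (Finset.sum_le_sum fun i _ => ?_)
  simp [norm_smul, stdVec]

theorem norm_le_of_mem_cube {x : E n} (hx : x ∈ cube n) : ‖x‖ ≤ n :=
  (norm_le_sum_abs x).trans ((Finset.sum_le_sum fun i _ => hx i).trans_eq (by simp))

theorem crossPolytope_mem_nhds : crossPolytope n ∈ nhds (0 : E n) := by
  have ho : IsOpen {x : E n | ∑ i, |x i| < 1} := isOpen_lt (by fun_prop) continuous_const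
  exact Filter.mem_of_superset (ho.mem_nhds (by simp)) fun x hx => le_of_lt (show ∑ i, |x i| < 1 from hx)

theorem single_mem_crossPolytope (i : Fin n) {a : ℝ} (ha : |a| ≤ 1) :
    (EuclideanSpace.single i a : E n) ∈ crossPolytope n := by
  simp only [crossPolytope, Set.mem_ofPred_eq, PiLp.single_apply]
  rw [Finset.sum_eq_single i]
  · simpa using ha
  · intro j _ hj; simp [hj]
  · simp

namespace HannerRep

/-- `K` is a convex body close to `H`, between the cross-polytope and the cube. -/
structure Near (H : HannerRep n) (ε : ℝ) (K : Set (E n)) : Prop where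
  convex : Convex ℝ K
  isCompact : IsCompact K
  cross_subset : crossPolytope n ⊆ K
  subset_cube : K ⊆ cube n
  nrm_le : ∀ x ∈ K, H.nrm x ≤ 1 + ε
  mem : ∀ x, H.nrm x ≤ 1 → (1 + ε)⁻¹ • x ∈ K

theorem Near.mem_nhds {H : HannerRep n} {ε : ℝ} {K : Set (E n)} (h : H.Near ε K) :
    K ∈ nhds (0 : E n) := Filter.mem_of_superset crossPolytope_mem_nhds h.cross_subset

theorem Near.zero_mem {H : HannerRep n} {ε : ℝ} {K : Set (E n)} (h : H.Near ε K) :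
    (0 : E n) ∈ K := mem_of_mem_nhds h.mem_nhds

/-- Closeness is expressed by dilation factors because this form is self-dual: polarity exchanges
the two inclusions with the same ε, and likewise the cross-polytope and the cube. -/
theorem Near.polar {H : HannerRep n} (hH : H.IsStandard) {ε : ℝ} (hε : 0 ≤ ε) {K : Set (E n)}
    (h : H.Near ε K) : H.dual.Near ε (polarBody K) := by
  have hpos : 0 < 1 + ε := by positivity
  have hcube : polarBody K ⊆ cube n := by
    intro y hy i
    have h1 := hy _ (h.cross_subset (single_mem_crossPolytope i (a := 1) (by simp)))
    have h2 := hy _ (h.cross_subset (single_mem_crossPolytope i (a := -1) (by simp)))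
    simp only [EuclideanSpace.inner_single_left, conj_trivial] at h1 h2
    rw [abs_le]; constructor <;> linarith
  have hpolar : polarBody K = ⋂ x ∈ K, {y : E n | inner ℝ x y ≤ (1 : ℝ)} := by
    ext; simp [polarBody]
  refine ⟨?_, ?_, ?_, hcube, ?_, ?_⟩
  · intro y hy z hz a b ha hb hab x hx
    rw [inner_add_right, inner_smul_right, inner_smul_right]
    have := hy x hx
    have := hz x hx
    nlinarith
  · have hclosed : IsClosed (polarBody K) := by
      rw [hpolar]
      exact isClosed_biInter fun x _ => isClosed_le (by fun_prop) continuous_const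
    refine Metric.isCompact_of_isClosed_isBounded hclosed (isBounded_iff_forall_norm_le.2
      ⟨n, fun x hx => norm_le_of_mem_cube (hcube hx)⟩)
  · intro y hy x hx
    rw [PiLp.inner_apply]
    refine (Finset.sum_le_sum fun i _ => ?_).trans hy
    simp only [RCLike.inner_apply, conj_trivial]
    have := h.subset_cube hx i
    calc y i * x i ≤ |y i| * |x i| := by rw [← abs_mul]; exact le_abs_self _
      _ ≤ |y i| := mul_le_of_le_one_right (abs_nonneg _) this
  · intro y hy
    rcases (H.dual.nrm_nonneg y).eq_or_lt with h0 | hp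
    · rw [← h0]; exact hpos.le
    · obtain ⟨s, hs, hc⟩ := exists_cone hH.1 hp
      have hpt := H.relInt_pt s
      have h1 := hy _ (h.mem _ (hpt.nrm_le_one hH.1))
      rw [inner_smul_left, conj_trivial, ← hH.pair_eq_inner,
        (hc _).2 (hpt.mem_faceSet hH.1 hs).2.1, hpt.nrm_eq_one hH.1 hs, mul_one,
        inv_mul_le_iff₀ hpos, mul_one] at h1
      exact h1
  · intro y hy x hx
    rw [inner_smul_right, ← hH.pair_eq_inner, inv_mul_le_iff₀ hpos]
    refine (pair_le hH.1 x y).trans ?_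
    exact mul_le_mul (h.nrm_le x hx) hy (nrm_nonneg _ _) hpos.le

theorem IsStandard.nrm_le_norm {H : HannerRep n} (hH : H.IsStandard) (x : E n) :
    H.nrm x ≤ n * ‖x‖ := by
  have := H.nrm_le_sum hH.1 x
  rw [hH.2] at this
  exact this.trans (sum_abs_le_norm x)

theorem near_of_hausdorffDist {H : HannerRep n} (hH : H.IsStandard) {ε : ℝ} (hε : 0 < ε)
    {K : Set (E n)} (hK : IsSymmConvexBody K) (h1 : crossPolytope n ⊆ K) (h2 : K ⊆ cube n)
    (hd : n * Metric.hausdorffDist K H.body ≤ ε) : H.Near ε K := by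
  have hne : K.Nonempty := hK.interior_nonempty.mono interior_subset
  have hHc := body_isCompact hH.1
  have hHne : H.body.Nonempty := ⟨0, zero_mem_body hH.1⟩
  have hfin : Metric.hausdorffEDist K H.body ≠ ⊤ :=
    Metric.hausdorffEDist_ne_top_of_nonempty_of_bounded hne hHne hK.isCompact.isBounded
      hHc.isBounded
  have hpos : 0 < 1 + ε := by positivity
  refine ⟨hK.convex, hK.isCompact, h1, h2, fun x hx => ?_, fun x hx => ?_⟩
  · obtain ⟨y, hy, hxy⟩ := hHc.exists_infDist_eq_dist hHne x
    have h3 := Metric.infDist_le_hausdorffDist_of_mem hx hfin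
    rw [hxy, dist_eq_norm] at h3
    calc H.nrm x = H.nrm (y + (x - y)) := by rw [add_sub_cancel]
      _ ≤ H.nrm y + H.nrm (x - y) := nrm_add_le _ _ _
      _ ≤ 1 + ε := add_le_add (hH.mem_body.1 hy) ((hH.nrm_le_norm _).trans
          ((mul_le_mul_of_nonneg_left h3 (Nat.cast_nonneg n)).trans hd))
  · obtain ⟨y, hy, hxy⟩ := hK.isCompact.exists_infDist_eq_dist hne x
    rw [Metric.hausdorffDist_comm] at hd
    have h3 := Metric.infDist_le_hausdorffDist_of_mem (hH.mem_body.2 hx)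
      (Metric.hausdorffEDist_comm.trans_ne hfin)
    rw [hxy, dist_eq_norm] at h3
    -- Writing `x` as `y + ε z` with `y` and `z` in `K`, where `z` is found in the cross-polytope,
    -- puts `x` into `(1 + ε) K`.
    have hz : ε⁻¹ • (x - y) ∈ K := h1 (by
      change ∑ i, |ε⁻¹ * (x - y) i| ≤ 1
      simp only [abs_mul, ← Finset.mul_sum, abs_of_pos (inv_pos.2 hε)]
      rw [inv_mul_le_iff₀ hε, mul_one]
      exact (sum_abs_le_norm _).trans
        ((mul_le_mul_of_nonneg_left h3 (Nat.cast_nonneg n)).trans hd))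
    have := hK.convex hy hz (a := (1 + ε)⁻¹) (b := (1 + ε)⁻¹ * ε) (by positivity) (by positivity)
      (by field_simp)
    rwa [mul_smul, smul_inv_smul₀ hε.ne', ← smul_add, add_sub_cancel] at this

/-! ### Points of tangency -/

theorem TouchesAt.mem {H : HannerRep n} {s : Fin n → SignType} {A : Set (E n)} {p q : E n}
    (hA : H.TouchesAt s A p q) : p ∈ A := by
  obtain ⟨W, rfl⟩ := hA.exists_coset
  simp [coset]

/-- The tangent dilate has factor 1/m, where m is the minimum of the gauge of K on A. The minimum
exists after cutting A with a large dilate of K, and is positive because 0 is not in A. -/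
theorem TouchesAt.exists_isTangencyPoint {H : HannerRep n} {s : Fin n → SignType}
    {A : Set (E n)} {p q : E n} (hA : H.TouchesAt s A p q) {ε : ℝ} {K : Set (E n)}
    (hK : H.Near ε K) (c : E n) : ∃ x, IsTangencyPoint A c K x := by
  have hnhds := hK.mem_nhds
  have hcont : Continuous (gauge K) := continuous_gauge hK.convex hnhds
  have habs : Absorbent ℝ K := absorbent_nhds_zero hnhds
  have hclosedA : IsClosed A := by
    obtain ⟨W, rfl⟩ := hA.exists_coset
    exact isClosed_coset p W
  set T := gauge K p + 1
  have hT : 0 < T := add_pos_of_nonneg_of_pos (gauge_nonneg p) one_pos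
  have mem_TK : ∀ x, gauge K x ≤ T → x ∈ T • K := by
    intro x hx
    rw [Set.mem_smul_set_iff_inv_smul_mem₀ hT.ne']
    have : gauge K (T⁻¹ • x) ≤ 1 := by
      rw [gauge_smul_of_nonneg (inv_nonneg.2 hT.le), smul_eq_mul, inv_mul_le_iff₀ hT, mul_one]
      exact hx
    have := (gauge_le_one_iff_mem_closure hK.convex hnhds).1 this
    rwa [hK.isCompact.isClosed.closure_eq] at this
  have hcompact : IsCompact (A ∩ T • K) := (hK.isCompact.smul T).inter_left hclosedA
  have hpm : p ∈ A ∩ T • K := ⟨hA.mem, mem_TK p (by simp [T])⟩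
  obtain ⟨a, ⟨haA, -⟩, hmin⟩ := hcompact.exists_isMinOn ⟨p, hpm⟩ hcont.continuousOn
  have hmin' : ∀ x ∈ A, gauge K a ≤ gauge K x := by
    intro x hx
    rcases le_or_gt (gauge K x) T with h | h
    · exact hmin ⟨hx, mem_TK x h⟩
    · have h1 : gauge K a ≤ gauge K p := hmin hpm
      have h2 : gauge K p ≤ T := by simp [T]
      linarith
  have ha0 : a ≠ 0 := by
    rintro rfl
    have := hA.pair_eq_one _ haA
    rw [pair_eq_zero_left _ _ (fun _ _ => rfl)] at this
    exact zero_ne_one this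
  have hm : 0 < gauge K a :=
    (gauge_pos habs (NormedSpace.isVonNBounded_of_isBounded ℝ hK.isCompact.isBounded)).2 ha0
  set t := (gauge K a)⁻¹
  have ht : 0 < t := inv_pos.2 hm
  have hta : gauge K (t • a) = 1 := by
    rw [gauge_smul_of_nonneg ht.le, smul_eq_mul, inv_mul_cancel₀ hm.ne']
  have hdisj : Disjoint (t • A) (interior K) := by
    rw [Set.disjoint_left]
    rintro _ ⟨x, hx, rfl⟩ hi
    have h1 := (gauge_lt_one_iff_mem_interior hK.convex hnhds).2 hi
    rw [gauge_smul_of_nonneg ht.le, smul_eq_mul, inv_mul_lt_iff₀ hm, mul_one] at h1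
    exact absurd (hmin' x hx) (not_le.2 h1)
  have hfr : IsCompact ((t • A) ∩ frontier K) := by
    refine IsCompact.inter_left ?_ (hclosedA.smul_of_ne_zero ht.ne')
    exact hK.isCompact.of_isClosed_subset isClosed_frontier hK.isCompact.isClosed.frontier_subset
  have hne : ((t • A) ∩ frontier K).Nonempty :=
    ⟨t • a, Set.smul_mem_smul_set haA, (gauge_eq_one_iff_mem_frontier hK.convex hnhds).1 hta⟩
  obtain ⟨x, hx, hxmin⟩ := hfr.exists_isMinOn hne
    (f := fun x => dist x c) (by fun_prop)
  exact ⟨x, t, ht, hdisj, hx, fun z hz => hxmin hz⟩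

theorem TouchesAt.tangencyPoint_spec {H : HannerRep n} {s : Fin n → SignType}
    {A : Set (E n)} {p q : E n} (hA : H.TouchesAt s A p q) {ε : ℝ} {K : Set (E n)}
    (hK : H.Near ε K) (c : E n) : IsTangencyPoint A c K (tangencyPoint A c K) :=
  Classical.epsilon_spec (hA.exists_isTangencyPoint hK c)

theorem mem_of_isTangencyPoint {A K : Set (E n)} {c x : E n} (hK : IsCompact K)
    (h : IsTangencyPoint A c K x) : x ∈ K := by
  obtain ⟨t, -, -, hx, -⟩ := h
  exact hK.isClosed.frontier_subset hx.2

/-- Compactness turns uniqueness of the touching point into stability: on the part of A at distance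
at least ω from p the norm has a minimum exceeding 1. -/
theorem TouchesAt.exists_norm_sub_le {H : HannerRep n} (hH : H.IsStandard) {s : Fin n → SignType}
    {A : Set (E n)} {p q : E n} (hA : H.TouchesAt s A p q) {ω : ℝ} (hω : 0 < ω) :
    ∃ ε : ℝ, 0 < ε ∧ ∀ x ∈ A, H.nrm x ≤ 1 + ε → ‖x - p‖ < ω := by
  have hclosedA : IsClosed A := by
    obtain ⟨W, rfl⟩ := hA.exists_coset
    exact isClosed_coset p W
  let T : Set (E n) := A ∩ {x | H.nrm x ≤ 2} ∩ {x | ω ≤ ‖x - p‖}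
  have hT : IsCompact T := by
    refine Metric.isCompact_of_isClosed_isBounded ?_ (isBounded_iff_forall_norm_le.2
      ⟨n * 2, fun x hx => ?_⟩)
    · exact (hclosedA.inter (isClosed_le H.continuous_nrm continuous_const)).inter
        (isClosed_le continuous_const (by fun_prop))
    · refine (norm_le_sum_abs x).trans ((Finset.sum_le_sum (g := fun _ => (2 : ℝ)) fun i _ =>
        (H.abs_le_nrm (by simp [hH.2])).trans hx.1.2).trans_eq ?_)
      simp
  rcases T.eq_empty_or_nonempty with he | hne
  · refine ⟨1, one_pos, fun x hx hle => ?_⟩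
    by_contra hcon
    have : x ∈ T := ⟨⟨hx, hle.trans (by norm_num)⟩, not_lt.1 hcon⟩
    rw [he] at this
    exact this
  · obtain ⟨a, ha, hmin⟩ := hT.exists_isMinOn hne H.continuous_nrm.continuousOn
    have h1 : 1 < H.nrm a := by
      by_contra hcon
      have := hA.eq_of_nrm_le a ha.1.1 (not_lt.1 hcon)
      have h2 := ha.2
      rw [this] at h2
      simp only [Set.mem_ofPred_eq, sub_self, norm_zero] at h2
      linarith
    refine ⟨min 1 ((H.nrm a - 1) / 2), lt_min one_pos (by linarith), fun x hx hle => ?_⟩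
    by_contra hcon
    have hm := min_le_left 1 ((H.nrm a - 1) / 2)
    have hm' := min_le_right 1 ((H.nrm a - 1) / 2)
    have : H.nrm a ≤ H.nrm x :=
      hmin (show x ∈ T from ⟨⟨hx, show H.nrm x ≤ 2 by linarith⟩, not_lt.1 hcon⟩)
    linarith

/-- If t were too small, t p would be interior to K; if too large, every point of tA would have norm
above 1 + ε, since A stays outside the interior of H. -/
theorem TouchesAt.scale_le {H : HannerRep n} (hH : H.IsStandard) {s : Fin n → SignType}
    {A : Set (E n)} {p q : E n} (hA : H.TouchesAt s A p q) {ε : ℝ} (hε : 0 ≤ ε) {K : Set (E n)}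
    (hK : H.Near ε K) {t : ℝ} (ht : 0 < t) (hdisj : Disjoint (t • A) (interior K)) {a : E n}
    (ha : a ∈ A) (hta : t • a ∈ K) : (1 + ε)⁻¹ ≤ t ∧ t ≤ 1 + ε := by
  have hpos : 0 < 1 + ε := by positivity
  constructor
  · by_contra hcon
    push Not at hcon
    refine Set.disjoint_left.1 hdisj (Set.smul_mem_smul_set hA.mem) ?_
    rw [← gauge_lt_one_iff_mem_interior hK.convex hK.mem_nhds]
    have h1 := gauge_le_one_of_mem (hK.mem p (hA.relInt.nrm_le_one hH.1))
    rw [gauge_smul_of_nonneg (inv_nonneg.2 hpos.le), smul_eq_mul, inv_mul_le_iff₀ hpos,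
      mul_one] at h1
    rw [gauge_smul_of_nonneg ht.le, smul_eq_mul]
    calc t * gauge K p ≤ t * (1 + ε) := mul_le_mul_of_nonneg_left h1 ht.le
      _ < (1 + ε)⁻¹ * (1 + ε) := mul_lt_mul_of_pos_right hcon hpos
      _ = 1 := inv_mul_cancel₀ hpos.ne'
  · have h1 := hK.nrm_le _ hta
    rw [nrm_smul, abs_of_pos ht] at h1
    exact (le_mul_of_one_le_right ht.le (hA.one_le_nrm hH.1 ha)).trans h1

theorem TouchesAt.exists_tangency_close {H : HannerRep n} (hH : H.IsStandard)
    {s : Fin n → SignType} {A : Set (E n)} {p q : E n} (hA : H.TouchesAt s A p q) {ω : ℝ}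
    (hω : 0 < ω) : ∃ ε₀ : ℝ, 0 < ε₀ ∧ ∀ ε, 0 ≤ ε → ε ≤ ε₀ → ∀ K, H.Near ε K → ∀ c x,
      IsTangencyPoint A c K x → ‖x - p‖ ≤ ω := by
  obtain ⟨ε₁, hε₁, h⟩ := hA.exists_norm_sub_le hH (ω := ω / 2) (by positivity)
  have hM : 0 < ‖p‖ + ω / 2 := by positivity
  -- For ε ≤ 1 one has (1 + ε)² ≤ 1 + 3ε, whence the factor 1/3. The last term makes the error from
  -- the dilation, at most ε ‖a‖, no larger than ω/2.
  refine ⟨min 1 (min (ε₁ / 3) (ω / 2 / (‖p‖ + ω / 2))), by positivity,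
    fun ε hε0 hε K hK c x hx => ?_⟩
  obtain ⟨t, ht, hdisj, ⟨⟨a, ha, rfl⟩, hfr⟩, -⟩ := hx
  have hxK := hK.isCompact.isClosed.frontier_subset hfr
  obtain ⟨t1, t2⟩ := hA.scale_le hH hε0 hK ht hdisj ha hxK
  have e1 : ε ≤ 1 := hε.trans (min_le_left _ _)
  have e2 : ε ≤ ε₁ / 3 := hε.trans ((min_le_right _ _).trans (min_le_left _ _))
  have e3 : ε ≤ ω / 2 / (‖p‖ + ω / 2) :=
    hε.trans ((min_le_right _ _).trans (min_le_right _ _))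
  have hpos : 0 < 1 + ε := by positivity
  have h1 := hK.nrm_le _ hxK
  simp only [nrm_smul, abs_of_pos ht] at h1
  have h2 : H.nrm a ≤ (1 + ε) * (1 + ε) := by
    have h3 : (1 + ε)⁻¹ * H.nrm a ≤ 1 + ε :=
      (mul_le_mul_of_nonneg_right t1 (nrm_nonneg _ _)).trans h1
    rwa [inv_mul_le_iff₀ hpos] at h3
  have h4 : ‖a - p‖ < ω / 2 := h a ha (by nlinarith)
  have h5 : ‖a‖ ≤ ‖p‖ + ω / 2 := by
    have := norm_le_norm_add_norm_sub' a p
    linarith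
  have t3 : 1 - ε ≤ t := by
    refine le_trans ?_ t1
    rw [← one_div, le_div_iff₀ hpos]
    nlinarith
  have h6 : ‖(t - 1) • a‖ ≤ ω / 2 := by
    rw [norm_smul, Real.norm_eq_abs]
    have : |t - 1| ≤ ε := abs_le.2 ⟨by linarith, by linarith⟩
    calc |t - 1| * ‖a‖ ≤ ω / 2 / (‖p‖ + ω / 2) * (‖p‖ + ω / 2) :=
          mul_le_mul (this.trans e3) h5 (norm_nonneg _) (by positivity)
      _ = ω / 2 := div_mul_cancel₀ _ hM.ne'
  have e : t • a - p = (t - 1) • a + (a - p) := by module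
  change ‖t • a - p‖ ≤ ω
  rw [e]
  exact (norm_add_le _ _).trans (by linarith)

/-! ### Faces of the form `x i = ±1` -/

theorem RelInt.eq_single {H : HannerRep n} (hd : H.IsDirect) {s : Fin n → SignType} {p : E n}
    (h : H.RelInt s p) {i : Fin n} (hi : i ∈ H.coords) (hs : ∀ j, j ≠ i → s j = 0) :
    p = EuclideanSpace.single i (s i : ℝ) := by
  induction H generalizing p with
  | interval k =>
    simp only [coords, Finset.mem_singleton] at hi
    subst hi
    exact h
  | sumOne H₁ H₂ h₁ h₂ =>
    obtain ⟨p₁, p₂, a, b, hp₁, hp₂, -, -, e₁, e₂, -, rfl⟩ := h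
    simp only [coords, Finset.mem_union] at hi
    rcases hi with hi | hi
    · have v₂ : H₂.Vanish s := fun j hj =>
        hs j fun h => Finset.disjoint_left.1 hd.2.2 hi (h ▸ hj)
      rw [hp₂.eq_zero_of_vanish v₂, e₂ v₂, h₁ hd.1 hp₁ hi]; simp
    · have v₁ : H₁.Vanish s := fun j hj =>
        hs j fun h => Finset.disjoint_right.1 hd.2.2 hi (h ▸ hj)
      rw [hp₁.eq_zero_of_vanish v₁, e₁ v₁, h₂ hd.2.1 hp₂ hi]; simp
  | sumInf H₁ H₂ h₁ h₂ =>
    obtain ⟨p₁, p₂, hp₁, hp₂, rfl⟩ := h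
    simp only [coords, Finset.mem_union] at hi
    rcases hi with hi | hi
    · have v₂ : H₂.Vanish s := fun j hj =>
        hs j fun h => Finset.disjoint_left.1 hd.2.2 hi (h ▸ hj)
      rw [hp₂.eq_zero_of_vanish v₂, h₁ hd.1 hp₁ hi]; simp
    · have v₁ : H₁.Vanish s := fun j hj =>
        hs j fun h => Finset.disjoint_right.1 hd.2.2 hi (h ▸ hj)
      rw [hp₁.eq_zero_of_vanish v₁, h₂ hd.2.1 hp₂ hi]; simp

theorem nrm_congr_abs (H : HannerRep n) {x y : E n} (h : ∀ i, |x i| = |y i|) :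
    H.nrm x = H.nrm y := by
  induction H with
  | interval i => exact h i
  | sumOne H₁ H₂ h₁ h₂ => rw [nrm, nrm, h₁, h₂]
  | sumInf H₁ H₂ h₁ h₂ => rw [nrm, nrm, h₁, h₂]

/-- The reflection in the coordinate hyperplane `x j = 0`. -/
def flip (j : Fin n) : E n ≃ₗᵢ[ℝ] E n :=
  LinearIsometryEquiv.piLpCongrRight 2 fun k =>
    if k = j then LinearIsometryEquiv.neg ℝ else LinearIsometryEquiv.refl ℝ ℝ

theorem flip_apply (j : Fin n) (x : E n) (k : Fin n) :
    flip j x k = if k = j then -x k else x k := by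
  simp only [flip, LinearIsometryEquiv.piLpCongrRight_apply]
  split_ifs <;> simp

theorem centroid_eq_of_preimage {F : Set (E n)} (e : E n ≃ₗᵢ[ℝ] E n) (h : e ⁻¹' F = F) :
    e (centroid F) = centroid F := by
  have hmp : MeasurePreserving e μHE[dim F] μHE[dim F] :=
    e.toIsometryEquiv.measurePreserving_euclideanHausdorffMeasure _
  have h1 : ∫ x in F, e x ∂μHE[dim F] = ∫ x in F, x ∂μHE[dim F] := by
    have := hmp.setIntegral_preimage_emb e.toHomeomorph.measurableEmbedding (fun x => x) F
    rwa [h] at this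
  rw [centroid, setAverage_eq, map_smul]
  congr 1
  refine Eq.trans ?_ h1
  exact (e.toContinuousLinearEquiv.integral_comp_comm (μ := μHE[dim F].restrict F) fun x => x).symm

/-- The face {x_i = ±1} of H is invariant under reflection in every other coordinate hyperplane,
hence so is its centroid. -/
theorem IsStandard.centroid_single {H : HannerRep n} (hH : H.IsStandard) {s : Fin n → SignType}
    {i : Fin n} (hs : ∀ j, j ≠ i → s j = 0) (hsi : s i ≠ 0) :
    centroid (H.faceSet s) = EuclideanSpace.single i (s i : ℝ) := by
  have hi : i ∈ H.coords := by simp [hH.2]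
  have hv : ¬ H.Vanish s := fun h => hsi (h i hi)
  have hq := H.dual.relInt_pt s
  have hqe := hq.eq_single hH.1.dual (by simpa using hi) hs
  have hmem : ∀ x, x ∈ H.faceSet s ↔ H.nrm x ≤ 1 ∧ x i * s i = 1 := fun x => by
    rw [hq.mem_faceSet_iff hH.1 hv, hqe, hH.pair_eq_inner, hH.mem_body]
    simp [EuclideanSpace.inner_single_right, mul_comm]
  have hc := (hmem _).1 (centroid_mem_faceSet hH.1 hv)
  ext j
  by_cases hj : j = i
  · subst hj
    have h2 : ((s j : SignType) : ℝ) * (s j : ℝ) = 1 := by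
      rcases hs : s j with _ | _ | _ <;> simp_all
    simp only [PiLp.single_apply, if_true]
    linear_combination (s j : ℝ) * hc.2 - (centroid (H.faceSet s) j) * h2
  · have hpre : flip j ⁻¹' (H.faceSet s) = H.faceSet s := by
      ext x
      rw [Set.mem_preimage, hmem, hmem, flip_apply, if_neg (Ne.symm hj),
        H.nrm_congr_abs (y := x) fun k => by rw [flip_apply]; split_ifs <;> simp]
    have h1 := congrArg (fun x : E n => x j) (centroid_eq_of_preimage (flip j) hpre)
    simp only [flip_apply, if_true] at h1
    simp only [PiLp.single_apply, if_neg hj]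
    linarith

/-- The tangency points of these faces do not move with K. The point ±e_i lies in K by B_1 ⊂ K, and
K ⊂ B_∞ forces the dilation factor to be 1; being itself the centroid of the face, ±e_i is the
nearest point. This fixes one coordinate of the flag normals exactly. -/
theorem IsStandard.points_single {H : HannerRep n} (hH : H.IsStandard) {s : Fin n → SignType}
    {i : Fin n} (hs : ∀ j, j ≠ i → s j = 0) (hsi : s i ≠ 0) {ε : ℝ} {K : Set (E n)}
    (hK : H.Near ε K) : H.points K (H.faceSet s) = EuclideanSpace.single i (s i : ℝ) := by
  have hi : i ∈ H.coords := by simp [hH.2]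
  have hv : ¬ H.Vanish s := fun h => hsi (h i hi)
  obtain ⟨p, q, hA⟩ := exists_touchesAt_affSub hH.1 hv
  have hp := hA.relInt.eq_single hH.1 hi hs
  have hq := hA.relInt_dual.eq_single hH.1.dual (by simpa using hi) hs
  have h2 : |((s i : SignType) : ℝ)| = 1 := by
    rcases hs : s i with _ | _ | _ <;> simp_all
  have h3 : ((s i : SignType) : ℝ) * (s i : ℝ) = 1 := by
    rcases hs : s i with _ | _ | _ <;> simp_all
  have hpK : p ∈ K := hK.cross_subset (hp ▸ single_mem_crossPolytope i h2.le)
  obtain ⟨t, ht, hdisj, ⟨hx, hfr⟩, hmin⟩ :=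
    hA.tangencyPoint_spec hK (centroid (H.faceSet s))
  have hgp := gauge_le_one_of_mem hpK
  have ht1 : 1 ≤ t := by
    by_contra hcon
    push Not at hcon
    refine Set.disjoint_left.1 hdisj (Set.smul_mem_smul_set hA.mem) ?_
    rw [← gauge_lt_one_iff_mem_interior hK.convex hK.mem_nhds, gauge_smul_of_nonneg ht.le,
      smul_eq_mul]
    exact (mul_le_of_le_one_right ht.le hgp).trans_lt hcon
  have ht2 : t ≤ 1 := by
    obtain ⟨a, ha, hta⟩ := hx
    have hxK := hK.isCompact.isClosed.frontier_subset hfr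
    have e1 := hK.subset_cube hxK i
    rw [← hta] at e1
    have e2 := hA.pair_eq_one a ha
    rw [hq, hH.pair_eq_inner] at e2
    simp only [EuclideanSpace.inner_single_right, conj_trivial] at e2
    have e3 : |a i| = 1 := by
      have := congrArg abs e2
      rwa [abs_mul, h2, one_mul, abs_one] at this
    simp only [PiLp.smul_apply, smul_eq_mul, abs_mul, e3, mul_one, abs_of_pos ht] at e1
    exact e1
  have ht' : t = 1 := le_antisymm ht2 ht1
  rw [ht', one_smul] at hdisj hmin
  have hpfr : p ∈ frontier K := by
    rw [← gauge_eq_one_iff_mem_frontier hK.convex hK.mem_nhds]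
    refine le_antisymm hgp (not_lt.1 fun hlt => ?_)
    exact Set.disjoint_left.1 hdisj hA.mem
      ((gauge_lt_one_iff_mem_interior hK.convex hK.mem_nhds).1 hlt)
  -- The candidate `p` is at distance 0 from the centroid, so the minimiser coincides with it.
  have h4 := hmin p ⟨hA.mem, hpfr⟩
  rw [hH.centroid_single hs hsi, hp, dist_self] at h4
  exact dist_le_zero.1 (by rw [points, hH.centroid_single hs hsi]; exact h4)

end HannerRep

end HannerMahler

end

/-! ### Combinatorics of vertices, facets and flags. -/

noncomputable section

namespace HannerMahler

namespace HannerRep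

variable {n : ℕ}

/-! ### Vertices and flags -/

/-- The sign vectors of the vertices of `H`. -/
def Vtx : HannerRep n → (Fin n → SignType) → Prop
  | interval i, s => s i ≠ 0
  | sumOne H₁ H₂, s => (H₁.Vtx s ∧ H₂.Vanish s) ∨ (H₁.Vanish s ∧ H₂.Vtx s)
  | sumInf H₁ H₂, s => H₁.Vtx s ∧ H₂.Vtx s

theorem Vtx.not_vanish {H : HannerRep n} {s : Fin n → SignType} (h : H.Vtx s) : ¬ H.Vanish s := by
  induction H with
  | interval i => exact fun hv => h (hv i (by simp [coords]))
  | sumOne H₁ H₂ h₁ h₂ =>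
    rw [vanish_sumOne]
    rcases h with h | h
    · exact fun hv => h₁ h.1 hv.1
    · exact fun hv => h₂ h.2 hv.2
  | sumInf H₁ H₂ h₁ h₂ =>
    rw [vanish_sumInf]
    exact fun hv => h₁ h.1 hv.1

theorem vtx_congr (H : HannerRep n) {s t : Fin n → SignType}
    (h : ∀ i ∈ H.coords, s i = 0 ↔ t i = 0) : H.Vtx s ↔ H.Vtx t := by
  have hvan : ∀ (H : HannerRep n), (∀ i ∈ H.coords, s i = 0 ↔ t i = 0) →
      (H.Vanish s ↔ H.Vanish t) := fun H h => forall₂_congr h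
  induction H with
  | interval i => exact (h i (by simp [coords])).not
  | sumOne H₁ H₂ h₁ h₂ =>
    have e₁ : ∀ i ∈ H₁.coords, s i = 0 ↔ t i = 0 := fun i hi => h i (by simp [coords, hi])
    have e₂ : ∀ i ∈ H₂.coords, s i = 0 ↔ t i = 0 := fun i hi => h i (by simp [coords, hi])
    exact or_congr (and_congr (h₁ e₁) (hvan _ e₂)) (and_congr (hvan _ e₁) (h₂ e₂))
  | sumInf H₁ H₂ h₁ h₂ =>
    have e₁ : ∀ i ∈ H₁.coords, s i = 0 ↔ t i = 0 := fun i hi => h i (by simp [coords, hi])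
    have e₂ : ∀ i ∈ H₂.coords, s i = 0 ↔ t i = 0 := fun i hi => h i (by simp [coords, hi])
    exact and_congr (h₁ e₁) (h₂ e₂)

theorem vtx_congr_eq (H : HannerRep n) {s t : Fin n → SignType}
    (h : ∀ i ∈ H.coords, s i = t i) : H.Vtx s ↔ H.Vtx t :=
  H.vtx_congr fun i hi => by rw [h i hi]

/-- For vertices the code is the point: their coordinates lie in {−1, 0, 1}. Applied to `H.dual`
this says the same of the facet normals of H. -/
theorem RelInt.apply_of_vtx {H : HannerRep n} (hd : H.IsDirect) {s : Fin n → SignType} {p : E n}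
    (h : H.RelInt s p) (hv : H.Vtx s) {j : Fin n} (hj : j ∈ H.coords) : p j = s j := by
  induction H generalizing p with
  | interval i =>
    simp only [coords, Finset.mem_singleton] at hj
    subst hj
    rw [RelInt] at h
    simp [h]
  | sumOne H₁ H₂ h₁ h₂ =>
    obtain ⟨p₁, p₂, a, b, hp₁, hp₂, -, -, e₁, e₂, -, rfl⟩ := h
    simp only [coords, Finset.mem_union] at hj
    rcases hv with ⟨hv, hz⟩ | ⟨hz, hv⟩
    · rw [hp₂.eq_zero_of_vanish hz, e₂ hz]
      rcases hj with hj | hj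
      · simp [h₁ hd.1 hp₁ hv hj]
      · simp [hp₁.apply_eq_zero (Finset.disjoint_right.1 hd.2.2 hj), hz j hj]
    · rw [hp₁.eq_zero_of_vanish hz, e₁ hz]
      rcases hj with hj | hj
      · simp [hp₂.apply_eq_zero (Finset.disjoint_left.1 hd.2.2 hj), hz j hj]
      · simp [h₂ hd.2.1 hp₂ hv hj]
  | sumInf H₁ H₂ h₁ h₂ =>
    obtain ⟨p₁, p₂, hp₁, hp₂, rfl⟩ := h
    simp only [coords, Finset.mem_union] at hj
    rcases hj with hj | hj
    · simp [h₁ hd.1 hp₁ hv.1 hj, hp₂.apply_eq_zero (Finset.disjoint_left.1 hd.2.2 hj)]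
    · simp [h₂ hd.2.1 hp₂ hv.2 hj, hp₁.apply_eq_zero (Finset.disjoint_right.1 hd.2.2 hj)]

/-- A singleton face cannot meet both summands of an ℓ₁-sum, as these meet only in 0, nor have a
whole summand as a factor in an ℓ_∞-sum. -/
theorem vtx_of_faceSet_subset {H : HannerRep n} (hd : H.IsDirect) {s : Fin n → SignType}
    (hs : ¬ H.Vanish s) {v : E n} (h : H.faceSet s ⊆ {v}) : H.Vtx s := by
  induction H generalizing v with
  | interval i =>
    exact fun h0 => hs fun j hj => by
      simp only [coords, Finset.mem_singleton] at hj; rw [hj, h0]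
  | sumOne H₁ H₂ h₁ h₂ =>
    have sub₁ : ¬ H₁.Vanish s → H₁.faceSet s ⊆ {v} := fun v₁ => by
      rw [← faceSet_sumOne_inter_left hd v₁]
      exact Set.inter_subset_left.trans h
    have sub₂ : ¬ H₂.Vanish s → H₂.faceSet s ⊆ {v} := fun v₂ => by
      rw [← faceSet_sumOne_inter_right hd v₂]
      exact Set.inter_subset_left.trans h
    by_cases v₁ : H₁.Vanish s
    · have v₂ : ¬ H₂.Vanish s := fun v₂ => hs (vanish_sumOne.2 ⟨v₁, v₂⟩)
      exact Or.inr ⟨v₁, h₂ hd.2.1 v₂ (sub₂ v₂)⟩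
    · by_cases v₂ : H₂.Vanish s
      · exact Or.inl ⟨h₁ hd.1 v₁ (sub₁ v₁), v₂⟩
      · exfalso
        have e1 : H₁.pt s = v := sub₁ v₁ ((H₁.relInt_pt s).mem_faceSet hd.1 v₁)
        have e2 : H₂.pt s = v := sub₂ v₂ ((H₂.relInt_pt s).mem_faceSet hd.2.1 v₂)
        have e3 := (H₁.relInt_pt s).nrm_eq_one hd.1 v₁
        rw [e1, ← e2, H₁.nrm_eq_zero_iff.2 fun i hi =>
          (H₂.relInt_pt s).apply_eq_zero (Finset.disjoint_left.1 hd.2.2 hi)] at e3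
        exact zero_ne_one e3
  | sumInf H₁ H₂ h₁ h₂ =>
    have nontriv : ∀ (H : HannerRep n), H.IsDirect → ∃ y ∈ H.body, y ≠ 0 := fun H hd => by
      have hv : ¬ H.Vanish fun _ => 1 := fun h => by
        obtain ⟨i, hi⟩ := H.coords_nonempty
        exact one_ne_zero (h i hi)
      refine ⟨H.pt fun _ => 1, (H.relInt_pt _).mem_body hd, fun h0 => ?_⟩
      have := (H.relInt_pt _).nrm_eq_one hd hv
      rw [h0, nrm_zero] at this
      exact zero_ne_one this
    have v₂ : ¬ H₂.Vanish s := fun v₂ => by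
      obtain ⟨y, hy, hy0⟩ := nontriv H₂ hd.2.1
      have hp := H₁.relInt_pt s
      have a := h (add_mem_faceSet_sumInf hd hs (hp.mem_body hd.1) hy (hp.mem_faceSet hd.1)
        fun h => absurd v₂ h)
      have b := h (add_mem_faceSet_sumInf hd hs (hp.mem_body hd.1) (zero_mem_body hd.2.1)
        (hp.mem_faceSet hd.1) fun h => absurd v₂ h)
      exact hy0 (add_left_cancel ((a : _ = v).trans (b : _ = v).symm))
    have v₁ : ¬ H₁.Vanish s := fun v₁ => by
      obtain ⟨y, hy, hy0⟩ := nontriv H₁ hd.1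
      have hp := H₂.relInt_pt s
      have a := h (add_mem_faceSet_sumInf hd hs hy (hp.mem_body hd.2.1) (fun h => absurd v₁ h)
        (hp.mem_faceSet hd.2.1))
      have b := h (add_mem_faceSet_sumInf hd hs (zero_mem_body hd.1) (hp.mem_body hd.2.1)
        (fun h => absurd v₁ h) (hp.mem_faceSet hd.2.1))
      exact hy0 (add_right_cancel ((a : _ = v).trans (b : _ = v).symm))
    constructor
    · refine h₁ hd.1 v₁ (v := v - H₂.pt s) fun y hy => ?_
      have hp := H₂.relInt_pt s
      have a := h (add_mem_faceSet_sumInf hd hs hy.1 (hp.mem_body hd.2.1) (fun _ => hy)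
        (hp.mem_faceSet hd.2.1))
      exact eq_sub_of_add_eq a
    · refine h₂ hd.2.1 v₂ (v := v - H₁.pt s) fun y hy => ?_
      have hp := H₁.relInt_pt s
      have a := h (add_mem_faceSet_sumInf hd hs (hp.mem_body hd.1) hy.1 (hp.mem_faceSet hd.1)
        (fun _ => hy))
      exact eq_sub_of_add_eq' a

/-- The face with sign vector `s` is contained in the face with sign vector `t`. -/
def Sub (H : HannerRep n) (s t : Fin n → SignType) : Prop := H.pair (H.pt s) (H.dual.pt t) = 1

theorem sub_iff {H : HannerRep n} (hd : H.IsDirect) {s t : Fin n → SignType}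
    (hs : ¬ H.Vanish s) (ht : ¬ H.Vanish t) : H.Sub s t ↔ H.faceSet s ⊆ H.faceSet t :=
  (H.relInt_pt s).pair_eq_one_iff hd (H.dual.relInt_pt t) hs ht

theorem sub_dual (H : HannerRep n) {s t : Fin n → SignType} : H.dual.Sub t s ↔ H.Sub s t := by
  rw [Sub, Sub, dual_dual, ← pair_comm]

theorem Sub.not_vanish_left {H : HannerRep n} {s t : Fin n → SignType} (h : H.Sub s t) :
    ¬ H.Vanish s := fun hv => by
  rw [Sub, (H.relInt_pt s).eq_zero_of_vanish hv, pair_eq_zero_left _ _ fun _ _ => rfl] at h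
  exact zero_ne_one h

theorem Sub.not_vanish_right {H : HannerRep n} {s t : Fin n → SignType} (h : H.Sub s t) :
    ¬ H.Vanish t := by
  simpa using ((sub_dual H).2 h).not_vanish_left

theorem sub_refl {H : HannerRep n} (hd : H.IsDirect) {s : Fin n → SignType}
    (hs : ¬ H.Vanish s) : H.Sub s s := (sub_iff hd hs hs).2 subset_rfl

theorem Sub.trans {H : HannerRep n} (hd : H.IsDirect) {s t u : Fin n → SignType}
    (h₁ : H.Sub s t) (h₂ : H.Sub t u) : H.Sub s u :=
  (sub_iff hd h₁.not_vanish_left h₂.not_vanish_right).2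
    (((sub_iff hd h₁.not_vanish_left h₁.not_vanish_right).1 h₁).trans
      ((sub_iff hd h₂.not_vanish_left h₂.not_vanish_right).1 h₂))

theorem pt_congr (H : HannerRep n) {s t : Fin n → SignType} (h : ∀ i ∈ H.coords, s i = t i) :
    H.pt s = H.pt t := by
  induction H with
  | interval i => simp [pt, h i (by simp [coords])]
  | sumOne H₁ H₂ h₁ h₂ =>
    have e₁ : ∀ i ∈ H₁.coords, s i = t i := fun i hi => h i (by simp [coords, hi])
    have e₂ : ∀ i ∈ H₂.coords, s i = t i := fun i hi => h i (by simp [coords, hi])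
    have a := propext (vanish_congr H₁ e₁)
    have b := propext (vanish_congr H₂ e₂)
    rw [pt, pt, h₁ e₁, h₂ e₂]
    by_cases v₁ : H₁.Vanish t <;> by_cases v₂ : H₂.Vanish t <;> simp [a, b, v₁, v₂]
  | sumInf H₁ H₂ h₁ h₂ =>
    have e₁ : ∀ i ∈ H₁.coords, s i = t i := fun i hi => h i (by simp [coords, hi])
    have e₂ : ∀ i ∈ H₂.coords, s i = t i := fun i hi => h i (by simp [coords, hi])
    simp only [pt, h₁ e₁, h₂ e₂]

theorem sub_congr (H : HannerRep n) {s s' t t' : Fin n → SignType}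
    (h : ∀ i ∈ H.coords, s i = s' i) (h' : ∀ i ∈ H.coords, t i = t' i) :
    H.Sub s t ↔ H.Sub s' t' := by
  rw [Sub, Sub, H.pt_congr h, H.dual.pt_congr (s := t) (t := t') (by simpa using h')]

/-- Inclusion of joins is inclusion of their parts, an empty part imposing nothing. The ℓ_∞ case
needs no separate lemma, since it is reached through `sub_dual`. -/
theorem sub_sumOne {H₁ H₂ : HannerRep n} (hd : (sumOne H₁ H₂).IsDirect) {s t : Fin n → SignType}
    (hs : ¬ (sumOne H₁ H₂).Vanish s) :
    (sumOne H₁ H₂).Sub s t ↔ (¬ H₁.Vanish s → H₁.Sub s t) ∧ (¬ H₂.Vanish s → H₂.Sub s t) := by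
  have hdis := hd.2.2
  have hdis' : Disjoint H₁.dual.coords H₂.dual.coords := by simpa using hdis
  have hp₁ := H₁.relInt_pt s
  have hp₂ := H₂.relInt_pt s
  have hq₁ := H₁.dual.relInt_pt t
  have hq₂ := H₂.dual.relInt_pt t
  have A := hq₂.pair_left_combine (p₁ := H₁.dual.pt t) hdis' 1 1 (H₁.pt s)
  have B := hq₁.pair_right_combine (p₂ := H₂.dual.pt t) hdis' 1 1 (H₂.pt s)
  simp only [one_smul, one_mul, ← pair_comm] at A B
  rw [vanish_sumOne] at hs
  simp only [Sub, HannerRep.dual, pt]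
  rw [pair_sumOne hdis, hp₂.pair_left_combine hdis, hp₁.pair_right_combine hdis, A, B]
  have L₁ := hp₁.pair_le_one hd.1 hq₁
  have L₂ := hp₂.pair_le_one hd.2.1 hq₂
  by_cases v₁ : H₁.Vanish s
  · have v₂ : ¬ H₂.Vanish s := fun v₂ => hs ⟨v₁, v₂⟩
    simp [v₁, v₂, pair_eq_zero_left H₁ (x := H₁.pt s) (H₁.dual.pt t)
      (by simp [hp₁.eq_zero_of_vanish v₁])]
  · by_cases v₂ : H₂.Vanish s
    · simp [v₁, v₂, pair_eq_zero_left H₂ (x := H₂.pt s) (H₂.dual.pt t)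
        (by simp [hp₂.eq_zero_of_vanish v₂])]
    · simp only [v₁, v₂, if_false, not_false_eq_true, true_imp_iff]
      constructor
      · intro h; constructor <;> linarith
      · rintro ⟨h, h'⟩; rw [h, h']; norm_num

/-- Existence of a maximal chain of faces through the vertex `v`, the face `x i = v i`, and the
facet `u`. -/
def HasChain (H : HannerRep n) (i : Fin n) (v u : Fin n → SignType) : Prop :=
  ∃ L : List (Fin n → SignType), L.length = H.coords.card ∧
    L.Pairwise (fun s t => H.Sub s t ∧ ¬ H.Sub t s) ∧ (∀ s ∈ L, H.Sub v s ∧ H.Sub s u) ∧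
    ∃ s ∈ L, ∀ j ∈ H.coords, s j = if j = i then v i else 0

theorem HasChain.dual {H : HannerRep n} {i : Fin n} {v u : Fin n → SignType}
    (h : H.HasChain i v u) (hvu : v i = u i) : H.dual.HasChain i u v := by
  obtain ⟨L, hlen, hpw, hb, s, hs, hsi⟩ := h
  refine ⟨L.reverse, by simpa using hlen, ?_, fun t ht => ?_, s, by simpa using hs,
    by simpa [← hvu] using hsi⟩
  · rw [List.pairwise_reverse]
    exact hpw.imp fun h => by rwa [sub_dual, sub_dual]
  · rw [sub_dual, sub_dual]
    exact (hb t (by simpa using ht)).symm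

/-- In an ℓ₁-sum, first climb inside the summand containing v up to the facet there, with empty part
in the other summand; then keep that facet and join to it the members of a chain in the other
summand. The lengths add up. The inclusion rule is a hypothesis so that the two summands can
exchange roles. -/
theorem HasChain.combine {H H₁ H₂ : HannerRep n} (hd₁ : H₁.IsDirect)
    (hdis : Disjoint H₁.coords H₂.coords) (hc : H.coords = H₁.coords ∪ H₂.coords)
    (hsub : ∀ s t, ¬ H.Vanish s →
      (H.Sub s t ↔ (¬ H₁.Vanish s → H₁.Sub s t) ∧ (¬ H₂.Vanish s → H₂.Sub s t)))
    {i i₂ : Fin n} {v v₂ u : Fin n → SignType} (hi : i ∈ H₁.coords) (hv : H₂.Vanish v)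
    (h₁ : H₁.HasChain i v u) (h₂ : H₂.HasChain i₂ v₂ u) : H.HasChain i v u := by
  obtain ⟨L₁, len₁, pw₁, b₁, e, he, hei⟩ := h₁
  obtain ⟨L₂, len₂, pw₂, b₂, -⟩ := h₂
  have hvan : ∀ s, H.Vanish s ↔ H₁.Vanish s ∧ H₂.Vanish s := fun s => by
    simp only [Vanish, hc, Finset.mem_union, or_imp, forall_and]
  have g₁ : ∀ s : Fin n → SignType, H₂.Vanish (glue H₁.coords s 0) := fun s =>
    (vanish_congr _ (glue_right hdis s 0)).2 fun _ _ => rfl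
  have g₂ : ∀ s : Fin n → SignType, H₁.Vanish (glue H₁.coords s 0) ↔ H₁.Vanish s := fun s =>
    vanish_congr _ (glue_left s 0)
  have g₃ : ∀ s : Fin n → SignType, H₁.Vanish (glue H₁.coords u s) ↔ H₁.Vanish u := fun s =>
    vanish_congr _ (glue_left u s)
  have g₄ : ∀ s : Fin n → SignType, H₂.Vanish (glue H₁.coords u s) ↔ H₂.Vanish s := fun s =>
    vanish_congr _ (glue_right hdis u s)
  have hvu : H₁.Sub v u := (b₁ e he).1.trans hd₁ (b₁ e he).2
  have hu₁ := hvu.not_vanish_right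
  have s₁ : ∀ s t, ¬ H₁.Vanish s → (H.Sub (glue H₁.coords s 0) t ↔ H₁.Sub s t) := fun s t hs => by
    rw [hsub _ _ fun h => hs ((g₂ s).1 ((hvan _).1 h).1)]
    simp only [g₁, g₂, hs, not_true, not_false_eq_true, true_imp_iff, false_imp_iff, and_true]
    exact H₁.sub_congr (glue_left s 0) fun _ _ => rfl
  have s₂ : ∀ s t, ¬ H₂.Vanish s → (H.Sub (glue H₁.coords u s) t ↔ H₁.Sub u t ∧ H₂.Sub s t) :=
      fun s t hs => by
    rw [hsub _ _ fun h => hu₁ ((g₃ s).1 ((hvan _).1 h).1)]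
    simp only [g₃, g₄, hs, hu₁, not_false_eq_true, true_imp_iff]
    rw [H₁.sub_congr (glue_left u s) fun _ _ => rfl,
      H₂.sub_congr (glue_right hdis u s) fun _ _ => rfl]
  have r₁ : ∀ s t t', H₁.Sub s (glue H₁.coords t t') ↔ H₁.Sub s t := fun s t t' =>
    H₁.sub_congr (fun _ _ => rfl) (glue_left t t')
  have r₂ : ∀ s t t', H₂.Sub s (glue H₁.coords t t') ↔ H₂.Sub s t' := fun s t t' =>
    H₂.sub_congr (fun _ _ => rfl) (glue_right hdis t t')
  have sv : ∀ t, H.Sub v t ↔ H₁.Sub v t := fun t => by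
    rw [hsub _ _ fun h => hvu.not_vanish_left ((hvan _).1 h).1]
    simp [hv, hvu.not_vanish_left]
  refine ⟨L₁.map (fun s => glue H₁.coords s 0) ++ L₂.map fun s => glue H₁.coords u s, ?_, ?_, ?_,
    glue H₁.coords e 0, ?_, ?_⟩
  · simp [len₁, len₂, hc, Finset.card_union_of_disjoint hdis]
  · rw [List.pairwise_append]
    refine ⟨?_, ?_, ?_⟩
    · rw [List.pairwise_map]
      refine pw₁.imp ?_
      rintro s t ⟨h, h'⟩
      rw [s₁ _ _ h.not_vanish_left, s₁ _ _ h.not_vanish_right, r₁, r₁]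
      exact ⟨h, h'⟩
    · rw [List.pairwise_map]
      refine pw₂.imp ?_
      rintro s t ⟨h, h'⟩
      rw [s₂ _ _ h.not_vanish_left, s₂ _ _ h.not_vanish_right, r₁, r₁, r₂, r₂]
      exact ⟨⟨sub_refl hd₁ hu₁, h⟩, fun h3 => h' h3.2⟩
    · intro a ha b hb
      obtain ⟨s, hs, rfl⟩ := List.mem_map.1 ha
      obtain ⟨t, ht, rfl⟩ := List.mem_map.1 hb
      rw [s₁ _ _ (b₁ s hs).1.not_vanish_right, r₁, s₂ _ _ (b₂ t ht).1.not_vanish_right, r₂]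
      refine ⟨(b₁ s hs).2, fun h => h.2.not_vanish_right fun _ _ => rfl⟩
  · intro a ha
    rcases List.mem_append.1 ha with ha | ha
    · obtain ⟨s, hs, rfl⟩ := List.mem_map.1 ha
      rw [sv, s₁ _ _ (b₁ s hs).1.not_vanish_right, r₁]
      exact b₁ s hs
    · obtain ⟨t, ht, rfl⟩ := List.mem_map.1 ha
      rw [sv, s₂ _ _ (b₂ t ht).1.not_vanish_right, r₁]
      exact ⟨hvu, sub_refl hd₁ hu₁, (b₂ t ht).2⟩
  · exact List.mem_append_left _ (List.mem_map.2 ⟨e, he, rfl⟩)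
  · intro j hj
    by_cases h : j ∈ H₁.coords
    · rw [glue_left _ _ j h, hei j h]
    · have : j ≠ i := fun hji => h (hji ▸ hi)
      simp [glue, h, this]

/-- Supports of vertices are built recursively by choosing one summand in an ℓ₁-sum and both in an
ℓ_∞-sum; the signs on the support are free. -/
theorem exists_vtx {H : HannerRep n} (hd : H.IsDirect) {τ : Fin n → SignType} (hτ : ∀ j, τ j ≠ 0)
    {i : Fin n} (hi : i ∈ H.coords) :
    ∃ w, H.Vtx w ∧ w i = τ i ∧ ∀ j, w j = 0 ∨ w j = τ j := by
  induction H generalizing i with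
  | interval k =>
    simp only [coords, Finset.mem_singleton] at hi
    subst hi
    exact ⟨τ, hτ i, rfl, fun _ => Or.inr rfl⟩
  | sumOne H₁ H₂ h₁ h₂ =>
    simp only [coords, Finset.mem_union] at hi
    rcases hi with hi | hi
    · obtain ⟨w, hw, hwi, hc⟩ := h₁ hd.1 hi
      refine ⟨glue H₁.coords w 0, Or.inl ⟨(vtx_congr_eq _ (glue_left w 0)).2 hw,
        (vanish_congr _ (glue_right hd.2.2 w 0)).2 fun _ _ => rfl⟩,
        (glue_left w 0 i hi).trans hwi, fun j => ?_⟩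
      simp only [glue]; split_ifs
      · exact hc j
      · exact Or.inl rfl
    · obtain ⟨w, hw, hwi, hc⟩ := h₂ hd.2.1 hi
      refine ⟨glue H₁.coords 0 w, Or.inr ⟨(vanish_congr _ (glue_left 0 w)).2 fun _ _ => rfl,
        (vtx_congr_eq _ (glue_right hd.2.2 0 w)).2 hw⟩,
        (glue_right hd.2.2 0 w i hi).trans hwi, fun j => ?_⟩
      simp only [glue]; split_ifs
      · exact Or.inl rfl
      · exact hc j
  | sumInf H₁ H₂ h₁ h₂ =>
    have key : ∀ i₁ ∈ H₁.coords, ∀ i₂ ∈ H₂.coords, ∃ w, (sumInf H₁ H₂).Vtx w ∧ w i₁ = τ i₁ ∧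
        w i₂ = τ i₂ ∧ ∀ j, w j = 0 ∨ w j = τ j := fun i₁ hi₁ i₂ hi₂ => by
      obtain ⟨w₁, hw₁, e₁, c₁⟩ := h₁ hd.1 hi₁
      obtain ⟨w₂, hw₂, e₂, c₂⟩ := h₂ hd.2.1 hi₂
      refine ⟨glue H₁.coords w₁ w₂, ⟨(vtx_congr_eq _ (glue_left w₁ w₂)).2 hw₁,
        (vtx_congr_eq _ (glue_right hd.2.2 w₁ w₂)).2 hw₂⟩, (glue_left w₁ w₂ i₁ hi₁).trans e₁,
        (glue_right hd.2.2 w₁ w₂ i₂ hi₂).trans e₂, fun j => ?_⟩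
      simp only [glue]; split_ifs
      · exact c₁ j
      · exact c₂ j
    simp only [coords, Finset.mem_union] at hi
    rcases hi with hi | hi
    · obtain ⟨i₂, hi₂⟩ := H₂.coords_nonempty
      obtain ⟨w, hw, e, -, c⟩ := key i hi i₂ hi₂
      exact ⟨w, hw, e, c⟩
    · obtain ⟨i₁, hi₁⟩ := H₁.coords_nonempty
      obtain ⟨w, hw, -, e, c⟩ := key i₁ hi₁ i hi
      exact ⟨w, hw, e, c⟩

theorem exists_vtx_apply {H : HannerRep n} (hd : H.IsDirect) {i : Fin n} (hi : i ∈ H.coords)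
    {σ : SignType} (hσ : σ ≠ 0) : ∃ w, H.Vtx w ∧ w i = σ := by
  obtain ⟨w, hw, e, -⟩ := exists_vtx hd (τ := fun _ => σ) (fun _ => hσ) hi
  exact ⟨w, hw, e⟩

theorem hasChain_sumOne {H₁ H₂ : HannerRep n} (hd : (sumOne H₁ H₂).IsDirect)
    (h₁ : ∀ {i : Fin n} {v u : Fin n → SignType}, i ∈ H₁.coords → H₁.Vtx v → H₁.dual.Vtx u →
      v i ≠ 0 → v i = u i → H₁.HasChain i v u)
    (h₂ : ∀ {i : Fin n} {v u : Fin n → SignType}, i ∈ H₂.coords → H₂.Vtx v → H₂.dual.Vtx u →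
      v i ≠ 0 → v i = u i → H₂.HasChain i v u)
    {i : Fin n} {v u : Fin n → SignType} (hi : i ∈ (sumOne H₁ H₂).coords)
    (hv : (sumOne H₁ H₂).Vtx v) (hu : (sumOne H₁ H₂).dual.Vtx u) (hvi : v i ≠ 0)
    (hvu : v i = u i) : (sumOne H₁ H₂).HasChain i v u := by
  -- In the summand not containing v any chain below the facet u will do; it is started at some
  -- vertex sharing a nonzero coordinate with u.
  have aux : ∀ {H : HannerRep n}, H.IsDirect → H.dual.Vtx u →
      ∃ i ∈ H.coords, ∃ v, H.Vtx v ∧ v i ≠ 0 ∧ v i = u i := fun {H} hd hu => by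
    have := hu.not_vanish
    simp only [Vanish, coords_dual, not_forall] at this
    obtain ⟨j, hj, hne⟩ := this
    obtain ⟨w, hw, e⟩ := exists_vtx_apply hd hj hne
    exact ⟨j, hj, w, hw, e ▸ hne, e⟩
  simp only [coords, Finset.mem_union] at hi
  rcases hi with hi | hi
  · have hv' : H₁.Vtx v ∧ H₂.Vanish v := by
      rcases hv with h | h
      · exact h
      · exact absurd (h.1 i hi) hvi
    obtain ⟨j, hj, w, hw, hwj, e⟩ := aux hd.2.1 hu.2
    exact HasChain.combine hd.1 hd.2.2 rfl (fun s t hs => sub_sumOne hd hs) hi hv'.2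
      (h₁ hi hv'.1 hu.1 hvi hvu) (h₂ hj hw hu.2 hwj e)
  · have hv' : H₁.Vanish v ∧ H₂.Vtx v := by
      rcases hv with h | h
      · exact absurd (h.2 i hi) hvi
      · exact h
    obtain ⟨j, hj, w, hw, hwj, e⟩ := aux hd.1 hu.1
    exact HasChain.combine hd.2.1 hd.2.2.symm (Finset.union_comm _ _)
      (fun s t hs => (sub_sumOne hd hs).trans and_comm) hi hv'.1
      (h₂ hi hv'.2 hu.2 hvi hvu) (h₁ hj hw hu.1 hwj e)

theorem hasChain {H : HannerRep n} (hd : H.IsDirect) {i : Fin n} {v u : Fin n → SignType}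
    (hi : i ∈ H.coords) (hv : H.Vtx v) (hu : H.dual.Vtx u) (hvi : v i ≠ 0) (hvu : v i = u i) :
    H.HasChain i v u := by
  induction H generalizing i v u with
  | interval k =>
    simp only [coords, Finset.mem_singleton] at hi
    subst hi
    have e : (interval i).Sub v v := sub_refl hd hv.not_vanish
    refine ⟨[v], by simp [coords], by simp, ?_, v, by simp, by simp [coords]⟩
    simp only [List.mem_singleton, forall_eq]
    exact ⟨e, (sub_congr _ (fun _ _ => rfl) (by simp [coords, hvu])).1 e⟩
  | sumOne H₁ H₂ h₁ h₂ => exact hasChain_sumOne hd (h₁ hd.1) (h₂ hd.2.1) hi hv hu hvi hvu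
  | sumInf H₁ H₂ h₁ h₂ =>
    -- The dual of an ℓ_∞-sum is an ℓ₁-sum, with v and u exchanged and the chain reversed.
    have := hasChain_sumOne (H₁ := H₁.dual) (H₂ := H₂.dual) (i := i) (v := u) (u := v) hd.dual
      (fun hi hv hu hvi hvu => (h₁ hd.1 (by simpa using hi) (by simpa using hu) hv
        (hvu ▸ hvi) hvu.symm).dual hvu.symm)
      (fun hi hv hu hvi hvu => (h₂ hd.2.1 (by simpa using hi) (by simpa using hu) hv
        (hvu ▸ hvi) hvu.symm).dual hvu.symm)
      (by simpa [coords] using hi) hu (by simpa [HannerRep.dual] using hv) (hvu ▸ hvi) hvu.symm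
    simpa [HannerRep.dual] using this.dual hvu.symm

theorem eq_of_strictMono {g : Fin n → ℕ} (hg : StrictMono g) (hn : ∀ k, g k < n) (k : Fin n) :
    g k = k := by
  let g' : Fin n → Fin n := fun k => ⟨g k, hn k⟩
  have hg' : StrictMono g' := fun a b h => hg h
  have hsurj := Finite.surjective_of_injective hg'.injective
  have : g' = id := (hg'.range_inj strictMono_id).1 (by rw [hsurj.range_eq, Set.range_id])
  exact congrArg Fin.val (congrFun this k)

/-- The dimensions need not be computed: n strictly increasing numbers below n can only be 0, …, n −
1. -/
theorem IsStandard.mem_flags {H : HannerRep n} (hH : H.IsStandard) {f : Fin n → Set (E n)}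
    (hf : ∀ k, IsFace H.body (f k)) (hmono : StrictMono f) : f ∈ flags H.body := by
  choose s hs hfs using fun k => hH.isFace_iff.1 (hf k)
  refine ⟨fun k => ⟨hf k, ?_⟩, hmono.monotone⟩
  refine eq_of_strictMono (g := fun k => dim (f k)) (fun a b hab => ?_) (fun k => ?_) k
  · have := hmono hab
    rw [hfs a, hfs b] at this
    simpa only [hfs] using faceSet_ssubset_dim_lt hH.1 (hs a) this
  · simp only [hfs]
    exact (dim_faceSet_lt hH.1 (hs k)).trans_le ((Submodule.finrank_le _).trans (by simp))

/-- The code `Pi.single i (v i)` belongs to the face {x_i = v_i} of H. Passing through it is what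
pins the i-th coordinate of the flag's normal. -/
theorem IsStandard.exists_flag {H : HannerRep n} (hH : H.IsStandard) {i : Fin n}
    {v u : Fin n → SignType} (hv : H.Vtx v) (hu : H.dual.Vtx u) (hvi : v i ≠ 0)
    (hvu : v i = u i) :
    ∃ f ∈ flags H.body, (∀ k, H.faceSet v ⊆ f k) ∧ (∀ k, f k ⊆ H.faceSet u) ∧
      ∃ k, f k = H.faceSet (Pi.single i (v i)) := by
  have hi : i ∈ H.coords := by simp [hH.2]
  obtain ⟨L, hlen, hpw, hb, e, he, hei⟩ := hasChain hH.1 hi hv hu hvi hvu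
  rw [hH.2, Finset.card_univ, Fintype.card_fin] at hlen
  let g : Fin n → (Fin n → SignType) := fun k => L.get (k.cast hlen.symm)
  have hgm : ∀ k, g k ∈ L := fun k => L.get_mem _
  have hgv : ∀ k, ¬ H.Vanish (g k) := fun k => (hb _ (hgm k)).1.not_vanish_right
  have hss : StrictMono fun k => H.faceSet (g k) := by
    intro a b hab
    have := List.pairwise_iff_get.1 hpw (a.cast hlen.symm) (b.cast hlen.symm) (by simpa using hab)
    rw [sub_iff hH.1 (hgv a) (hgv b), sub_iff hH.1 (hgv b) (hgv a)] at this
    exact this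
  refine ⟨fun k => H.faceSet (g k), hH.mem_flags (fun k => hH.isFace_faceSet (hgv k)) hss,
    fun k => ?_, fun k => ?_, ?_⟩
  · exact (sub_iff hH.1 hv.not_vanish (hgv k)).1 (hb _ (hgm k)).1
  · exact (sub_iff hH.1 (hgv k) (by simpa using hu.not_vanish)).1 (hb _ (hgm k)).2
  · obtain ⟨k, hk⟩ := List.get_of_mem he
    have e1 : e = Pi.single i (v i) := by
      ext1 j
      rw [hei j (by simp [hH.2])]
      by_cases hj : j = i
      · subst hj; simp
      · simp [hj]
    refine ⟨k.cast hlen, ?_⟩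
    simp only [g]
    rw [← e1, ← hk]
    rfl

/-- Any two coordinates occur together in the support of a vertex or of a facet. -/
def Adjacent (H : HannerRep n) (i j : Fin n) : Prop :=
  ∀ τ : Fin n → SignType, (∀ k, τ k ≠ 0) →
    ∃ w, H.Vtx w ∧ w i = τ i ∧ w j = τ j ∧ ∀ k, w k = 0 ∨ w k = τ k

/-- A facet of an ℓ₁-sum combines facets of both summands, so coordinates from different summands
meet in facets. Coordinates from the same summand inherit the alternative, by extending a vertex by
zero or a facet by an arbitrary facet. -/
theorem adjacent_sumOne {H₁ H₂ : HannerRep n} (hd : (sumOne H₁ H₂).IsDirect)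
    (h₁ : ∀ {i j : Fin n}, i ≠ j → i ∈ H₁.coords → j ∈ H₁.coords →
      H₁.Adjacent i j ∨ H₁.dual.Adjacent i j)
    (h₂ : ∀ {i j : Fin n}, i ≠ j → i ∈ H₂.coords → j ∈ H₂.coords →
      H₂.Adjacent i j ∨ H₂.dual.Adjacent i j)
    {i j : Fin n} (hij : i ≠ j) (hi : i ∈ (sumOne H₁ H₂).coords)
    (hj : j ∈ (sumOne H₁ H₂).coords) :
    (sumOne H₁ H₂).Adjacent i j ∨ (sumOne H₁ H₂).dual.Adjacent i j := by
  have hdis := hd.2.2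
  have hglue : ∀ {τ w₁ w₂ : Fin n → SignType}, (∀ k, w₁ k = 0 ∨ w₁ k = τ k) →
      (∀ k, w₂ k = 0 ∨ w₂ k = τ k) → ∀ k, glue H₁.coords w₁ w₂ k = 0 ∨
      glue H₁.coords w₁ w₂ k = τ k := fun c₁ c₂ k => by
    simp only [glue]; split_ifs
    · exact c₁ k
    · exact c₂ k
  have hfacet : ∀ {w₁ w₂ : Fin n → SignType}, H₁.dual.Vtx w₁ → H₂.dual.Vtx w₂ →
      (sumOne H₁ H₂).dual.Vtx (glue H₁.coords w₁ w₂) := fun {w₁ w₂} hw₁ hw₂ =>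
    ⟨(vtx_congr_eq _ (by simpa using glue_left w₁ w₂)).2 hw₁,
      (vtx_congr_eq _ (by simpa using glue_right hdis w₁ w₂)).2 hw₂⟩
  have mixed : ∀ {i j : Fin n} {τ : Fin n → SignType}, (∀ k, τ k ≠ 0) → i ∈ H₁.coords →
      j ∈ H₂.coords → ∃ w, (sumOne H₁ H₂).dual.Vtx w ∧ w i = τ i ∧ w j = τ j ∧
      ∀ k, w k = 0 ∨ w k = τ k := fun {i j τ} hτ hi hj => by
    obtain ⟨w₁, hw₁, e₁, c₁⟩ := exists_vtx hd.1.dual hτ (by simpa using hi)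
    obtain ⟨w₂, hw₂, e₂, c₂⟩ := exists_vtx hd.2.1.dual hτ (by simpa using hj)
    exact ⟨_, hfacet hw₁ hw₂, (glue_left w₁ w₂ i hi).trans e₁,
      (glue_right hdis w₁ w₂ j hj).trans e₂, hglue c₁ c₂⟩
  simp only [coords, Finset.mem_union] at hi hj
  rcases hi with hi | hi <;> rcases hj with hj | hj
  · refine (h₁ hij hi hj).imp (fun h τ hτ => ?_) fun h τ hτ => ?_
    · obtain ⟨w, hw, e, e', c⟩ := h τ hτ
      exact ⟨glue H₁.coords w 0, Or.inl ⟨(vtx_congr_eq _ (glue_left w 0)).2 hw,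
        (vanish_congr _ (glue_right hdis w 0)).2 fun _ _ => rfl⟩,
        (glue_left w 0 i hi).trans e, (glue_left w 0 j hj).trans e',
        hglue c fun _ => Or.inl rfl⟩
    · obtain ⟨w, hw, e, e', c⟩ := h τ hτ
      obtain ⟨k, hk⟩ := H₂.dual.coords_nonempty
      obtain ⟨w₂, hw₂, -, c₂⟩ := exists_vtx hd.2.1.dual hτ hk
      exact ⟨_, hfacet hw hw₂, (glue_left w w₂ i hi).trans e, (glue_left w w₂ j hj).trans e',
        hglue c c₂⟩
  · exact Or.inr fun τ hτ => mixed hτ hi hj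
  · refine Or.inr fun τ hτ => ?_
    obtain ⟨w, hw, e, e', c⟩ := mixed hτ hj hi
    exact ⟨w, hw, e', e, c⟩
  · refine (h₂ hij hi hj).imp (fun h τ hτ => ?_) fun h τ hτ => ?_
    · obtain ⟨w, hw, e, e', c⟩ := h τ hτ
      exact ⟨glue H₁.coords 0 w, Or.inr ⟨(vanish_congr _ (glue_left 0 w)).2 fun _ _ => rfl,
        (vtx_congr_eq _ (glue_right hdis 0 w)).2 hw⟩,
        (glue_right hdis 0 w i hi).trans e, (glue_right hdis 0 w j hj).trans e',
        hglue (fun _ => Or.inl rfl) c⟩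
    · obtain ⟨w, hw, e, e', c⟩ := h τ hτ
      obtain ⟨k, hk⟩ := H₁.dual.coords_nonempty
      obtain ⟨w₁, hw₁, -, c₁⟩ := exists_vtx hd.1.dual hτ hk
      exact ⟨_, hfacet hw₁ hw, (glue_right hdis w₁ w i hi).trans e,
        (glue_right hdis w₁ w j hj).trans e', hglue c₁ c⟩

/-- The alternative is symmetric in H and its dual, so the ℓ_∞ case is the ℓ₁ case for the dual. -/
theorem adjacent_or_adjacent {H : HannerRep n} (hd : H.IsDirect) {i j : Fin n} (hij : i ≠ j)
    (hi : i ∈ H.coords) (hj : j ∈ H.coords) : H.Adjacent i j ∨ H.dual.Adjacent i j := by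
  induction H generalizing i j with
  | interval k =>
    simp only [coords, Finset.mem_singleton] at hi hj
    exact absurd (hi.trans hj.symm) hij
  | sumOne H₁ H₂ h₁ h₂ => exact adjacent_sumOne hd (h₁ hd.1) (h₂ hd.2.1) hij hi hj
  | sumInf H₁ H₂ h₁ h₂ =>
    have := adjacent_sumOne (H₁ := H₁.dual) (H₂ := H₂.dual) hd.dual
      (fun hij hi hj => by
        simpa using (h₁ hd.1 hij (by simpa using hi) (by simpa using hj)).symm)
      (fun hij hi hj => by
        simpa using (h₂ hd.2.1 hij (by simpa using hi) (by simpa using hj)).symm)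
      hij (by simpa [coords] using hi) (by simpa [coords] using hj)
    simpa [HannerRep.dual] using this.symm

end HannerRep

end HannerMahler

end

/-! ### V(X) as a sum over strictly monotone chains, and the volume gain. -/

noncomputable section

namespace HannerMahler

namespace HannerRep

variable {n : ℕ}

theorem strictMono_of_mem_flags {P : Set (E n)} {f : Fin n → Set (E n)} (hf : f ∈ flags P) :
    StrictMono f := hf.2.strictMono_of_injective fun a b hab => by
  have := (hf.1 a).2
  rw [hab, (hf.1 b).2] at this
  exact Fin.ext this.symm

theorem IsStandard.finite_faces {H : HannerRep n} (hH : H.IsStandard) :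
    {F | IsFace H.body F}.Finite := by
  refine (Set.finite_range H.faceSet).subset fun F hF => ?_
  obtain ⟨s, -, rfl⟩ := hH.isFace_iff.1 hF
  exact ⟨s, rfl⟩

/-- The poset of faces. -/
abbrev Face (H : HannerRep n) : Type := {F : Set (E n) // IsFace H.body F}

/-- The touching points p_F and the dual relative interior points satisfy the incidence relation
required by `exists_spread`, and the tangency points are small perturbations of the p_F, uniformly
over the finitely many faces. The constant κ is independent of the accuracy ω. -/
theorem IsStandard.exists_spread_points {H : HannerRep n} (hH : H.IsStandard) [Fintype H.Face] :
    ∃ κ : ℝ, 0 < κ ∧ ∀ ω : ℝ, 0 < ω → ∃ ε₀ : ℝ, 0 < ε₀ ∧ ∀ ε, 0 ≤ ε → ε ≤ ε₀ → ∀ K,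
      H.Near ε K → Spread κ (fun F : H.Face => H.points K F) ∧
      (∀ F : H.Face, H.points K F ∈ K) ∧
      ∀ (F : H.Face) (u : Fin n → SignType), H.dual.Vtx u → (F : Set (E n)) ⊆ H.faceSet u →
        |1 - inner ℝ (H.dual.pt u) (H.points K F)| ≤ ω := by
  choose s hs hFs using fun F : H.Face => hH.isFace_iff.1 F.2
  choose p q hA using fun F : H.Face => exists_touchesAt_affSub hH.1 (hs F)
  have hpq : ∀ F u, inner ℝ (p F) (H.dual.pt u) = H.pair (p F) (H.dual.pt u) := fun F u =>
    (hH.pair_eq_inner _ _).symm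
  obtain ⟨κ, hκ, ε₁, hε₁, hspread⟩ := exists_spread (P := p) (Q := fun F => H.dual.pt (s F))
    (fun F G => by rw [hpq]; exact (hA F).relInt.pair_le_one hH.1 (H.dual.relInt_pt _))
    (fun F G => by
      rw [hpq, (hA F).relInt.pair_eq_one_iff hH.1 (H.dual.relInt_pt _) (hs F) (hs G), ← hFs,
        ← hFs]
      rfl)
  refine ⟨κ, hκ, fun ω hω => ?_⟩
  let ω' : ℝ := min ε₁ (ω / (n + 1))
  have hω' : 0 < ω' := by positivity
  choose ε hε hclose using fun F : H.Face => (hA F).exists_tangency_close hH hω'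
  obtain ⟨ε₀, hε₀, hle⟩ : ∃ ε₀ : ℝ, 0 < ε₀ ∧ ∀ F, ε₀ ≤ ε F := by
    rcases isEmpty_or_nonempty H.Face with h | h
    · exact ⟨1, one_pos, fun F => h.elim F⟩
    · obtain ⟨F, hF⟩ := Finite.exists_min ε
      exact ⟨ε F, hε F, hF⟩
  refine ⟨ε₀, hε₀, fun e he hee K hK => ?_⟩
  have hspec : ∀ F : H.Face, IsTangencyPoint (H.affSub F) (centroid F) K (H.points K F) :=
    fun F => (hFs F ▸ hA F : H.TouchesAt (s F) (H.affSub F) (p F) (q F)).tangencyPoint_spec hK _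
  have hd : ∀ F : H.Face, ‖H.points K F - p F‖ ≤ ω' := fun F =>
    hclose F e he (hee.trans (hle F)) K hK (centroid F) _ (hFs F ▸ hspec F)
  refine ⟨hspread _ fun F => (hd F).trans (min_le_left _ _),
    fun F => mem_of_isTangencyPoint hK.isCompact (hspec F), fun F u hu hFu => ?_⟩
  have h1 : inner ℝ (p F) (H.dual.pt u) = (1 : ℝ) := by
    rw [hpq, (hA F).relInt.pair_eq_one_iff hH.1 (H.dual.relInt_pt _) (hs F)
      (by simpa using hu.not_vanish), ← hFs]
    exact hFu
  have h2 : ‖H.dual.pt u‖ ≤ n := norm_le_of_mem_cube fun j => by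
    rw [(H.dual.relInt_pt u).apply_of_vtx hH.1.dual hu (by simp [hH.2])]
    cases u j <;> simp
  rw [← h1, real_inner_comm (H.dual.pt u) (p F), ← inner_sub_right]
  refine (abs_real_inner_le_norm _ _).trans ?_
  rw [norm_sub_rev]
  calc ‖H.dual.pt u‖ * ‖H.points K F - p F‖ ≤ (n + 1) * (ω / (n + 1)) := by
        gcongr
        · linarith
        · exact (hd F).trans (min_le_right _ _)
    _ = ω := by field_simp

theorem volFun_eq_sum (H : HannerRep n) [Fintype H.Face] (Z : Set (E n) → E n) :
    ∃ S : Finset (Fin n → H.Face), (∀ f, f ∈ S ↔ (fun k => (f k : Set (E n))) ∈ flags H.body) ∧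
      volFun H.body Z = ∑ f ∈ S, volume (simplex ((fun F : H.Face => Z F) ∘ f)) := by
  classical
  let e : flags H.body ↪ (Fin n → H.Face) :=
    ⟨fun f k => ⟨f.1 k, (f.2.1 k).1⟩, fun f g h => Subtype.ext <| funext fun k =>
      congrArg Subtype.val (congrFun h k)⟩
  have : Finite (flags H.body) := Finite.of_injective e e.injective
  have := Fintype.ofFinite (flags H.body)
  refine ⟨Finset.univ.map e, fun f => ?_, ?_⟩
  · simp only [Finset.mem_map, Finset.mem_univ, true_and]
    constructor
    · rintro ⟨g, rfl⟩; exact g.2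
    · exact fun h => ⟨⟨_, h⟩, rfl⟩
  · rw [Finset.sum_map, volFun, tsum_fintype]
    rfl

/-- Collects all that is needed on one side of the duality. The facet normal u pairs to 1 with p_F
for every face F in the flag, hence almost to 1 with x_F, so the normal ν of the flag is close to u.
-/
theorem IsStandard.exists_gain {H : HannerRep n} (hH : H.IsStandard) (hn : 0 < n) :
    ∃ c : ℝ, 0 < c ∧ ∀ ω : ℝ, 0 < ω → ∃ ε₀ : ℝ, 0 < ε₀ ∧ ∀ ε, 0 ≤ ε → ε ≤ ε₀ → ∀ K,
      H.Near ε K → ∀ f ∈ flags H.body, ENNReal.ofReal c ≤ volFun H.body (H.points K) ∧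
      ∃ ν : E n, (∀ k, inner ℝ ν (H.points K (f k)) = (1 : ℝ)) ∧
        (∀ u, H.dual.Vtx u → (∀ k, f k ⊆ H.faceSet u) → ∀ j, |ν j - u j| ≤ ω) ∧
        ∀ y ∈ K, ∀ ρ : ℝ, 0 ≤ ρ → 1 + ρ ≤ inner ℝ ν y →
          volFun H.body (H.points K) + ENNReal.ofReal (c * ρ) ≤ volume K := by
  have : Finite H.Face := hH.finite_faces.to_subtype
  have := Fintype.ofFinite H.Face
  have hn' : (0 : ℝ) < n := Nat.cast_pos.2 hn
  obtain ⟨κ, hκ, hsp⟩ := hH.exists_spread_points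
  have hfin : volume (Metric.ball (0 : E n) (κ / (2 * n))) ≠ ⊤ := measure_ball_lt_top.ne
  let b : ℝ := (volume (Metric.ball (0 : E n) (κ / (2 * n)))).toReal
  have hb : 0 < b := ENNReal.toReal_pos (Metric.measure_ball_pos _ _ (by positivity)).ne' hfin
  have hbv : ENNReal.ofReal b = volume (Metric.ball (0 : E n) (κ / (2 * n))) :=
    ENNReal.ofReal_toReal hfin
  -- This is the constant of `Spread.sum_volume_add_le` with R = n, a bound for the norm on the
  -- cube.
  let a : ℝ := 1 / (2 * (1 + n * (n / κ)))
  have ha : 0 < a := by positivity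
  refine ⟨min b (a * b), by positivity, fun ω hω => ?_⟩
  obtain ⟨ε₀, hε₀, hK⟩ := hsp (ω * κ) (by positivity)
  refine ⟨ε₀, hε₀, fun ε hε hεε K hN f hf => ?_⟩
  obtain ⟨hS, hmem, hclose⟩ := hK ε hε hεε K hN
  obtain ⟨S, hSf, hV⟩ := H.volFun_eq_sum (H.points K)
  have hSm : ∀ g ∈ S, StrictMono g := fun g hg => strictMono_of_mem_flags ((hSf g).1 hg)
  let f' : Fin n → H.Face := fun k => ⟨f k, (hf.1 k).1⟩
  have hf' : f' ∈ S := (hSf f').2 hf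
  have hbf : ENNReal.ofReal b ≤ volume (simplex ((fun F : H.Face => H.points K F) ∘ f')) :=
    hbv ▸ hS.le_volume_simplex hκ (hSm f' hf') hn
  obtain ⟨ν, hν⟩ := hS.exists_normal hκ (hSm f' hf')
  refine ⟨?_, ν, hν, fun u hu hfu j => ?_, fun y hy ρ hρ hyρ => ?_⟩
  · rw [hV]
    refine (ENNReal.ofReal_le_ofReal (min_le_left _ _)).trans (hbf.trans ?_)
    exact Finset.single_le_sum (f := fun g => volume (simplex ((fun F : H.Face => H.points K F) ∘ g)))
      (fun _ _ => zero_le) hf'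
  · have h1 := hS.norm_sub_le hκ (hSm f' hf') hν (w := H.dual.pt u) (ε := ω * κ) (by positivity)
      fun k => hclose (f' k) u hu (hfu k)
    rw [mul_div_cancel_right₀ _ hκ.ne'] at h1
    rw [← (H.dual.relInt_pt u).apply_of_vtx hH.1.dual hu (j := j) (by simp [hH.2])]
    exact (abs_apply_le_norm (ν - H.dual.pt u) j).trans h1
  · rw [hV]
    refine le_trans ?_ (hS.sum_volume_add_le hκ hn hN.convex hN.isCompact.measurableSet hN.zero_mem
      hmem (fun x hx => norm_le_of_mem_cube (hN.subset_cube hx)) (hSm f' hf') hν hy hyρ S hSm)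
    gcongr
    refine le_trans ?_ (mul_le_mul_right hbf _)
    rw [← ENNReal.ofReal_mul (by positivity)]
    refine ENNReal.ofReal_le_ofReal ?_
    calc min b (a * b) * ρ ≤ a * b * ρ := by gcongr; exact min_le_right _ _
      _ = _ := by simp only [a]; ring

theorem IsStandard.dualFace_ssubset {H : HannerRep n} (hH : H.IsStandard) {F G : Set (E n)}
    (hF : IsFace H.body F) (hG : IsFace H.body G) (h : F ⊂ G) :
    dualFace H.body G ⊂ dualFace H.body F := by
  obtain ⟨s, hs, rfl⟩ := hH.isFace_iff.1 hF
  obtain ⟨t, ht, rfl⟩ := hH.isFace_iff.1 hG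
  have hs' : ¬ H.dual.Vanish s := by simpa using hs
  have ht' : ¬ H.dual.Vanish t := by simpa using ht
  rw [hH.dualFace_faceSet hs, hH.dualFace_faceSet ht, ssubset_iff_subset_not_subset,
    ← sub_iff hH.1.dual ht' hs', ← sub_iff hH.1.dual hs' ht', sub_dual, sub_dual,
    sub_iff hH.1 hs ht, sub_iff hH.1 ht hs]
  exact h

theorem IsStandard.dualFace_injOn {H : HannerRep n} (hH : H.IsStandard) :
    Set.InjOn (dualFace H.body) {F | IsFace H.body F} := by
  intro F hF G hG h
  obtain ⟨s, hs, rfl⟩ := hH.isFace_iff.1 hF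
  obtain ⟨t, ht, rfl⟩ := hH.isFace_iff.1 hG
  have hs' : ¬ H.dual.Vanish s := by simpa using hs
  have ht' : ¬ H.dual.Vanish t := by simpa using ht
  rw [hH.dualFace_faceSet hs, hH.dualFace_faceSet ht] at h
  refine Set.Subset.antisymm ?_ ?_
  · rw [← sub_iff hH.1 hs ht, ← sub_dual, sub_iff hH.1.dual ht' hs', h]
  · rw [← sub_iff hH.1 ht hs, ← sub_dual, sub_iff hH.1.dual hs' ht', h]

/-- Passing to dual faces and reversing the order maps flags of H injectively to flags of H°, and
the corresponding simplices have the same vertices. Only this inequality is needed. -/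
theorem IsStandard.volFun_dualPoints_le {H : HannerRep n} (hH : H.IsStandard) (K : Set (E n)) :
    volFun H.body (H.dualPoints K) ≤ volFun H.dual.body (H.dual.points (polarBody K)) := by
  have hmem : ∀ f ∈ flags H.body, (fun k : Fin n => dualFace H.body (f k.rev)) ∈
      flags H.dual.body := fun f hf => by
    refine hH.dual.mem_flags (fun k => ?_) fun a b hab => ?_
    · obtain ⟨s, hs, e⟩ := hH.isFace_iff.1 (hf.1 k.rev).1
      rw [e, hH.dualFace_faceSet hs]
      exact hH.dual.isFace_faceSet (by simpa using hs)
    · exact hH.dualFace_ssubset (hf.1 _).1 (hf.1 _).1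
        (strictMono_of_mem_flags hf (Fin.rev_lt_rev.2 hab))
  let e : flags H.body → flags H.dual.body := fun f => ⟨_, hmem f.1 f.2⟩
  have he : Function.Injective e := fun f g h => Subtype.ext <| funext fun k => by
    have := congrFun (congrArg Subtype.val h) k.rev
    simp only [e, Fin.rev_rev] at this
    exact hH.dualFace_injOn (f.2.1 k).1 (g.2.1 k).1 this
  refine le_trans (le_of_eq (tsum_congr fun f => ?_)) (ENNReal.tsum_comp_le_tsum_of_injective he _)
  congr 3
  exact (Fin.rev_surjective.range_comp fun k => H.dualPoints K (f.1 k)).symm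

end HannerRep

end HannerMahler

end

/-! ### From almost supporting normals to the vertices of the cube. -/

noncomputable section

namespace HannerMahler

variable {n : ℕ}

/-! ### Sign patterns -/

theorem le_sign_mul {τ w : SignType} {m ω : ℝ} (hτ : τ ≠ 0) (hw : w = τ) (h : |m - w| ≤ ω) :
    1 - ω ≤ τ * m := by
  subst hw
  rw [abs_le] at h
  cases w
  · exact absurd rfl hτ
  · simp at h ⊢; linarith
  · simp at h ⊢; linarith

theorem neg_le_sign_mul {τ w : SignType} {m ω : ℝ} (hτ : τ ≠ 0)
    (hw : w = 0 ∨ w = τ) (h : |m - w| ≤ ω) : -ω ≤ τ * m := by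
  rcases hw with rfl | hw
  · rw [abs_le] at h
    cases τ <;> simp at h ⊢ <;> linarith
  · linarith [le_sign_mul hτ hw h]

/-- A nonzero sign of a real number. -/
def sgn (a : ℝ) : SignType := if 0 ≤ a then 1 else -1

theorem sgn_ne_zero (a : ℝ) : sgn a ≠ 0 := by unfold sgn; split_ifs <;> decide

theorem abs_mul_sgn (a : ℝ) : |a| * sgn a = a := by
  unfold sgn
  split_ifs with h
  · simp [abs_of_nonneg h]
  · simp [abs_of_neg (not_le.1 h)]

/-- Take j with the largest |a_j|. It contributes at least (1 − ω)|a_j| and the others together lose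
at most nω|a_j|, and (n + 1)ω ≤ 1/2. -/
theorem exists_forall_half_abs_le_sum {S : Finset (Fin n)} (hS : S.Nonempty) (a : Fin n → ℝ)
    {ω : ℝ} (hω : 0 ≤ ω) (hωn : (n + 1) * ω ≤ 1 / 2) :
    ∃ j ∈ S, (∀ k ∈ S, |a k| ≤ |a j|) ∧ ∀ m : Fin n → ℝ, 1 - ω ≤ sgn (a j) * m j →
      (∀ k ∈ S, -ω ≤ sgn (a k) * m k) → |a j| / 2 ≤ ∑ k ∈ S, a k * m k := by
  obtain ⟨j, hj, hmax⟩ := S.exists_max_image (fun k => |a k|) hS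
  refine ⟨j, hj, hmax, fun m hm hmk => ?_⟩
  have key : ∀ k, a k * m k = |a k| * (sgn (a k) * m k) := fun k => by
    rw [← mul_assoc, abs_mul_sgn]
  have h1 : -(n * (ω * |a j|)) ≤ ∑ k ∈ S.erase j, a k * m k := by
    have : ∑ k ∈ S.erase j, -(ω * |a j|) ≤ ∑ k ∈ S.erase j, a k * m k := by
      refine Finset.sum_le_sum fun k hk => ?_
      have hkS := Finset.mem_of_mem_erase hk
      rw [key]
      have h2 := mul_le_mul_of_nonneg_left (hmk k hkS) (abs_nonneg (a k))
      have h3 := mul_le_mul_of_nonneg_left (hmax k hkS) hω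
      linarith
    refine le_trans ?_ this
    rw [Finset.sum_const, nsmul_eq_mul, mul_neg, neg_le_neg_iff]
    gcongr
    exact_mod_cast (Finset.card_le_univ _).trans_eq (Fintype.card_fin n)
  rw [← Finset.add_sum_erase S _ hj, key j]
  have h2 := mul_le_mul_of_nonneg_left hm (abs_nonneg (a j))
  have h3 := mul_le_mul_of_nonneg_left hωn (abs_nonneg (a j))
  linarith

/-- Separation: otherwise a linear functional in the coordinates of B is positive on all chosen
points. For τ opposite to the signs of its coefficients and j the index of the largest one, the
functional is nonpositive at the corresponding point, by the previous lemma. -/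
theorem exists_mem_forall_eq_zero {C : Set (E n)} (hC : Convex ℝ C) (hne : C.Nonempty)
    {B : Finset (Fin n)} {ω : ℝ} (hω : 0 ≤ ω) (hωn : (n + 1) * ω ≤ 1 / 2)
    (h : ∀ τ : Fin n → SignType, (∀ k, τ k ≠ 0) → ∀ j ∈ B, ∃ ν ∈ C, 1 - ω ≤ τ j * ν j ∧
      ∀ k ∈ B, -ω ≤ τ k * ν k) : ∃ N ∈ C, ∀ j ∈ B, N j = 0 := by
  rcases B.eq_empty_or_nonempty with rfl | hB
  · exact ⟨hne.some, hne.some_mem, by simp⟩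
  have h' : ∀ i : (Fin n → SignType) × Fin n, ∃ ν ∈ C, (∀ k, i.1 k ≠ 0) → i.2 ∈ B →
      1 - ω ≤ i.1 i.2 * ν i.2 ∧ ∀ k ∈ B, -ω ≤ i.1 k * ν k := fun ⟨τ, j⟩ => by
    by_cases hτ : (∀ k, τ k ≠ 0) ∧ j ∈ B
    · obtain ⟨ν, hν, h1⟩ := h τ hτ.1 j hτ.2
      exact ⟨ν, hν, fun _ _ => h1⟩
    · obtain ⟨ν, hν⟩ := hne
      exact ⟨ν, hν, fun h1 h2 => absurd ⟨h1, h2⟩ hτ⟩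
  choose g hgC hg using h'
  -- C need not be closed; the hull of the finitely many points `g (τ, j)` is compact, so its
  -- projection can be separated strictly from 0.
  have hT : convexHull ℝ (Set.range g) ⊆ C := convexHull_min (Set.range_subset_iff.2 hgC) hC
  have hTc : IsCompact (convexHull ℝ (Set.range g)) := (Set.finite_range g).isCompact_convexHull ℝ
  have hRc : IsCompact (restr B '' convexHull ℝ (Set.range g)) :=
    hTc.image (restr B).continuous_of_finiteDimensional
  have hRv : Convex ℝ (restr B '' convexHull ℝ (Set.range g)) :=
    (convex_convexHull ℝ _).linear_image _
  by_cases h0 : (0 : E n) ∈ restr B '' convexHull ℝ (Set.range g)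
  · obtain ⟨N, hN, hN0⟩ := h0
    refine ⟨N, hT hN, fun j hj => ?_⟩
    have := congrArg (fun x : E n => x j) hN0
    simpa [hj] using this
  · exfalso
    obtain ⟨φ, c, hc0, hc⟩ := geometric_hahn_banach_point_closed hRv hRc.isClosed h0
    rw [map_zero] at hc0
    have hφ : ∀ x : E n, φ (restr B x) = ∑ k ∈ B, φ (stdVec k) * x k := fun x => by
      rw [HannerRep.mem_span_single (S := B) (x := restr B x) fun i hi => by simp [hi], map_sum]
      refine Finset.sum_congr rfl fun k hk => ?_
      simp [hk, mul_comm]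
    have hpos : ∀ i, 0 < φ (restr B (g i)) := fun i =>
      hc0.trans (hc _ ⟨_, subset_convexHull ℝ _ ⟨i, rfl⟩, rfl⟩)
    obtain ⟨j, hj, -, hsum⟩ := exists_forall_half_abs_le_sum hB (fun k => -φ (stdVec k)) hω hωn
    let τ : Fin n → SignType := fun k => sgn (-φ (stdVec k))
    obtain ⟨h1, h2⟩ := hg (τ, j) (fun k => sgn_ne_zero _) hj
    have h3 := hsum (g (τ, j)) h1 h2
    have h4 := hpos (τ, j)
    rw [hφ] at h4
    simp only [neg_mul, Finset.sum_neg_distrib] at h3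
    linarith [abs_nonneg (-φ (stdVec j))]

namespace HannerRep

/-- The rigidity argument. All conditions on ν are affine equations or half-spaces, so they pass to
convex combinations. Of the coordinates other than i, those meeting i in facets are cancelled by
such a combination N, and the remaining ones are bounded by testing N against elements of ℳ. -/
theorem abs_sub_le_of_normals {H : HannerRep n} (hH : H.IsStandard) {i : Fin n} {σ : SignType}
    (hσ : σ ≠ 0) {x : E n} (hx : ∀ j, |x j| ≤ 1) {r ω : ℝ} (hr : 0 ≤ r) (hω : 0 ≤ ω)
    (hωn : (n + 1) * ω ≤ 1 / 2) {𝒩 ℳ : Set (E n)}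
    (h₁ : ∀ u, H.dual.Vtx u → u i = σ → ∃ ν ∈ 𝒩, ν i = σ ∧ inner ℝ ν x = (1 : ℝ) ∧
      ∀ j, |ν j - u j| ≤ ω)
    (h₂ : ∀ w, H.Vtx w → w i = σ → ∃ μ ∈ ℳ, μ i = σ ∧ ∀ j, |μ j - w j| ≤ ω)
    (h₃ : ∀ ν ∈ 𝒩, ∀ μ ∈ ℳ, inner ℝ ν μ ≤ 1 + r) : |x i - σ| ≤ n * (2 * r) := by
  classical
  have hi : i ∈ H.coords := by simp [hH.2]
  let C : Set (E n) := {ν | ν i = σ ∧ inner ℝ ν x = (1 : ℝ) ∧ ∀ μ ∈ ℳ, inner ℝ ν μ ≤ 1 + r}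
  have hC : Convex ℝ C := by
    rintro a ⟨ha1, ha2, ha3⟩ b ⟨hb1, hb2, hb3⟩ s t hs ht hst
    refine ⟨?_, ?_, fun μ hμ => ?_⟩
    · simp only [PiLp.add_apply, PiLp.smul_apply, smul_eq_mul, ha1, hb1]
      rw [← add_mul, hst, one_mul]
    · rw [inner_add_left, real_inner_smul_left, real_inner_smul_left, ha2, hb2, mul_one, mul_one,
        hst]
    · rw [inner_add_left, real_inner_smul_left, real_inner_smul_left]
      calc s * inner ℝ a μ + t * inner ℝ b μ ≤ s * (1 + r) + t * (1 + r) :=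
            add_le_add (mul_le_mul_of_nonneg_left (ha3 μ hμ) hs)
              (mul_le_mul_of_nonneg_left (hb3 μ hμ) ht)
        _ = 1 + r := by rw [← add_mul, hst, one_mul]
  have hmem : ∀ u, H.dual.Vtx u → u i = σ → ∃ ν ∈ C, ∀ j, |ν j - u j| ≤ ω := fun u hu hui => by
    obtain ⟨ν, hν, h1, h2, h3⟩ := h₁ u hu hui
    exact ⟨ν, ⟨h1, h2, h₃ ν hν⟩, h3⟩
  have hne : C.Nonempty := by
    obtain ⟨u, hu, hui⟩ := exists_vtx_apply hH.1.dual (i := i) (by simpa using hi) hσ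
    obtain ⟨ν, hν, -⟩ := hmem u hu hui
    exact ⟨ν, hν⟩
  let B : Finset (Fin n) := Finset.univ.filter fun j => j ≠ i ∧ H.dual.Adjacent i j
  let A : Finset (Fin n) := Finset.univ.filter fun j => j ≠ i ∧ ¬ H.dual.Adjacent i j
  -- The sign pattern is prescribed freely except at `i`, where it has to be `σ`.
  have hover : ∀ τ : Fin n → SignType, (∀ k, τ k ≠ 0) → ∀ k, Function.update τ i σ k ≠ 0 :=
    fun τ hτ k => by
      by_cases hk : k = i
      · subst hk; simpa using hσ
      · simpa [hk] using hτ k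
  obtain ⟨N, ⟨hNi, hNx, hNμ⟩, hNB⟩ := exists_mem_forall_eq_zero hC hne (B := B) hω hωn
    fun τ hτ j hj => by
      obtain ⟨hji, hadj⟩ := (Finset.mem_filter.1 hj).2
      obtain ⟨u, hu, hui, huj, huk⟩ := hadj _ (hover τ hτ)
      obtain ⟨ν, hν, hνu⟩ := hmem u hu (by simpa using hui)
      refine ⟨ν, hν, le_sign_mul (hτ j) (by simpa [hji] using huj) (hνu j), fun k hk => ?_⟩
      have hki := (Finset.mem_filter.1 hk).2.1
      exact neg_le_sign_mul (hτ k) (by simpa [hki] using huk k) (hνu k)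
  have hinner : ∀ y : E n, inner ℝ N y = σ * y i + ∑ k ∈ A, N k * y k := fun y => by
    have e : inner ℝ N y = ∑ k, N k * y k := by
      rw [PiLp.inner_apply]
      exact Finset.sum_congr rfl fun k _ => by simp [mul_comm]
    rw [e, ← Finset.add_sum_erase _ _ (Finset.mem_univ i), hNi]
    congr 1
    symm
    refine Finset.sum_subset (fun k hk => ?_) fun k hk hkA => ?_
    · simp only [A, Finset.mem_filter] at hk
      simp [hk.2.1]
    · have hki := Finset.ne_of_mem_erase hk
      rw [hNB k (by
        simp only [A, B, Finset.mem_filter, Finset.mem_univ, true_and, not_and, not_not] at hkA ⊢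
        exact ⟨hki, hkA hki⟩), zero_mul]
  -- Choose a vertex whose signs agree with those of N on its support, containing i and the index j
  -- of the largest |N_j|. A μ near it has ⟨N, μ⟩ ≥ 1 + |N_j|/2, whereas ⟨N, μ⟩ ≤ 1 + r.
  have hA : ∀ k ∈ A, |N k| ≤ 2 * r := by
    rcases A.eq_empty_or_nonempty with hA | hA
    · simp [hA]
    obtain ⟨j, hj, hmax, hsum⟩ := exists_forall_half_abs_le_sum hA N hω hωn
    obtain ⟨hji, hadj⟩ := (Finset.mem_filter.1 hj).2
    have hadj' : H.Adjacent i j := (adjacent_or_adjacent hH.1 hji.symm hi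
      (by simp [hH.2])).resolve_right hadj
    obtain ⟨w, hw, hwi, hwj, hwk⟩ := hadj' _ (hover (fun k => sgn (N k)) fun k => sgn_ne_zero _)
    obtain ⟨μ, hμ, hμi, hμw⟩ := h₂ w hw (by simpa using hwi)
    have h1 := hsum μ (le_sign_mul (sgn_ne_zero _) (by simpa [hji] using hwj) (hμw j))
      fun k hk => neg_le_sign_mul (sgn_ne_zero _)
        (by simpa [(Finset.mem_filter.1 hk).2.1] using hwk k) (hμw k)
    have h2 := hNμ μ hμ
    rw [hinner, hμi] at h2
    have h3 : (σ : ℝ) * σ = 1 := by cases σ <;> simp at hσ ⊢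
    intro k hk
    linarith [hmax k hk]
  have h1 : |∑ k ∈ A, N k * x k| ≤ n * (2 * r) := by
    refine (Finset.abs_sum_le_sum_abs _ _).trans ?_
    calc ∑ k ∈ A, |N k * x k| ≤ ∑ k ∈ A, 2 * r := Finset.sum_le_sum fun k hk => by
          rw [abs_mul]
          exact (mul_le_of_le_one_right (abs_nonneg _) (hx k)).trans (hA k hk)
      _ = A.card * (2 * r) := by simp
      _ ≤ n * (2 * r) := by
          gcongr
          exact (Finset.card_le_univ _).trans_eq (Fintype.card_fin n)
  rw [hinner] at hNx
  have h2 : ∑ k ∈ A, N k * x k = 1 - σ * x i := by linarith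
  rw [h2] at h1
  refine le_trans (le_of_eq ?_) h1
  cases σ
  · exact absurd rfl hσ
  · rw [abs_sub_comm]; simp; rw [← abs_neg]; ring_nf
  · rw [abs_sub_comm]; simp

end HannerRep

/-! ### Projections to the span of the support of a vertex -/

theorem mem_suppSubspace {v x : E n} : x ∈ suppSubspace v ↔ ∀ i, v i = 0 → x i = 0 := by
  constructor
  · intro hx i hi
    induction hx using Submodule.span_induction with
    | mem y hy =>
      obtain ⟨j, hj, rfl⟩ := hy
      have : i ≠ j := fun h => hj (h ▸ hi)
      simp [stdVec, this]
    | zero => rfl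
    | add y z _ _ hy hz => simp [hy, hz]
    | smul a y _ hy => simp [hy]
  · intro hx
    rw [HannerRep.mem_span_single (S := Finset.univ.filter fun j => v j ≠ 0) (x := x)
      fun i hi => hx i (by simpa using hi)]
    refine Submodule.sum_mem _ fun i hi => Submodule.smul_mem _ _ (Submodule.subset_span ?_)
    exact ⟨i, by simpa using hi, rfl⟩

theorem starProjection_suppSubspace (v x : E n) :
    (suppSubspace v).starProjection x = restr (Finset.univ.filter fun j => v j ≠ 0) x := by
  refine Submodule.eq_starProjection_of_mem_orthogonal
    (mem_suppSubspace.2 fun i hi => by simp [hi]) ?_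
  rw [Submodule.mem_orthogonal]
  intro u hu
  rw [mem_suppSubspace] at hu
  simp only [PiLp.inner_apply]
  refine Finset.sum_eq_zero fun i _ => ?_
  by_cases hi : v i = 0
  · simp [hu i hi]
  · simp [hi]

/-- The cube is the convex hull of its vertices, so it suffices that the convex set K|ℝ^(v) + nr·B
contains them. The Euclidean norm is bounded by the ℓ₁-norm, which gives the factor n. -/
theorem hausdorffDist_suppProj_le {v : E n} {K : Set (E n)} (hK : Convex ℝ K)
    (hKc : K ⊆ cube n) {r : ℝ} (hr : 0 ≤ r)
    (h : ∀ w : Fin n → SignType, (∀ j, w j = 0 ↔ v j = 0) →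
      ∃ x ∈ K, ∀ j, v j ≠ 0 → |x j - w j| ≤ r) :
    Metric.hausdorffDist (suppProj v K) (suppCube v) ≤ n * r := by
  have hnr : 0 ≤ n * r := by positivity
  have hproj : ∀ x, (suppSubspace v).starProjection x =
    restr (Finset.univ.filter fun j => v j ≠ 0) x := starProjection_suppSubspace v
  have hconv : Convex ℝ (suppProj v K + Metric.closedBall (0 : E n) (n * r)) :=
    (hK.linear_image (suppSubspace v).starProjection.toLinearMap).add (convex_closedBall _ _)
  let L := (WithLp.linearEquiv 2 ℝ (Fin n → ℝ)).symm
  have hpre := hconv.linear_preimage L.toLinearMap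
  let t : Fin n → Set ℝ := fun j => if v j = 0 then {0} else {-1, 1}
  have hsub : Set.univ.pi t ⊆ L.toLinearMap ⁻¹'
      (suppProj v K + Metric.closedBall (0 : E n) (n * r)) := by
    intro a ha
    let w : Fin n → SignType := fun j => SignType.sign (a j)
    have ht : ∀ j, a j ∈ t j := fun j => ha j (Set.mem_univ j)
    have hw : ∀ j, (w j : ℝ) = a j := fun j => by
      have := ht j
      simp only [t] at this
      split_ifs at this with hj
      · rw [Set.mem_singleton_iff] at this; simp [w, this]
      · rcases this with h | h
        · simp [w, h]
        · rw [Set.mem_singleton_iff] at h; simp [w, h]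
    have hw0 : ∀ j, w j = 0 ↔ v j = 0 := fun j => by
      have := ht j
      simp only [t] at this
      split_ifs at this with hj
      · rw [Set.mem_singleton_iff] at this; simp [w, this, hj]
      · rcases this with h | h
        · simp [w, h, hj]
        · rw [Set.mem_singleton_iff] at h; simp [w, h, hj]
    obtain ⟨x, hx, hxw⟩ := h w hw0
    refine Set.mem_add.2 ⟨_, ⟨x, hx, rfl⟩, L a - (suppSubspace v).starProjection x, ?_, by simp⟩
    rw [mem_closedBall_zero_iff]
    refine (norm_le_sum_abs _).trans ?_
    calc _ ≤ ∑ j : Fin n, r := Finset.sum_le_sum fun j _ => ?_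
      _ = n * r := by simp
    rw [hproj, PiLp.sub_apply, abs_sub_comm]
    have hLa : L a j = w j := (hw j).symm
    rw [hLa]
    by_cases hj : v j = 0
    · simp [hj, (hw0 j).2 hj, hr]
    · simpa [hj] using hxw j hj
  have hsub2 := convexHull_min hsub hpre
  rw [convexHull_pi] at hsub2
  refine Metric.hausdorffDist_le_of_mem_dist hnr ?_ fun a ha => ?_
  · rintro _ ⟨x, hx, rfl⟩
    refine ⟨(suppSubspace v).starProjection x, ⟨fun i => ?_, Submodule.starProjection_apply_mem _ _⟩,
      by simpa using hnr⟩
    rw [hproj, restr_apply]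
    split_ifs
    · exact hKc hx i
    · simp
  · have h1 : WithLp.ofLp a ∈ Set.univ.pi fun j => convexHull ℝ (t j) := fun j _ => by
      simp only [t]
      split_ifs with hj
      · rw [convexHull_singleton]; exact mem_suppSubspace.1 ha.2 j hj
      · rw [convexHull_pair, segment_eq_Icc (by norm_num)]; exact abs_le.1 (ha.1 j)
    obtain ⟨y, hy, z, hz, hyz⟩ := Set.mem_add.1 (hsub2 h1)
    refine ⟨y, hy, ?_⟩
    have : a = y + z := hyz.symm
    rw [this, dist_eq_norm, add_sub_cancel_left]
    simpa using hz

theorem hausdorffDist_suppProj_le_natCast (v : E n) {K : Set (E n)} (hK : Convex ℝ K)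
    (hKc : K ⊆ cube n) (h0 : (0 : E n) ∈ K) :
    Metric.hausdorffDist (suppProj v K) (suppCube v) ≤ n := by
  refine (hausdorffDist_suppProj_le hK hKc zero_le_one fun w _ => ⟨0, h0, fun j _ => ?_⟩).trans_eq
    (mul_one _)
  cases w j <;> simp

end HannerMahler

end

/-! ### Contradiction from the absence of gain, and uniform constants. -/

noncomputable section

namespace HannerMahler

variable {n : ℕ}

theorem apply_eq_of_inner_single {ν : E n} {i : Fin n} {σ : SignType} (hσ : σ ≠ 0)
    (h : inner ℝ ν (EuclideanSpace.single i (σ : ℝ)) = (1 : ℝ)) : ν i = σ := by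
  rw [EuclideanSpace.inner_single_right] at h
  cases σ
  · exact absurd rfl hσ
  · simp at h ⊢; linarith
  · simpa using h

namespace HannerRep

theorem IsStandard.points_mem {H : HannerRep n} (hH : H.IsStandard) {s : Fin n → SignType}
    (hs : ¬ H.Vanish s) {ε : ℝ} {K : Set (E n)} (hK : H.Near ε K) :
    H.points K (H.faceSet s) ∈ K := by
  obtain ⟨p, q, hA⟩ := exists_touchesAt_affSub hH.1 hs
  exact mem_of_isTangencyPoint hK.isCompact (hA.tangencyPoint_spec hK _)

theorem IsStandard.eq_faceSet_of_mem_flags {H : HannerRep n} (hH : H.IsStandard)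
    {f : Fin n → Set (E n)} (hf : f ∈ flags H.body) {v : Fin n → SignType} (hv : ¬ H.Vanish v)
    {k : Fin n} (hk : (k : ℕ) = 0) (h : H.faceSet v ⊆ f k) : f k = H.faceSet v := by
  obtain ⟨s, hs, e⟩ := hH.isFace_iff.1 (hf.1 k).1
  have hd := (hf.1 k).2
  rw [e] at h hd ⊢
  by_contra hne
  have := faceSet_ssubset_dim_lt hH.1 hv (h.ssubset_of_ne (Ne.symm hne))
  omega

/-- The normals of the simplices over the flags whose supporting half-spaces almost contain `K`. -/
def normals (H : HannerRep n) (K : Set (E n)) (ω ρ : ℝ) : Set (E n) :=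
  {ν | ∃ f ∈ flags H.body, (∀ k, inner ℝ ν (H.points K (f k)) = (1 : ℝ)) ∧
    (∀ u, H.dual.Vtx u → (∀ k, f k ⊆ H.faceSet u) → ∀ j, |ν j - u j| ≤ ω) ∧
    ∀ y ∈ K, inner ℝ ν y < 1 + ρ}

/-- The point ν/(1 + ρ) lies in K°, so μ may be tested on it; this gives ⟨ν, μ⟩ ≤ (1 + ρ)² ≤ 1 + 3ρ.
-/
theorem inner_le_of_mem_normals {H H' : HannerRep n} {K : Set (E n)} {ω ρ : ℝ} (hρ : 0 ≤ ρ)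
    (hρ1 : ρ ≤ 1) {ν μ : E n} (hν : ν ∈ H.normals K ω ρ)
    (hμ : μ ∈ H'.normals (polarBody K) ω ρ) : inner ℝ ν μ ≤ 1 + 3 * ρ := by
  obtain ⟨-, -, -, -, hν⟩ := hν
  obtain ⟨-, -, -, -, hμ⟩ := hμ
  have hpos : 0 < 1 + ρ := by positivity
  have h1 : (1 + ρ)⁻¹ • ν ∈ polarBody K := fun a ha => by
    rw [real_inner_smul_right, real_inner_comm, inv_mul_le_iff₀ hpos, mul_one]
    exact (hν a ha).le
  have h2 := hμ _ h1
  rw [real_inner_smul_right, real_inner_comm, inv_mul_lt_iff₀ hpos] at h2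
  nlinarith

/-- The flag from v to u through {x_i = v_i} yields the three properties of its normal: the middle
face fixes ν_i, the first face gives ⟨ν, x_v⟩ = 1, the facet gives ν ≈ u. -/
theorem IsStandard.exists_mem_normals {H : HannerRep n} (hH : H.IsStandard) (hn : 0 < n)
    {K : Set (E n)} {ε ω ρ : ℝ} (hK : H.Near ε K)
    (hall : ∀ f ∈ flags H.body, ∃ ν : E n, (∀ k, inner ℝ ν (H.points K (f k)) = (1 : ℝ)) ∧
      (∀ u, H.dual.Vtx u → (∀ k, f k ⊆ H.faceSet u) → ∀ j, |ν j - u j| ≤ ω) ∧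
      ∀ y ∈ K, inner ℝ ν y < 1 + ρ)
    {i : Fin n} {v u : Fin n → SignType} (hv : H.Vtx v) (hu : H.dual.Vtx u) (hvi : v i ≠ 0)
    (hvu : v i = u i) :
    ∃ ν ∈ H.normals K ω ρ, ν i = v i ∧ inner ℝ ν (H.points K (H.faceSet v)) = (1 : ℝ) ∧
      ∀ j, |ν j - u j| ≤ ω := by
  obtain ⟨f, hf, hfv, hfu, k, hk⟩ := hH.exists_flag hv hu hvi hvu
  obtain ⟨ν, hν, hνu, hνy⟩ := hall f hf
  refine ⟨ν, ⟨f, hf, hν, hνu, hνy⟩, apply_eq_of_inner_single hvi ?_, ?_, hνu u hu hfu⟩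
  · have := hν k
    rw [hk, hH.points_single (i := i) (fun j hj => by simp [hj]) (by simpa using hvi) hK] at this
    simpa using this
  · rw [← hH.eq_faceSet_of_mem_flags hf hv.not_vanish (k := ⟨0, hn⟩) rfl (hfv _)]
    exact hν _

/-- Every sign change of a vertex of H is again a vertex with the same support, so each vertex of
the cube B_∞^(v) is approximated by the tangency point of some vertex of H. -/
theorem IsStandard.hausdorffDist_le {H : HannerRep n} (hH : H.IsStandard) (hn : 0 < n)
    {K : Set (E n)} {ε ω ρ : ℝ} (hε : 0 ≤ ε) (hK : H.Near ε K) (hω : 0 ≤ ω)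
    (hωn : (n + 1) * ω ≤ 1 / 2) (hρ : 0 ≤ ρ) (hρ1 : ρ ≤ 1)
    (h₁ : ∀ f ∈ flags H.body, ∃ ν : E n, (∀ k, inner ℝ ν (H.points K (f k)) = (1 : ℝ)) ∧
      (∀ u, H.dual.Vtx u → (∀ k, f k ⊆ H.faceSet u) → ∀ j, |ν j - u j| ≤ ω) ∧
      ∀ y ∈ K, inner ℝ ν y < 1 + ρ)
    (h₂ : ∀ f ∈ flags H.dual.body, ∃ ν : E n,
      (∀ k, inner ℝ ν (H.dual.points (polarBody K) (f k)) = (1 : ℝ)) ∧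
      (∀ u, H.dual.dual.Vtx u → (∀ k, f k ⊆ H.dual.faceSet u) → ∀ j, |ν j - u j| ≤ ω) ∧
      ∀ y ∈ polarBody K, inner ℝ ν y < 1 + ρ)
    {v : E n} {s : Fin n → SignType} (hs : H.Vtx s) (hvs : ∀ j, v j = s j) :
    Metric.hausdorffDist (suppProj v K) (suppCube v) ≤ n * (n * (2 * (3 * ρ))) := by
  refine hausdorffDist_suppProj_le hK.convex hK.subset_cube (by positivity) fun w hw => ?_
  have hsv : ∀ j, w j = 0 ↔ s j = 0 := fun j => by
    rw [hw, hvs]; cases s j <;> simp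
  have hwv : H.Vtx w := (H.vtx_congr fun j _ => hsv j).2 hs
  have hmem := hH.points_mem hwv.not_vanish hK
  refine ⟨_, hmem, fun i hi => ?_⟩
  have hwi : w i ≠ 0 := fun h => hi ((hw i).1 h)
  refine abs_sub_le_of_normals hH hwi (hK.subset_cube hmem) (by positivity) hω hωn
    (𝒩 := H.normals K ω ρ) (ℳ := H.dual.normals (polarBody K) ω ρ) (fun u hu hui => ?_)
    (fun w' hw' hwi' => ?_) fun ν hν μ hμ => inner_le_of_mem_normals hρ hρ1 hν hμ
  · exact hH.exists_mem_normals hn hK h₁ hwv hu hwi hui.symm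
  · obtain ⟨u, hu, hui⟩ := exists_vtx_apply hH.1.dual (i := i) (by simp [hH.2]) hwi
    obtain ⟨μ, hμ, hμi, -, hμw⟩ := hH.dual.exists_mem_normals hn (hK.polar hH hε) h₂ hu
      (u := w') (by simpa using hw') (hui ▸ hwi) (hui.trans hwi'.symm)
    exact ⟨μ, hμ, hμi.trans (by rw [hui]), hμw⟩

theorem IsStandard.exists_vtx_of_isVertex {H : HannerRep n} (hH : H.IsStandard) {v : E n}
    (hv : IsVertex H.body v) : ∃ s, H.Vtx s ∧ ∀ j, v j = s j := by
  obtain ⟨s, hs, e⟩ := hH.isFace_iff.1 hv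
  have hvtx := vtx_of_faceSet_subset hH.1 hs e.ge
  have hp := (H.relInt_pt s).mem_faceSet hH.1 hs
  rw [← e, Set.mem_singleton_iff] at hp
  refine ⟨s, hvtx, fun j => ?_⟩
  rw [← hp]
  exact (H.relInt_pt s).apply_of_vtx hH.1 hvtx (by simp [hH.2])

/-- The conclusion for one representation, with constants `c` and `η`. -/
def Gain (H : HannerRep n) (c η : ℝ) : Prop :=
  ∀ K : Set (E n), IsSymmConvexBody K → crossPolytope n ⊆ K → K ⊆ cube n →
    Metric.hausdorffDist K H.body ≤ η → ∀ v : E n, IsVertex H.body v → ∀ δ : ℝ, 0 < δ →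
    Metric.hausdorffDist (suppProj v K) (suppCube v) = δ →
    volFun H.body (H.points K) * volFun H.body (H.dualPoints K) + ENNReal.ofReal (c * δ) ≤
      volume K * volume (polarBody K)

theorem Gain.mono {H : HannerRep n} {c c' η η' : ℝ} (h : H.Gain c η) (hc : c' ≤ c) (hη : η' ≤ η) :
    H.Gain c' η' := fun K hK h1 h2 hd v hv δ hδ e =>
  le_trans (by gcongr) (h K hK h1 h2 (hd.trans hη) v hv δ hδ e)

/-- A gain in one factor becomes a gain in the product, because the other factor is bounded below.
-/
theorem mul_add_ofReal_le {V W W' a b : ENNReal} {x y : ℝ} (hx : 0 ≤ x) (hW : W ≤ W')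
    (hy : ENNReal.ofReal y ≤ W') (ha : V + ENNReal.ofReal x ≤ a) (hb : W' ≤ b) :
    V * W + ENNReal.ofReal (x * y) ≤ a * b :=
  calc V * W + ENNReal.ofReal (x * y) ≤ V * W' + ENNReal.ofReal x * W' := by
        rw [ENNReal.ofReal_mul hx]; gcongr
    _ = (V + ENNReal.ofReal x) * W' := (add_mul _ _ _).symm
    _ ≤ a * b := by gcongr

theorem IsStandard.exists_gain_constants {H : HannerRep n} (hH : H.IsStandard) (hn : 0 < n) :
    ∃ c : ℝ, 0 < c ∧ ∃ η : ℝ, 0 < η ∧ H.Gain c η := by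
  have hn' : (0 : ℝ) < n := Nat.cast_pos.2 hn
  have hn1 : (1 : ℝ) ≤ n := by exact_mod_cast hn
  obtain ⟨c₁, hc₁, hg₁⟩ := hH.exists_gain hn
  obtain ⟨c₂, hc₂, hg₂⟩ := hH.dual.exists_gain hn
  let ω : ℝ := 1 / (2 * (n + 1))
  have hω : 0 < ω := by positivity
  obtain ⟨ε₁, hε₁, hg₁⟩ := hg₁ ω hω
  obtain ⟨ε₂, hε₂, hg₂⟩ := hg₂ ω hω
  let ε : ℝ := min ε₁ ε₂
  have hε : 0 < ε := lt_min hε₁ hε₂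
  refine ⟨c₁ * c₂ / (12 * n ^ 2), by positivity, ε / n, by positivity, ?_⟩
  intro K hK h1 h2 hd v hv δ hδ e
  have hN : H.Near ε K := near_of_hausdorffDist hH hε hK h1 h2 (by
    rwa [le_div_iff₀ hn', mul_comm] at hd)
  have hN' := hN.polar hH hε.le
  have hg₁ := hg₁ ε hε.le (min_le_left _ _) K hN
  have hg₂ := hg₂ ε hε.le (min_le_right _ _) _ hN'
  obtain ⟨s, hs, hvs⟩ := hH.exists_vtx_of_isVertex hv
  have hvan := hs.not_vanish
  simp only [Vanish, not_forall] at hvan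
  obtain ⟨i, hi, hsi⟩ := hvan
  obtain ⟨u, hu, hui⟩ := exists_vtx_apply hH.1.dual (i := i) (by simpa using hi) hsi
  -- One flag on each side suffices to extract V ≤ volume (the case of excess 0) and the lower
  -- bounds for V from `exists_gain`.
  obtain ⟨f, hf, -⟩ := hH.exists_flag hs hu hsi hui.symm
  obtain ⟨g, hg, -⟩ := hH.dual.exists_flag hu (u := s) (by simpa using hs) (hui ▸ hsi) hui
  have hb₁ : volFun H.body (H.points K) ≤ volume K := by
    obtain ⟨-, ν, hν, -, hy⟩ := hg₁ f hf
    have hmem : H.points K (f ⟨0, hn⟩) ∈ K := by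
      obtain ⟨t, ht, e⟩ := hH.isFace_iff.1 (hf.1 ⟨0, hn⟩).1
      exact e ▸ hH.points_mem ht hN
    exact le_self_add.trans (hy _ hmem 0 le_rfl (by rw [hν, add_zero]))
  have hb₂ : volFun H.dual.body (H.dual.points (polarBody K)) ≤ volume (polarBody K) := by
    obtain ⟨-, ν, hν, -, hy⟩ := hg₂ g hg
    have hmem : H.dual.points (polarBody K) (g ⟨0, hn⟩) ∈ polarBody K := by
      obtain ⟨t, ht, e⟩ := hH.dual.isFace_iff.1 (hg.1 ⟨0, hn⟩).1
      exact e ▸ hH.dual.points_mem ht hN'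
    exact le_self_add.trans (hy _ hmem 0 le_rfl (by rw [hν, add_zero]))
  have hdual := hH.volFun_dualPoints_le K
  -- With this choice the bound n · n · 2 · 3ρ of `IsStandard.hausdorffDist_le` equals δ/2, which is
  -- less than δ. The inequality δ ≤ n ensures ρ ≤ 1.
  let ρ : ℝ := δ / (12 * n ^ 2)
  have hρ : 0 < ρ := by positivity
  have hδn : δ ≤ n := e ▸ hausdorffDist_suppProj_le_natCast v hN.convex h2 hN.zero_mem
  have hρ1 : ρ ≤ 1 := by
    rw [div_le_one (by positivity)]
    nlinarith
  -- A point of K or of K° beyond a simplex of some flag by ρ would prove the inequality, so under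
  -- `hcon` there is none.
  by_contra hcon
  have hno₁ : ∀ f ∈ flags H.body, ∃ ν : E n, (∀ k, inner ℝ ν (H.points K (f k)) = (1 : ℝ)) ∧
      (∀ u, H.dual.Vtx u → (∀ k, f k ⊆ H.faceSet u) → ∀ j, |ν j - u j| ≤ ω) ∧
      ∀ y ∈ K, inner ℝ ν y < 1 + ρ := fun f hf => by
    obtain ⟨-, ν, hν, hνu, hy⟩ := hg₁ f hf
    refine ⟨ν, hν, hνu, fun y hyK => lt_of_not_ge fun hge => hcon ?_⟩
    refine le_trans (le_of_eq ?_) (mul_add_ofReal_le (by positivity) hdual (hg₂ g hg).1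
      (hy y hyK ρ hρ.le hge) hb₂)
    congr 2
    simp only [ρ]; ring
  have hno₂ : ∀ f ∈ flags H.dual.body, ∃ ν : E n,
      (∀ k, inner ℝ ν (H.dual.points (polarBody K) (f k)) = (1 : ℝ)) ∧
      (∀ u, H.dual.dual.Vtx u → (∀ k, f k ⊆ H.dual.faceSet u) → ∀ j, |ν j - u j| ≤ ω) ∧
      ∀ y ∈ polarBody K, inner ℝ ν y < 1 + ρ := fun f' hf' => by
    obtain ⟨-, ν, hν, hνu, hy⟩ := hg₂ f' hf'
    refine ⟨ν, hν, hνu, fun y hyK => lt_of_not_ge fun hge => hcon ?_⟩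
    rw [mul_comm (volume K), mul_comm (volFun H.body (H.points K))]
    refine le_trans ?_ (mul_add_ofReal_le (x := c₂ * ρ) (y := c₁) (by positivity) le_rfl (hg₁ f hf).1
      (hy y hyK ρ hρ.le hge) hb₁)
    refine add_le_add (mul_le_mul_left hdual _) (ENNReal.ofReal_le_ofReal (le_of_eq ?_))
    simp only [ρ]; ring
  have hle := hH.hausdorffDist_le hn hε.le hN hω.le (le_of_eq (by simp only [ω]; field_simp)) hρ.le
    hρ1 hno₁ hno₂ hs hvs
  rw [e] at hle
  have : n * (n * (2 * (3 * ρ))) = δ / 2 := by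
    simp only [ρ]; field_simp; norm_num
  linarith

/-- Every summand uses at least one coordinate, so both parts of a direct sum live on proper subsets
of S and strong induction applies. -/
theorem finite_isDirect_coords_eq (S : Finset (Fin n)) :
    {H : HannerRep n | H.IsDirect ∧ H.coords = S}.Finite := by
  classical
  induction S using Finset.strongInduction with
  | H S ih =>
    let U : Set (HannerRep n) := ⋃ T ∈ S.ssubsets, {H | H.IsDirect ∧ H.coords = T}
    have hU : U.Finite := S.ssubsets.finite_toSet.biUnion fun T hT =>
      ih T (Finset.mem_ssubsets.1 hT)
    have hsub : ∀ H₁ H₂ : HannerRep n, H₁.IsDirect → H₂.IsDirect →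
        Disjoint H₁.coords H₂.coords → H₁.coords ∪ H₂.coords = S → H₁ ∈ U ∧ H₂ ∈ U := by
      intro H₁ H₂ hd₁ hd₂ hdis hS
      have hmem : ∀ H : HannerRep n, H.IsDirect → H.coords ⊂ S → H ∈ U := fun H hd h => by
        simp only [U, Set.mem_iUnion]
        exact ⟨H.coords, Finset.mem_ssubsets.2 h, hd, rfl⟩
      obtain ⟨i, hi⟩ := H₁.coords_nonempty
      obtain ⟨j, hj⟩ := H₂.coords_nonempty
      refine ⟨hmem H₁ hd₁ ?_, hmem H₂ hd₂ ?_⟩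
      · exact (Finset.ssubset_iff_of_subset (hS ▸ Finset.subset_union_left)).2
          ⟨j, hS ▸ Finset.mem_union_right _ hj, Finset.disjoint_right.1 hdis hj⟩
      · exact (Finset.ssubset_iff_of_subset (hS ▸ Finset.subset_union_right)).2
          ⟨i, hS ▸ Finset.mem_union_left _ hi, Finset.disjoint_left.1 hdis hi⟩
    refine (((Set.finite_range interval).union (hU.image2 sumOne hU)).union
      (hU.image2 sumInf hU)).subset ?_
    rintro H ⟨hd, hS⟩
    cases H with
    | interval i => exact Or.inl (Or.inl ⟨i, rfl⟩)
    | sumOne H₁ H₂ =>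
      obtain ⟨m₁, m₂⟩ := hsub H₁ H₂ hd.1 hd.2.1 hd.2.2 hS
      exact Or.inl (Or.inr ⟨H₁, m₁, H₂, m₂, rfl⟩)
    | sumInf H₁ H₂ =>
      obtain ⟨m₁, m₂⟩ := hsub H₁ H₂ hd.1 hd.2.1 hd.2.2 hS
      exact Or.inr ⟨H₁, m₁, H₂, m₂, rfl⟩

theorem exists_gain_constants_of_finite {𝓗 : Set (HannerRep n)} (hfin : 𝓗.Finite)
    (h : ∀ H ∈ 𝓗, ∃ c : ℝ, 0 < c ∧ ∃ η : ℝ, 0 < η ∧ H.Gain c η) :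
    ∃ c : ℝ, 0 < c ∧ ∃ η : ℝ, 0 < η ∧ ∀ H ∈ 𝓗, H.Gain c η := by
  induction 𝓗, hfin using Set.Finite.induction_on with
  | empty => exact ⟨1, one_pos, 1, one_pos, fun H hH => hH.elim⟩
  | insert _ _ ih =>
    obtain ⟨c₁, hc₁, η₁, hη₁, h₁⟩ := ih fun H hH => h H (Set.mem_insert_of_mem _ hH)
    obtain ⟨c₂, hc₂, η₂, hη₂, h₂⟩ := h _ (Set.mem_insert _ _)
    refine ⟨min c₁ c₂, lt_min hc₁ hc₂, min η₁ η₂, lt_min hη₁ hη₂, ?_⟩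
    rintro H (rfl | hH)
    · exact h₂.mono (min_le_right _ _) (min_le_right _ _)
    · exact (h₁ H hH).mono (min_le_left _ _) (min_le_left _ _)

end HannerRep

end HannerMahler

end

theorem mainTheorem6 (n : ℕ) :
    ∃ c : ℝ, 0 < c ∧ ∃ η : ℝ, 0 < η ∧
      ∀ H : HannerMahler.HannerRep n, H.IsStandard →
      ∀ K : Set (HannerMahler.E n), HannerMahler.IsSymmConvexBody K →
        HannerMahler.crossPolytope n ⊆ K → K ⊆ HannerMahler.cube n →
        Metric.hausdorffDist K H.body ≤ η →
      ∀ v : HannerMahler.E n, HannerMahler.IsVertex H.body v →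
      ∀ δ : ℝ, 0 < δ →
        Metric.hausdorffDist (HannerMahler.suppProj v K) (HannerMahler.suppCube v) = δ →
        HannerMahler.volFun H.body (H.points K) * HannerMahler.volFun H.body (H.dualPoints K)
            + ENNReal.ofReal (c * δ)
          ≤ MeasureTheory.volume K * MeasureTheory.volume (HannerMahler.polarBody K) := by
  obtain ⟨c, hc, η, hη, h⟩ := HannerMahler.HannerRep.exists_gain_constants_of_finite
    (HannerMahler.HannerRep.finite_isDirect_coords_eq (Finset.univ : Finset (Fin n)))
    fun H hH => by
      -- A representation contains an interval, hence 0 < n; for n = 0 there is nothing to prove.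
      obtain ⟨i, -⟩ := H.coords_nonempty
      exact HannerMahler.HannerRep.IsStandard.exists_gain_constants hH i.pos
  exact ⟨c, hc, η, hη, fun H hH => h H hH⟩
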